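/- Let $0<\lambda<\mu$ and consider an M/M/1/$\infty$/FIFO queue in equilibrium on the time axis $\mathbb R$: the customers $n\in\mathbb Z$ arrive at the instants $\cdots<A_{-1}<A_0\le 0<A_1<\cdots$ of a homogeneous Poisson process of intensity $\lambda$; their service times $\sigma_n$ are i.i.d. exponential of parameter $\mu$ and independent of $(A_n)_n$; the instant $S_n$ at which the service of customer $n$ begins satisfies $S_{n+1}=\max(A_{n+1},\,S_n+\sigma_n)$; and the law of the queue length $Q_t=\#\{n: A_n\le t<S_n+\sigma_n\}$ does not depend on $t\in\mathbb R$. Let $\xi_n=S_{n+1}-S_n$, and let $\nu$ be the law of $\xi_*$ for a generic customer $*$, that is, the Palm distribution $$\nu(B)=\frac{\mathbb E\big[\#\{n: A_n\in(0,1],\ \xi_n\in B\}\big]}{\mathbb E\big[\#\{n: A_n\in(0,1]\}\big]}\,.$$ Then $\nu$ is a probability distribution whose Laplace transform is, for all $s\in\mathbb C$ with $\mathrm{Re}(s)\ge 0$, $$\int e^{-sx}\,d\nu(x)=\frac{\lambda\big(\mu^2(\lambda+\mu)+\mu(2\mu+\lambda)s+\lambda s^2\big)}{\mu(\lambda+s)(\mu+s)(\lambda+\mu+s)}\,.$$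 In particular $\nu$ is not an exponential distribution. The point process $(S_n)_{n\in\mathbb Z}$ of the instants of beginning of service is not a homogeneous Poisson process of any intensity, whereas the point process $(S_n+\sigma_n)_{n\in\mathbb Z}$ of the departure instants is a homogeneous Poisson process of intensity $\lambda$. -/

import Mathlib

open MeasureTheory ProbabilityTheory

namespace MM1

variable {Ω : Type*} [MeasurableSpace Ω]

/-- The number of points of the point process `(X n)`, `n ∈ ℤ`, that lie in `I`. -/
noncomputable def count (X : ℤ → Ω → ℝ) (I : Set ℝ) (ω : Ω) : ℕ∞ :=
  Set.encard {n : ℤ | X n ω ∈ I}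

/-- The random points `X n` form a homogeneous Poisson process on `ℝ` of intensity `a`: the
number of points in `(u, v]` has the Poisson law of parameter `a * (v - u)`, and the numbers of
points in successive intervals are independent. -/
structure IsPoissonProcess (P : Measure Ω) (X : ℤ → Ω → ℝ) (a : ℝ) : Prop where
  law : ∀ u v : ℝ, u ≤ v →
    HasLaw (count X (Set.Ioc u v))
      ((poissonMeasure (a * (v - u)).toNNReal).map (fun k : ℕ => (k : ℕ∞))) P
  indep : ∀ t : ℕ → ℝ, Monotone t →
    iIndepFun (fun i : ℕ => count X (Set.Ioc (t i) (t (i + 1)))) P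

/-- The instant at which customer `n` leaves the queue: its beginning of service plus its
service time. -/
def departure (S σ : ℤ → Ω → ℝ) (n : ℤ) (ω : Ω) : ℝ := S n ω + σ n ω

/-- The number of customers present (in service or in the buffer) at time `t`, where `A`, `S`, `σ`
are the arrival instants, the instants of beginning of service and the service times. -/
noncomputable def queueLength (A S σ : ℤ → Ω → ℝ) (t : ℝ) (ω : Ω) : ℕ∞ :=
  Set.encard {n : ℤ | A n ω ≤ t ∧ t < departure S σ n ω}

/-- The M/M/1/∞/FIFO queue in equilibrium, on the time axis `ℝ`, with arrival instants `A n`,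
service times `σ n` and instants of beginning of service `S n` of the customers `n ∈ ℤ`. -/
structure IsEquilibriumMM1 (P : Measure Ω) (lam mu : ℝ) (A σ S : ℤ → Ω → ℝ) : Prop where
  measurable_arrival : ∀ n, Measurable (A n)
  measurable_service : ∀ n, Measurable (σ n)
  measurable_start : ∀ n, Measurable (S n)
  /-- customers are numbered by order of arrival -/
  arrival_strictMono : ∀ᵐ ω ∂P, StrictMono fun n => A n ω
  /-- the usual numbering: customer `0` is the last one to arrive up to time `0` -/
  arrival_zero : ∀ᵐ ω ∂P, A 0 ω ≤ 0 ∧ 0 < A 1 ω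
  arrival_poisson : IsPoissonProcess P A lam
  service_law : ∀ n, HasLaw (σ n) (expMeasure mu) P
  service_indep : iIndepFun σ P
  arrival_indep_service : IndepFun (fun ω n => A n ω) (fun ω n => σ n ω) P
  /-- FIFO with a single server: a service begins as soon as the customer has arrived and the
  previous customer has left -/
  fifo : ∀ᵐ ω ∂P, ∀ n, S (n + 1) ω = max (A (n + 1) ω) (departure S σ n ω)
  /-- equilibrium: the law of the queue length does not depend on time -/
  stationary : ∀ t : ℝ, IdentDistrib (queueLength A S σ t) (queueLength A S σ 0) P P

/-- The law of the characteristic `ξ` of a generic customer (its Palm distribution): the expected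
number of the customers arriving in the time window `(0, 1]` whose characteristic lies in a given
set, divided by the expected number of all customers arriving in that window. -/
noncomputable def genericLaw (P : Measure Ω) (A ξ : ℤ → Ω → ℝ) : Measure ℝ :=
  (∑' n : ℤ, P {ω | A n ω ∈ Set.Ioc 0 1})⁻¹ •
    Measure.sum fun n : ℤ => (P.restrict {ω | A n ω ∈ Set.Ioc 0 1}).map (ξ n)

/-- The duration between the beginnings of service of customers `n` and `n + 1`. -/
def interStart (S : ℤ → Ω → ℝ) (n : ℤ) (ω : Ω) : ℝ := S (n + 1) ω - S n ω

end MM1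

open MeasureTheory ProbabilityTheory
open scoped ENNReal NNReal Topology


namespace MM1

/-! ### Exponential laws -/

/-! Write `a = λ`, `b = μ - λ` and `ρ = λ/μ`. Everything is read backwards from a fixed time `t`.
The time elapsed since the last arrival and the preceding interarrival times are i.i.d. exponential
of parameter `a`, and the corresponding service times are i.i.d. exponential of parameter `a + b`,
independent of them (`map_past`). The Poisson property only speaks of counts; it determines the law
of the points because an ordered sequence is recovered from its counts in finer and finer cells
(`map_eq_map_of_cells`).

Sojourn times obey the Lindley recursion. Were the server never idle before some time, the queue
would have been arbitrarily long in the remote past, which stationarity of the queue length excludes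
(`IsEquilibriumMM1.ae_idle`). Infinitely many idle periods single out one solution of the recursion:
a supremum of partial sums with negative drift (`sojourn`), an explicit function of the past.

Departures. If `X`, `T`, `V` are independent exponentials of parameters `a`, `b`, `a + b`, then `V +
(X - T)⁺` and `V + (T - X)⁺` are independent exponentials of parameters `a` and `b` (`output_step`).
Iterating this step and letting the starting customer recede to `-∞` shows that the sojourn time of
the last customer is independent of the past interdeparture times, themselves i.i.d. exponential of
parameter `a` (`map_sojourn_outputGaps`). Letting the observation time tend to `+∞` yields the
Poisson departures.

Beginnings of service. A gap is `max (X - W) V`, where the waiting time `W`, the next interarrival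
time `X` and the service time `V` are independent. Hence its distribution function is `(1 - (1 - ρ²)
e^{-ay}) (1 - e^{-(a+b)y})`, so that its law is a signed mixture of three exponential laws
(`startGapLaw_add`). This gives the Laplace transform, which is not that of an exponential law. The
Palm distribution is identified with this law by observing the window `(0, 1]` from a late time
(`IsEquilibriumMM1.tsum_interStart`). If the beginnings of service were Poisson, the gaps before
time `0` would be exponential; they are the gaps of fixed customers up to a random shift of the
index, which averaging makes negligible, and this contradicts the shape of the law. -/

instance isProbabilityMeasure_exp (r : ℝ) [hr : Fact (0 < r)] :
    IsProbabilityMeasure (expMeasure r) := isProbabilityMeasure_expMeasure hr.out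

lemma lintegral_exp (r : ℝ) {f : ℝ → ℝ≥0∞} (hf : Measurable f) :
    ∫⁻ x, f x ∂(expMeasure r) =
      ∫⁻ x in Set.Ici 0, ENNReal.ofReal (r * Real.exp (-(r * x))) * f x := by
  have h : expMeasure r = volume.withDensity (exponentialPDF r) := rfl
  have hm : Measurable (exponentialPDF r) := (measurable_exponentialPDFReal r).ennreal_ofReal
  rw [h, lintegral_withDensity_eq_lintegral_mul _ hm hf, ← lintegral_indicator measurableSet_Ici]
  refine lintegral_congr fun x => ?_
  by_cases hx : 0 ≤ x
  · simp [hx, exponentialPDF_of_nonneg hx]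
  · simp [hx, exponentialPDF_of_neg (not_le.mp hx)]

lemma ae_nonneg_exp (r : ℝ) : ∀ᵐ x ∂(expMeasure r), 0 ≤ x := by
  rw [ae_iff, ← lintegral_indicator_one (by measurability), lintegral_exp r (by
    exact measurable_one.indicator (by measurability))]
  rw [setLIntegral_congr_fun (g := fun _ => 0) measurableSet_Ici]
  · simp
  · intro x hx
    have : (0 : ℝ) ≤ x := hx
    simp [this]

lemma exp_singleton (r x : ℝ) : expMeasure r {x} = 0 := by
  have h : expMeasure r = volume.withDensity (exponentialPDF r) := rfl
  rw [h]
  exact withDensity_absolutelyContinuous _ _ (by simp)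

lemma ae_pos_exp (r : ℝ) : ∀ᵐ x ∂(expMeasure r), 0 < x := by
  have h0 : ∀ᵐ x ∂(expMeasure r), x ≠ 0 := by
    rw [ae_iff]; simpa using exp_singleton r 0
  filter_upwards [ae_nonneg_exp r, h0] with x h1 h2 using lt_of_le_of_ne h1 (Ne.symm h2)

/-- Memorylessness. -/
lemma exp_memoryless {r y : ℝ} (hy : 0 ≤ y) :
    ((expMeasure r).restrict (Set.Ici y)).map (fun x => x - y) =
      ENNReal.ofReal (Real.exp (-(r * y))) • expMeasure r := by
  refine Measure.ext_of_lintegral _ fun f hf => ?_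
  rw [lintegral_map hf (by fun_prop), lintegral_smul_measure, lintegral_exp r hf,
    ← lintegral_indicator measurableSet_Ici,
    lintegral_exp r ((by fun_prop : Measurable fun x => f (x - y)).indicator measurableSet_Ici),
    smul_eq_mul, ← lintegral_const_mul _ (by fun_prop), ← lintegral_indicator measurableSet_Ici,
    -- Translating the integration variable by `y` reduces the claim to an equality of integrands.
    ← lintegral_indicator measurableSet_Ici, ← lintegral_add_right_eq_self _ y]
  refine lintegral_congr fun x => ?_
  by_cases hx : 0 ≤ x
  · have h1 : 0 ≤ x + y := by positivity
    simp only [Set.indicator, Set.mem_Ici, h1, hx, if_true, le_add_iff_nonneg_left,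
      add_sub_cancel_right]
    rw [← mul_assoc, ← ENNReal.ofReal_mul (by positivity)]
    congr 2
    rw [mul_left_comm, ← Real.exp_add]
    ring_nf
  · simp [Set.indicator, hx]

lemma integrable_exp_id (r : ℝ) [hr : Fact (0 < r)] :
    Integrable (fun x : ℝ => x) (expMeasure r) ∧ ∫ x, x ∂(expMeasure r) = r⁻¹ := by
  have hr0 := hr.out
  have h : expMeasure r = volume.withDensity (exponentialPDF r) := rfl
  have hG : IntegrableOn (fun x : ℝ => x * (r * Real.exp (-(r * x)))) (Set.Ioi 0) := by
    have := integrableOn_rpow_mul_exp_neg_mul_rpow (s := 1) (p := 1) (b := r) (by norm_num)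
      one_pos hr0
    refine IntegrableOn.congr_fun (Integrable.const_mul this r) (fun x hx => ?_) measurableSet_Ioi
    simp only [Real.rpow_one, neg_mul]
    ring
  have hind : ∀ x : ℝ, (exponentialPDF r x).toReal • x =
      (Set.Ici 0).indicator (fun x : ℝ => x * (r * Real.exp (-(r * x)))) x := by
    intro x
    by_cases hx : 0 ≤ x
    · rw [exponentialPDF_of_nonneg hx, ENNReal.toReal_ofReal (by positivity)]
      simp [hx]; ring
    · simp [hx, exponentialPDF_of_neg (not_le.mp hx)]
  have hm : Measurable (exponentialPDF r) := (measurable_exponentialPDFReal r).ennreal_ofReal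
  have hlt : ∀ᵐ x, exponentialPDF r x < ∞ := .of_forall fun x => ENNReal.ofReal_lt_top
  constructor
  · rw [h, integrable_withDensity_iff_integrable_smul' hm hlt]
    simp_rw [hind]
    rw [integrable_indicator_iff measurableSet_Ici, integrableOn_Ici_iff_integrableOn_Ioi]
    exact hG
  · rw [h, integral_withDensity_eq_integral_toReal_smul hm hlt]
    simp_rw [hind]
    rw [integral_indicator measurableSet_Ici, integral_Ici_eq_integral_Ioi]
    have := Real.integral_rpow_mul_exp_neg_mul_Ioi (a := 2) (r := r) (by norm_num) hr0
    have h2 : ∀ x : ℝ, x * (r * Real.exp (-(r * x))) =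
        r * (x ^ ((2 : ℝ) - 1) * Real.exp (-(r * x))) := by
      intro x
      norm_num
      ring
    simp_rw [h2]
    rw [integral_const_mul, this]
    norm_num
    field_simp

/-! ### Independent sequences -/

/-- The sequence `x, e 0, e 1, …`. -/
def cons (x : ℝ) (e : ℕ → ℝ) : ℕ → ℝ
  | 0 => x
  | n + 1 => e n

@[simp] lemma cons_zero (x : ℝ) (e : ℕ → ℝ) : cons x e 0 = x := rfl

@[simp] lemma cons_succ (x : ℝ) (e : ℕ → ℝ) (n : ℕ) : cons x e (n + 1) = e n := rfl

/-- The sequence `e 1, e 2, …`. -/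
def tail (e : ℕ → ℝ) : ℕ → ℝ := fun n => e (n + 1)

@[simp] lemma tail_cons (x : ℝ) (e : ℕ → ℝ) : tail (cons x e) = e := rfl

@[fun_prop]
lemma measurable_cons {α : Type*} [MeasurableSpace α] {f : α → ℝ} {g : α → ℕ → ℝ}
    (hf : Measurable f) (hg : Measurable g) : Measurable fun a => cons (f a) (g a) := by
  refine measurable_pi_lambda _ fun n => ?_
  cases n with
  | zero => exact hf
  | succ n => exact (measurable_pi_apply n).comp hg

@[fun_prop]
lemma measurable_tail : Measurable tail :=
  measurable_pi_lambda _ fun n => measurable_pi_apply (n + 1)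

/-- The law of a sequence of independent random variables of law `π`. -/
noncomputable abbrev iid (π : Measure ℝ) : Measure (ℕ → ℝ) := Measure.infinitePi fun _ => π

/-- This decomposition into first term and remainder drives the inductions below: each conditions on
the first step and leaves a fresh sequence of the same law. -/
lemma map_cons_iid (π : Measure ℝ) [IsProbabilityMeasure π] :
    (π.prod (iid π)).map (fun p => cons p.1 p.2) = iid π := by
  refine Measure.eq_infinitePi _ fun s t ht => ?_
  have hm : Measurable fun p : ℝ × (ℕ → ℝ) => cons p.1 p.2 := by fun_prop
  rw [Measure.map_apply hm (MeasurableSet.pi s.countable_toSet fun i _ => ht i)]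
  classical
  set s' : Finset ℕ := s.preimage Nat.succ (Nat.succ_injective.injOn) with hs'
  have hset : (fun p : ℝ × (ℕ → ℝ) => cons p.1 p.2) ⁻¹' (Set.pi s t) =
      (if 0 ∈ s then t 0 else Set.univ) ×ˢ Set.pi s' (fun i => t (i + 1)) := by
    ext ⟨x, e⟩
    simp only [Set.mem_preimage, Set.mem_pi, Set.mem_prod, hs', Finset.mem_coe,
      Finset.mem_preimage]
    constructor
    · intro h
      refine ⟨?_, fun i hi => h (i + 1) hi⟩
      split_ifs with h0
      · exact h 0 h0
      · trivial
    · rintro ⟨h0, h1⟩ i hi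
      cases i with
      | zero => simpa [hi] using h0
      | succ i => exact h1 i hi
  rw [hset, Measure.prod_prod, Measure.infinitePi_pi _ (fun i _ => ht (i + 1))]
  have hprod : ∏ i ∈ s, π (t i) =
      (if 0 ∈ s then π (t 0) else 1) * ∏ i ∈ s', π (t (i + 1)) := by
    have h1 : ∏ i ∈ s', π (t (i + 1)) = ∏ i ∈ s with i ≠ 0, π (t i) := by
      rw [← Finset.prod_image (f := fun i => π (t i)) (g := Nat.succ) (s := s')
        (by intro a _ b _ h; exact Nat.succ_injective h)]
      congr 1
      ext i
      cases i with
      | zero => simp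
      | succ i => simp [hs']
    rw [h1, ← Finset.prod_filter_mul_prod_filter_not s (fun i => i = 0)]
    congr 1
    rw [Finset.filter_eq']
    split_ifs <;> simp
  rw [hprod]
  split_ifs <;> simp

lemma lintegral_iid_cons (π : Measure ℝ) [IsProbabilityMeasure π] {f : (ℕ → ℝ) → ℝ≥0∞}
    (hf : Measurable f) :
    ∫⁻ e, f e ∂(iid π) = ∫⁻ x, ∫⁻ e, f (cons x e) ∂(iid π) ∂π := by
  conv_lhs => rw [← map_cons_iid π]
  rw [lintegral_map hf (by fun_prop), lintegral_prod _ (by fun_prop)]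

lemma iid_apply_cons (π : Measure ℝ) [IsProbabilityMeasure π] {F : Set (ℕ → ℝ)}
    (hF : MeasurableSet F) :
    iid π F = ∫⁻ x, iid π {e | cons x e ∈ F} ∂π := by
  rw [← lintegral_indicator_one hF, lintegral_iid_cons π (measurable_one.indicator hF)]
  refine lintegral_congr fun x => ?_
  rw [← lintegral_indicator_one (by
    exact (by fun_prop : Measurable fun e : ℕ → ℝ => cons x e) hF)]
  rfl

lemma map_tail_iid (π : Measure ℝ) [IsProbabilityMeasure π] :
    (iid π).map tail = iid π := by
  conv_lhs => rw [← map_cons_iid π]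
  rw [Measure.map_map (by fun_prop) (by fun_prop)]
  have : tail ∘ (fun p : ℝ × (ℕ → ℝ) => cons p.1 p.2) = Prod.snd := by ext p; simp
  rw [this, Measure.map_snd_prod]
  simp

lemma ae_iid_of_ae (π : Measure ℝ) [IsProbabilityMeasure π] {p : ℝ → Prop}
    (h : ∀ᵐ x ∂π, p x) : ∀ᵐ e ∂(iid π), ∀ n, p (e n) := by
  rw [ae_all_iff]
  intro n
  have := (measurePreserving_eval_infinitePi (fun _ : ℕ => π) n)
  exact this.quasiMeasurePreserving.ae h

/-! ### Partial sums of independent exponential variables -/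

/-- The `n`-th point of the renewal process with steps `e`. -/
noncomputable def renewal (e : ℕ → ℝ) (n : ℕ) : ℝ := ∑ i ∈ Finset.range (n + 1), e i

@[simp] lemma renewal_zero (e : ℕ → ℝ) : renewal e 0 = e 0 := by simp [renewal]

lemma renewal_succ (e : ℕ → ℝ) (n : ℕ) : renewal e (n + 1) = renewal e n + e (n + 1) := by
  simp [renewal, Finset.sum_range_succ]

@[simp] lemma renewal_cons_succ (x : ℝ) (e : ℕ → ℝ) (n : ℕ) :
    renewal (cons x e) (n + 1) = x + renewal e n := by
  rw [renewal, Finset.sum_range_succ']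
  simp [renewal, add_comm]

@[fun_prop]
lemma measurable_renewal : Measurable renewal := by
  unfold renewal; fun_prop

@[fun_prop]
lemma measurable_renewal_apply (n : ℕ) : Measurable fun e => renewal e n := by
  unfold renewal; fun_prop

/-- The renewal process `e` passes the level `x` at its `n`-th point. -/
def Passes (x : ℝ) (n : ℕ) (e : ℕ → ℝ) : Prop := (∀ j < n, renewal e j < x) ∧ x ≤ renewal e n

/-- The steps of the renewal process seen from the level `x`, which it passes at its `n`-th
point. -/
noncomputable def restart (x : ℝ) (n : ℕ) (e : ℕ → ℝ) : ℕ → ℝ :=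
  cons (renewal e n - x) fun j => e (n + 1 + j)

@[fun_prop]
lemma measurable_restart (n : ℕ) : Measurable fun p : ℝ × (ℕ → ℝ) => restart p.1 n p.2 := by
  unfold restart
  refine measurable_cons ?_ (by fun_prop)
  exact ((measurable_renewal_apply n).comp measurable_snd).sub measurable_fst

lemma measurableSet_passes (n : ℕ) :
    MeasurableSet {p : ℝ × (ℕ → ℝ) | Passes p.1 n p.2} := by
  have h (j : ℕ) : Measurable fun p : ℝ × (ℕ → ℝ) => renewal p.2 j :=
    (measurable_renewal_apply j).comp measurable_snd
  have : {p : ℝ × (ℕ → ℝ) | Passes p.1 n p.2} =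
      (⋂ j ∈ Set.Iio n, {p | renewal p.2 j < p.1}) ∩ {p | p.1 ≤ renewal p.2 n} := by
    ext p; simp [Passes]
  rw [this]
  exact (MeasurableSet.biInter (Set.to_countable _) fun j _ =>
    measurableSet_lt (h j) measurable_fst).inter (measurableSet_le measurable_fst (h n))

lemma passes_cons_succ (x y : ℝ) (n : ℕ) (e : ℕ → ℝ) :
    Passes x (n + 1) (cons y e) ↔ y < x ∧ Passes (x - y) n e := by
  constructor
  · rintro ⟨h1, h2⟩
    refine ⟨by simpa using h1 0 n.succ_pos, fun j hj => ?_, ?_⟩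
    · have := h1 (j + 1) (by omega)
      rw [renewal_cons_succ] at this; linarith
    · rw [renewal_cons_succ] at h2; linarith
  · rintro ⟨h0, h1, h2⟩
    refine ⟨fun j hj => ?_, by rw [renewal_cons_succ]; linarith⟩
    cases j with
    | zero => simpa using h0
    | succ j => rw [renewal_cons_succ]; linarith [h1 j (by omega)]

lemma restart_cons_succ (x y : ℝ) (n : ℕ) (e : ℕ → ℝ) :
    restart x (n + 1) (cons y e) = restart (x - y) n e := by
  unfold restart
  rw [renewal_cons_succ]
  congr 1
  · ring
  · ext j
    rw [show n + 1 + 1 + j = (n + 1 + j) + 1 by ring, cons_succ]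

/-- Strong Markov property: the index at which the renewal process passes the level `x` has a
Poisson law, and the process seen from this level is an independent copy of it. -/
lemma iid_exp_restart (r : ℝ) [hr : Fact (0 < r)] {F : Set (ℕ → ℝ)} (hF : MeasurableSet F)
    (n : ℕ) {x : ℝ} (hx : 0 ≤ x) :
    iid (expMeasure r) {e | Passes x n e ∧ restart x n e ∈ F} =
      poissonMeasure (r * x).toNNReal {n} * iid (expMeasure r) F := by
  have hr0 := hr.out
  have hmeas : ∀ n, MeasurableSet {p : ℝ × (ℕ → ℝ) | Passes p.1 n p.2 ∧ restart p.1 n p.2 ∈ F} :=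
    fun n => (measurableSet_passes n).inter (measurable_restart n hF)
  have hmx : ∀ n x, MeasurableSet {e : ℕ → ℝ | Passes x n e ∧ restart x n e ∈ F} := fun n x =>
    measurable_prodMk_left (hmeas n)
  have hpois : ∀ (n : ℕ) {x : ℝ}, 0 ≤ x → poissonMeasure (r * x).toNNReal {n} =
      ENNReal.ofReal (Real.exp (-(r * x)) * (r * x) ^ n / n.factorial) := fun n x hx => by
    rw [poissonMeasure_singleton, Real.coe_toNNReal _ (by positivity)]
  induction n generalizing x with
  | zero =>
    rw [hpois 0 hx, iid_apply_cons _ (hmx 0 x)]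
    -- Passing `x` at index `0` means that the first step exceeds `x`; the excess is again
    -- exponential by memorylessness, and the later steps are untouched.
    have h1 : ∀ y : ℝ, iid (expMeasure r) {e | cons y e ∈ {e | Passes x 0 e ∧ restart x 0 e ∈ F}} =
        (Set.Ici x).indicator (fun y => iid (expMeasure r) {e | cons (y - x) e ∈ F}) y := by
      intro y
      by_cases hy : x ≤ y
      · rw [Set.indicator_of_mem (by exact hy)]
        congr 1
        ext e
        have : (fun j => cons y e (0 + 1 + j)) = e := by
          ext j; rw [zero_add, add_comm]; rfl
        simp [Passes, restart, hy, this]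
      · rw [Set.indicator_of_notMem (by exact hy)]
        simp [Passes, hy]
    have hm0 : Measurable fun y => iid (expMeasure r) {e | cons y e ∈ F} :=
      measurable_measure_prodMk_left
        ((by fun_prop : Measurable fun p : ℝ × (ℕ → ℝ) => cons p.1 p.2) hF)
    simp_rw [h1]
    rw [lintegral_indicator measurableSet_Ici,
      ← lintegral_map (f := fun y => iid (expMeasure r) {e | cons y e ∈ F})
        (g := fun y => y - x) hm0 (by fun_prop), exp_memoryless hx, lintegral_smul_measure,
      ← iid_apply_cons _ hF]
    simp
  | succ n ih =>
    rw [iid_apply_cons _ (hmx (n + 1) x)]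
    -- Given a first step `y < x`, the remaining steps have to pass the level `x - y` at index `n`,
    -- which the induction hypothesis handles.
    have h1 : ∀ᵐ y ∂(expMeasure r), iid (expMeasure r)
          {e | cons y e ∈ {e | Passes x (n + 1) e ∧ restart x (n + 1) e ∈ F}} =
        (Set.Ico 0 x).indicator (fun y => ENNReal.ofReal
          (Real.exp (-(r * (x - y))) * (r * (x - y)) ^ n / n.factorial) *
            iid (expMeasure r) F) y := by
      filter_upwards [ae_nonneg_exp r] with y hy0
      by_cases hy : y < x
      · rw [Set.indicator_of_mem (by exact ⟨hy0, hy⟩), ← hpois n (by linarith),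
          ← ih (x := x - y) (by linarith)]
        congr 1
        ext e
        simp [passes_cons_succ, restart_cons_succ, hy]
      · rw [Set.indicator_of_notMem (fun h => hy h.2)]
        simp [passes_cons_succ, hy]
    rw [lintegral_congr_ae h1, lintegral_exp r (by
      refine Measurable.indicator ?_ measurableSet_Ico
      exact Measurable.mul_const (by fun_prop) _), hpois _ hx]
    -- The two exponentials multiply to `exp (-(r * x))`, free of `y`, so only a power of `x - y`
    -- remains to be integrated.
    have h2 : ∀ y : ℝ, ENNReal.ofReal (r * Real.exp (-(r * y))) *
        (Set.Ico 0 x).indicator (fun y => ENNReal.ofReal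
          (Real.exp (-(r * (x - y))) * (r * (x - y)) ^ n / n.factorial) *
            iid (expMeasure r) F) y =
        (Set.Ico 0 x).indicator (fun y => ENNReal.ofReal
          (r * Real.exp (-(r * x)) * ((r * (x - y)) ^ n / n.factorial)) *
            iid (expMeasure r) F) y := by
      intro y
      by_cases hy : y ∈ Set.Ico 0 x
      · rw [Set.indicator_of_mem hy, Set.indicator_of_mem hy, ← mul_assoc,
          ← ENNReal.ofReal_mul (by positivity)]
        congr 2
        rw [show -(r * x) = -(r * y) + -(r * (x - y)) by ring, Real.exp_add]
        ring
      · simp [hy]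
    simp_rw [h2]
    rw [lintegral_indicator measurableSet_Ico,
      Measure.restrict_restrict measurableSet_Ico,
      Set.inter_eq_left.mpr (fun y hy => hy.1), lintegral_mul_const _ (by fun_prop)]
    congr 1
    rw [← ofReal_integral_eq_lintegral_ofReal]
    · congr 1
      rw [integral_Ico_eq_integral_Ioo, ← integral_Ioc_eq_integral_Ioo,
        ← intervalIntegral.integral_of_le hx]
      have hd : ∀ y ∈ Set.uIcc 0 x, HasDerivAt
          (fun y => -(Real.exp (-(r * x)) * (r * (x - y)) ^ (n + 1) / (n + 1).factorial))
          (r * Real.exp (-(r * x)) * ((r * (x - y)) ^ n / n.factorial)) y := by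
        intro y _
        have h3 : HasDerivAt (fun y => r * (x - y)) (-r) y := by
          simpa using ((hasDerivAt_id y).const_sub x).const_mul r
        have h4 := (((h3.pow (n + 1)).const_mul (Real.exp (-(r * x)))).div_const
          ((n + 1).factorial : ℝ)).neg
        refine h4.congr_deriv ?_
        rw [Nat.factorial_succ]
        push_cast
        have : (n.factorial : ℝ) ≠ 0 := by positivity
        field_simp
      rw [intervalIntegral.integral_eq_sub_of_hasDerivAt hd
        (Continuous.intervalIntegrable (by fun_prop) _ _)]
      simp
    · exact (Continuous.integrableOn_Icc (by fun_prop)).mono_set Set.Ico_subset_Icc_self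
    · filter_upwards [ae_restrict_mem measurableSet_Ico] with y hy
      have : 0 ≤ x - y := by linarith [hy.2]
      positivity

end MM1

namespace MM1

/-! ### Counting points -/

/-- The number of points of the family `b` in `I`. -/
noncomputable def card {ι : Type*} (b : ι → ℝ) (I : Set ℝ) : ℕ∞ := Set.encard {j | b j ∈ I}

lemma coe_card {ι : Type*} (b : ι → ℝ) (I : Set ℝ) :
    ((card b I : ℕ∞) : ℝ≥0∞) = ∑' j, I.indicator (fun _ => (1 : ℝ≥0∞)) (b j) := by
  rw [card, ← ENNReal.tsum_set_one, tsum_subtype {j | b j ∈ I} (fun _ => (1 : ℝ≥0∞))]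
  rfl

/-- In `ℝ≥0∞` the count is a countable sum of measurable indicators; its level sets are then pulled
back to `ℕ∞`. -/
lemma measurable_card {ι : Type*} [Countable ι] {I : Set ℝ} (hI : MeasurableSet I) :
    Measurable fun b : ι → ℝ => card b I := by
  have h : Measurable fun b : ι → ℝ => ((card b I : ℕ∞) : ℝ≥0∞) := by
    simp_rw [coe_card]
    exact Measurable.tsum fun j =>
      (measurable_const.indicator hI).comp (measurable_pi_apply j)
  refine measurable_to_countable' fun k => ?_
  have h2 : (fun b : ι → ℝ => card b I) ⁻¹' {k} =
      (fun b : ι → ℝ => ((card b I : ℕ∞) : ℝ≥0∞)) ⁻¹' {(k : ℝ≥0∞)} := by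
    ext b
    simp
  rw [h2]
  exact h (measurableSet_singleton _)

/-- The Poisson law of parameter `a`, as a law on `ℕ∞`. -/
noncomputable abbrev poisson (a : ℝ) : Measure ℕ∞ :=
  (poissonMeasure a.toNNReal).map fun k : ℕ => (k : ℕ∞)

instance isProbabilityMeasure_poisson (a : ℝ) : IsProbabilityMeasure (poisson a) :=
  Measure.isProbabilityMeasure_map (by fun_prop)

lemma poisson_apply (a : ℝ) (B : Set ℕ∞) :
    poisson a B = ∑' n : ℕ, {n : ℕ | (n : ℕ∞) ∈ B}.indicator
      (fun n => poissonMeasure a.toNNReal {n}) n := by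
  rw [Measure.map_apply (by fun_prop) (by trivial)]
  exact (Measure.tsum_indicator_apply_singleton _ _ (by trivial)).symm

/-- Steps of a nondecreasing renewal process without accumulation points. -/
def Proper (e : ℕ → ℝ) : Prop := (∀ n, 0 ≤ e n) ∧ Filter.Tendsto (renewal e) .atTop .atTop

lemma Proper.mono {e : ℕ → ℝ} (he : Proper e) : Monotone (renewal e) :=
  monotone_nat_of_le_succ fun n => by rw [renewal_succ]; linarith [he.1 (n + 1)]

lemma Proper.exists_passes {e : ℕ → ℝ} (he : Proper e) (x : ℝ) : ∃ n, Passes x n e := by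
  classical
  have h : ∃ n, x ≤ renewal e n := (he.2.eventually_ge_atTop x).exists
  exact ⟨Nat.find h, fun j hj => not_le.mp (Nat.find_min h hj), Nat.find_spec h⟩

lemma Passes.unique {e : ℕ → ℝ} {x : ℝ} {n m : ℕ} (hn : Passes x n e) (hm : Passes x m e) :
    n = m := by
  by_contra h
  rcases lt_or_gt_of_ne h with h | h
  · exact absurd (hm.1 n h) (not_lt.mpr hn.2)
  · exact absurd (hn.1 m h) (not_lt.mpr hm.2)

lemma renewal_restart (x : ℝ) (n j : ℕ) (e : ℕ → ℝ) :
    renewal (restart x n e) j = renewal e (n + j) - x := by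
  induction j with
  | zero => simp [restart]
  | succ j ih =>
    rw [renewal_succ, ih, ← add_assoc, renewal_succ]
    simp only [restart, cons_succ]
    rw [show n + 1 + j = n + j + 1 by ring]
    ring

/-- Points of index below `n` lie strictly left of `x`, so for `0 ≤ u` they are not counted, and the
others are those of the restarted process. -/
lemma Passes.card_Ico {e : ℕ → ℝ} {x : ℝ} {n : ℕ} (hn : Passes x n e) (u v : ℝ)
    (hu : 0 ≤ u) :
    card (renewal e) (Set.Ico (x + u) (x + v)) =
      card (renewal (restart x n e)) (Set.Ico u v) := by
  unfold card
  rw [← (add_right_injective n).encard_image {j | renewal (restart x n e) j ∈ Set.Ico u v}]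
  congr 1
  ext j
  simp only [Set.mem_ofPred_eq, Set.mem_Ico, Set.mem_image, renewal_restart]
  constructor
  · rintro ⟨h1, h2⟩
    have hj : n ≤ j := by
      by_contra hj
      have := hn.1 j (by omega)
      linarith
    obtain ⟨k, rfl⟩ := Nat.exists_eq_add_of_le hj
    exact ⟨k, ⟨by linarith, by linarith⟩, rfl⟩
  · rintro ⟨k, ⟨h1, h2⟩, rfl⟩
    exact ⟨by linarith, by linarith⟩

lemma Passes.card_Ico_zero {e : ℕ → ℝ} (he : Proper e) {x : ℝ} {n : ℕ} (hn : Passes x n e) :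
    card (renewal e) (Set.Ico 0 x) = n := by
  unfold card
  have : {j | renewal e j ∈ Set.Ico 0 x} = ((Finset.range n : Finset ℕ) : Set ℕ) := by
    ext j
    simp only [Set.mem_ofPred_eq, Set.mem_Ico, Finset.coe_range, Set.mem_Iio]
    constructor
    · rintro ⟨_, h⟩
      by_contra hj
      exact absurd (hn.2.trans (he.mono (not_lt.mp hj))) (not_le.mpr h)
    · intro hj
      exact ⟨Finset.sum_nonneg fun i _ => he.1 i, hn.1 j hj⟩
  rw [this, Set.encard_coe_eq_coe_finsetCard]
  simp

/-- The law of large numbers for exponential variables. -/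
lemma iid_exp_slln (r : ℝ) [hr : Fact (0 < r)] :
    ∀ᵐ e ∂(iid (expMeasure r)),
      Filter.Tendsto (fun n : ℕ => (∑ i ∈ Finset.range n, e i) / (n : ℝ)) .atTop (𝓝 r⁻¹) := by
  have hmp := measurePreserving_eval_infinitePi (fun _ : ℕ => expMeasure r)
  have hint : Integrable (fun e : ℕ → ℝ => e 0) (iid (expMeasure r)) :=
    (hmp 0).integrable_comp_of_integrable (integrable_exp_id r).1
  have h := strong_law_ae_real (μ := iid (expMeasure r)) (fun n e => e n) hint
    (fun i j hij => (iIndepFun_infinitePi (P := fun _ : ℕ => expMeasure r)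
      (X := fun _ x => x) (fun _ => measurable_id)).indepFun hij)
    (fun i => ⟨(measurable_pi_apply i).aemeasurable, (measurable_pi_apply 0).aemeasurable,
      (hmp i).map_eq.trans (hmp 0).map_eq.symm⟩)
  have hE : ∫ e, e 0 ∂(iid (expMeasure r)) = r⁻¹ := by
    rw [← (integrable_exp_id r).2]
    conv_rhs => rw [← (hmp 0).map_eq]
    rw [integral_map (measurable_pi_apply 0).aemeasurable (by fun_prop)]
  rw [hE] at h
  exact h

lemma ae_proper (r : ℝ) [hr : Fact (0 < r)] : ∀ᵐ e ∂(iid (expMeasure r)), Proper e := by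
  filter_upwards [iid_exp_slln r, ae_iid_of_ae _ (ae_nonneg_exp r)] with e h1 h2
  refine ⟨h2, ?_⟩
  have h3 := h1.pos_mul_atTop (inv_pos.mpr hr.out) tendsto_natCast_atTop_atTop
  have h4 : Filter.Tendsto (fun n : ℕ => ∑ i ∈ Finset.range n, e i) .atTop .atTop := by
    refine h3.congr' ?_
    filter_upwards [Filter.eventually_gt_atTop 0] with n hn
    field_simp
  exact h4.comp (Filter.tendsto_add_atTop_nat 1)

/-- Summing the strong Markov property over the passing index: the number of points before `x` is
Poisson and independent of the process seen from `x`. -/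
lemma iid_exp_passes_mem (r : ℝ) [hr : Fact (0 < r)] {F : Set (ℕ → ℝ)} (hF : MeasurableSet F)
    (B : Set ℕ∞) {x : ℝ} (hx : 0 ≤ x) :
    iid (expMeasure r) {e | ∃ n : ℕ, (n : ℕ∞) ∈ B ∧ Passes x n e ∧ restart x n e ∈ F} =
      poisson (r * x) B * iid (expMeasure r) F := by
  have hm : ∀ n, MeasurableSet {e : ℕ → ℝ | Passes x n e ∧ restart x n e ∈ F} := fun n =>
    measurable_prodMk_left ((measurableSet_passes n).inter (measurable_restart n hF))
  have hset : {e | ∃ n : ℕ, (n : ℕ∞) ∈ B ∧ Passes x n e ∧ restart x n e ∈ F} =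
      ⋃ n : ℕ, {e | (n : ℕ∞) ∈ B ∧ Passes x n e ∧ restart x n e ∈ F} := by
    ext e; simp
  rw [hset, measure_iUnion, poisson_apply, ← ENNReal.tsum_mul_right]
  · refine tsum_congr fun n => ?_
    by_cases hn : (n : ℕ∞) ∈ B
    · simp [hn, iid_exp_restart r hF n hx]
    · simp [hn]
  · intro n m hnm
    refine Set.disjoint_left.mpr fun e h1 h2 => hnm (h1.2.1.unique h2.2.1)
  · intro n
    by_cases hn : (n : ℕ∞) ∈ B
    · simpa [hn] using hm n
    · simp [hn]

lemma measurableSet_card_mem (x : ℕ → ℝ) (m : ℕ) (B : ℕ → Set ℕ∞) :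
    MeasurableSet {e : ℕ → ℝ | ∀ i < m, card (renewal e) (Set.Ico (x i) (x (i + 1))) ∈ B i} := by
  have : {e : ℕ → ℝ | ∀ i < m, card (renewal e) (Set.Ico (x i) (x (i + 1))) ∈ B i} =
      ⋂ i ∈ Set.Iio m, {e | card (renewal e) (Set.Ico (x i) (x (i + 1))) ∈ B i} := by
    ext; simp
  rw [this]
  exact MeasurableSet.biInter (Set.to_countable _) fun i _ =>
    ((measurable_card measurableSet_Ico).comp measurable_renewal)
      (MeasurableSpace.measurableSet_top (s := B i))

/-- The renewal process with exponential steps is a Poisson process. -/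
lemma iid_exp_card_renewal (r : ℝ) [hr : Fact (0 < r)] (m : ℕ) (x : ℕ → ℝ) (hx : Monotone x)
    (hx0 : 0 ≤ x 0) (B : ℕ → Set ℕ∞) :
    iid (expMeasure r) {e | ∀ i < m, card (renewal e) (Set.Ico (x i) (x (i + 1))) ∈ B i} =
      ∏ i ∈ Finset.range m, poisson (r * (x (i + 1) - x i)) (B i) := by
  -- Induction on the number of intervals, for partitions starting at `0`: the first count is the
  -- index at which `x 1` is passed, and the other counts belong to the process restarted there.
  have key : ∀ (m : ℕ) (x : ℕ → ℝ), Monotone x → x 0 = 0 → ∀ B : ℕ → Set ℕ∞,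
      iid (expMeasure r) {e | ∀ i < m, card (renewal e) (Set.Ico (x i) (x (i + 1))) ∈ B i} =
        ∏ i ∈ Finset.range m, poisson (r * (x (i + 1) - x i)) (B i) := by
    intro m
    induction m with
    | zero => intro x _ _ B; simp
    | succ m ih =>
      intro x hx hx0 B
      have hx1 : 0 ≤ x 1 := hx0 ▸ hx zero_le_one
      have hF := measurableSet_card_mem (fun i => x (i + 1) - x 1) m (fun i => B (i + 1))
      have hae : {e : ℕ → ℝ | ∀ i < m + 1, card (renewal e) (Set.Ico (x i) (x (i + 1))) ∈ B i}
          =ᵐ[iid (expMeasure r)] {e | ∃ n : ℕ, (n : ℕ∞) ∈ B 0 ∧ Passes (x 1) n e ∧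
            restart (x 1) n e ∈ {e : ℕ → ℝ | ∀ i < m, card (renewal e)
              (Set.Ico (x (i + 1) - x 1) (x (i + 1 + 1) - x 1)) ∈ B (i + 1)}} := by
        rw [Filter.eventuallyEq_set]
        filter_upwards [ae_proper r] with e he
        obtain ⟨n, hn⟩ := he.exists_passes (x 1)
        have h1 : ∀ i, card (renewal (restart (x 1) n e))
            (Set.Ico (x (i + 1) - x 1) (x (i + 1 + 1) - x 1)) =
              card (renewal e) (Set.Ico (x (i + 1)) (x (i + 1 + 1))) := by
          intro i
          rw [← hn.card_Ico _ _ (by linarith [hx (show 1 ≤ i + 1 by omega)])]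
          simp
        have h0 : card (renewal e) (Set.Ico (x 0) (x (0 + 1))) = n := by
          rw [hx0, zero_add]; exact hn.card_Ico_zero he
        constructor
        · intro h
          refine ⟨n, h0 ▸ h 0 m.succ_pos, hn, fun i hi => ?_⟩
          rw [h1]; exact h (i + 1) (by omega)
        · rintro ⟨n', hn', hp, h⟩ i hi
          obtain rfl := hn.unique hp
          cases i with
          | zero => rw [h0]; exact hn'
          | succ i => rw [← h1]; exact h i (by omega)
      rw [measure_congr hae, iid_exp_passes_mem r hF _ hx1,
        ih (fun i => x (i + 1) - x 1) (fun i j hij => by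
          have := hx (show i + 1 ≤ j + 1 by omega)
          simpa using this) (by simp) (fun i => B (i + 1)), Finset.prod_range_succ']
      simp only [sub_sub_sub_cancel_right, hx0, zero_add, sub_zero]
      rw [mul_comm]
  -- A general starting point reduces to `0` by restarting at `x 0`, with no constraint on the
  -- number of points before it.
  have hF := measurableSet_card_mem (fun i => x i - x 0) m B
  have hae : {e : ℕ → ℝ | ∀ i < m, card (renewal e) (Set.Ico (x i) (x (i + 1))) ∈ B i}
      =ᵐ[iid (expMeasure r)] {e | ∃ n : ℕ, (n : ℕ∞) ∈ Set.univ ∧ Passes (x 0) n e ∧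
        restart (x 0) n e ∈ {e : ℕ → ℝ | ∀ i < m, card (renewal e)
          (Set.Ico (x i - x 0) (x (i + 1) - x 0)) ∈ B i}} := by
    rw [Filter.eventuallyEq_set]
    filter_upwards [ae_proper r] with e he
    obtain ⟨n, hn⟩ := he.exists_passes (x 0)
    have h1 : ∀ i, card (renewal (restart (x 0) n e)) (Set.Ico (x i - x 0) (x (i + 1) - x 0)) =
        card (renewal e) (Set.Ico (x i) (x (i + 1))) := by
      intro i
      rw [← hn.card_Ico _ _ (by linarith [hx (Nat.zero_le i)])]
      simp
    constructor
    · intro h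
      refine ⟨n, trivial, hn, fun i hi => ?_⟩
      rw [h1]; exact h i hi
    · rintro ⟨n', _, hp, h⟩ i hi
      obtain rfl := hn.unique hp
      rw [← h1]; exact h i hi
  rw [measure_congr hae, iid_exp_passes_mem r hF _ hx0,
    key m (fun i => x i - x 0) (fun i j hij => by simpa using hx hij) (by simp) B]
  simp

end MM1

namespace MM1

/-! ### Laws of limits -/

lemma tendsto_integral_map {Ω α : Type*} [MeasurableSpace Ω] [TopologicalSpace α]
    [MeasurableSpace α] [BorelSpace α] {P : Measure Ω} [IsProbabilityMeasure P]
    {Y : ℕ → Ω → α} {Z : Ω → α} (hY : ∀ n, AEMeasurable (Y n) P) (hZ : AEMeasurable Z P)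
    (hl : ∀ᵐ ω ∂P, Filter.Tendsto (fun n => Y n ω) .atTop (𝓝 (Z ω)))
    (f : BoundedContinuousFunction α ℝ) :
    Filter.Tendsto (fun n => ∫ x, f x ∂(P.map (Y n))) .atTop (𝓝 (∫ x, f x ∂(P.map Z))) := by
  have hf : ∀ {ν : Measure α}, AEStronglyMeasurable f ν := fun {ν} =>
    f.continuous.measurable.stronglyMeasurable.aestronglyMeasurable
  rw [integral_map hZ hf]
  simp_rw [fun n => integral_map (hY n) hf]
  refine tendsto_integral_of_dominated_convergence (fun _ => ‖f‖)
    (fun n => (f.continuous.measurable.comp_aemeasurable (hY n)).aestronglyMeasurable)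
    (integrable_const _) (fun n => .of_forall fun ω => f.norm_coe_le_norm _) ?_
  filter_upwards [hl] with ω hω
  exact (f.continuous.tendsto _).comp hω

/-- Almost sure convergence implies convergence in law, and limits in law are unique. It serves
twice: for points recovered from discretised counts, and for a queue started ever further in the
past. -/
lemma map_eq_map_of_tendsto {Ω Ω' α : Type*} [MeasurableSpace Ω] [MeasurableSpace Ω']
    [TopologicalSpace α] [MeasurableSpace α] [BorelSpace α] [HasOuterApproxClosed α]
    {P : Measure Ω} {P' : Measure Ω'} [IsProbabilityMeasure P] [IsProbabilityMeasure P']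
    {Y : ℕ → Ω → α} {Y' : ℕ → Ω' → α} {Z : Ω → α} {Z' : Ω' → α}
    (hY : ∀ n, AEMeasurable (Y n) P) (hY' : ∀ n, AEMeasurable (Y' n) P')
    (hZ : AEMeasurable Z P) (hZ' : AEMeasurable Z' P')
    (h : ∀ n, P.map (Y n) = P'.map (Y' n))
    (hl : ∀ᵐ ω ∂P, Filter.Tendsto (fun n => Y n ω) .atTop (𝓝 (Z ω)))
    (hl' : ∀ᵐ ω ∂P', Filter.Tendsto (fun n => Y' n ω) .atTop (𝓝 (Z' ω))) :
    P.map Z = P'.map Z' := by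
  have := Measure.isProbabilityMeasure_map hZ
  have := Measure.isProbabilityMeasure_map hZ'
  refine ext_of_forall_integral_eq_of_IsFiniteMeasure fun f => ?_
  refine tendsto_nhds_unique (tendsto_integral_map hY hZ hl f) ?_
  simp_rw [h]
  exact tendsto_integral_map hY' hZ' hl' f

/-! ### An ordered point process is determined by its numbers of points in cells -/

/-- The numbers of points of `b` in the successive cells of length `h`. -/
noncomputable def cells (h : ℝ) (b : ℕ → ℝ) (i : ℕ) : ℕ∞ :=
  card b (Set.Ico (i * h) ((i + 1) * h))

lemma measurable_cells (h : ℝ) : Measurable (cells h) :=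
  measurable_pi_lambda _ fun _ => measurable_card measurableSet_Ico

/-- The points, rounded down to a multiple of `h`, in terms of the numbers of points in cells. -/
noncomputable def rounded (h : ℝ) (c : ℕ → ℕ∞) (j : ℕ) : ℝ :=
  h * (∑' i : ℕ, if ∑ k ∈ Finset.range (i + 1), c k ≤ (j : ℕ∞) then (1 : ℝ≥0∞) else 0).toReal

lemma measurable_rounded (h : ℝ) : Measurable (rounded h) := by
  refine measurable_pi_lambda _ fun j => ?_
  refine Measurable.const_mul (Measurable.ennreal_toReal (Measurable.tsum fun i => ?_)) _
  refine Measurable.ite ?_ measurable_const measurable_const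
  have h1 : Measurable fun c : ℕ → ℕ∞ => fun k : Fin (i + 1) => c k :=
    measurable_pi_lambda _ fun k => measurable_pi_apply _
  have h2 : {c : ℕ → ℕ∞ | ∑ k ∈ Finset.range (i + 1), c k ≤ (j : ℕ∞)} =
      (fun c : ℕ → ℕ∞ => fun k : Fin (i + 1) => c k) ⁻¹'
        {c | ∑ k : Fin (i + 1), c k ≤ (j : ℕ∞)} := by
    ext c
    simp [Finset.sum_range]
  rw [h2]
  exact h1 (Set.to_countable _).measurableSet

lemma card_union {ι : Type*} (b : ι → ℝ) {I J : Set ℝ} (h : Disjoint I J) :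
    card b (I ∪ J) = card b I + card b J := by
  unfold card
  rw [← Set.encard_union_eq]
  · rfl
  · exact Set.disjoint_left.mpr fun j h1 h2 => Set.disjoint_left.mp h h1 h2

lemma sum_cells {h : ℝ} (hh : 0 < h) (b : ℕ → ℝ) (n : ℕ) :
    ∑ k ∈ Finset.range n, cells h b k = card b (Set.Ico 0 (n * h)) := by
  induction n with
  | zero => simp [card]
  | succ n ih =>
    rw [Finset.sum_range_succ, ih, cells, ← card_union, Set.Ico_union_Ico_eq_Ico]
    · push_cast; rfl
    · positivity
    · nlinarith
    · exact Set.Ico_disjoint_Ico_same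

/-- At most `j` points lie below `(i + 1) * h` exactly when `b j ≥ (i + 1) * h`; the indices `i`
with this property number `⌊b j / h⌋`. -/
lemma rounded_cells {h : ℝ} (hh : 0 < h) {b : ℕ → ℝ} (hb : Monotone b) (h0 : ∀ j, 0 ≤ b j) (j : ℕ) :
    rounded h (cells h b) j = h * ⌊b j / h⌋₊ := by
  have h1 : ∀ i : ℕ, ∑ k ∈ Finset.range (i + 1), cells h b k ≤ (j : ℕ∞) ↔ i < ⌊b j / h⌋₊ := by
    intro i
    rw [sum_cells hh, ← Nat.succ_le_iff, Nat.le_floor_iff (div_nonneg (h0 j) hh.le),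
      le_div_iff₀ hh]
    constructor
    · intro hc
      by_contra hlt
      rw [not_le] at hlt
      have : ((Finset.range (j + 1) : Finset ℕ) : Set ℕ) ⊆
          {k | b k ∈ Set.Ico 0 (((i + 1 : ℕ) : ℝ) * h)} := by
        intro k hk
        have hk' : k ≤ j := by simpa [Nat.lt_succ_iff] using hk
        exact ⟨h0 k, lt_of_le_of_lt (hb hk') hlt⟩
      have h2 := (Set.encard_le_encard this).trans hc
      rw [Set.encard_coe_eq_coe_finsetCard, Finset.card_range] at h2
      have : j + 1 ≤ j := by exact_mod_cast h2
      omega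
    · intro hle
      have : {k | b k ∈ Set.Ico 0 (((i + 1 : ℕ) : ℝ) * h)} ⊆
          ((Finset.range j : Finset ℕ) : Set ℕ) := by
        rintro k ⟨_, hk⟩
        have : k < j := by
          by_contra hkj
          exact absurd (hle.trans (hb (not_lt.mp hkj))) (not_le.mpr hk)
        simpa using this
      have h2 := Set.encard_le_encard this
      rwa [Set.encard_coe_eq_coe_finsetCard, Finset.card_range] at h2
  unfold rounded
  congr 1
  simp_rw [h1]
  rw [tsum_eq_sum (s := Finset.range ⌊b j / h⌋₊) (fun i hi => by simpa using hi)]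
  rw [Finset.sum_congr rfl (g := fun _ => (1 : ℝ≥0∞)) (fun i hi => by
    simp [Finset.mem_range.mp hi])]
  simp

/-- The points `b j` of `[0, ∞)` are numbered in increasing order. -/
def Ordered (b : ℕ → ℝ) : Prop := Monotone b ∧ ∀ j, 0 ≤ b j

lemma Ordered.tendsto_rounded {b : ℕ → ℝ} (hb : Ordered b) :
    Filter.Tendsto (fun n : ℕ => rounded (1 / (n + 1 : ℝ)) (cells (1 / (n + 1 : ℝ)) b)) .atTop
      (𝓝 b) := by
  rw [tendsto_pi_nhds]
  intro j
  have hlim : Filter.Tendsto (fun n : ℕ => b j - 1 / (n + 1 : ℝ)) .atTop (𝓝 (b j)) := by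
    simpa using tendsto_const_nhds.sub (tendsto_one_div_add_atTop_nhds_zero_nat (𝕜 := ℝ))
  refine tendsto_of_tendsto_of_tendsto_of_le_of_le hlim tendsto_const_nhds (fun n => ?_)
    (fun n => ?_)
  all_goals
    have hh : (0 : ℝ) < 1 / (n + 1 : ℝ) := by positivity
    simp only [rounded_cells hh hb.1 hb.2]
    generalize (1 : ℝ) / (n + 1 : ℝ) = h at hh
  · have := Nat.lt_floor_add_one (b j / h)
    rw [div_lt_iff₀ hh] at this
    linarith
  · have := Nat.floor_le (div_nonneg (hb.2 j) hh.le)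
    rw [le_div_iff₀ hh] at this
    linarith

/-- The counts in cells of length `ε` determine every point to within `ε`; letting `ε` tend to `0`
recovers the whole sequence. -/
lemma map_eq_map_of_cells {Ω Ω' : Type*} [MeasurableSpace Ω] [MeasurableSpace Ω']
    {P : Measure Ω} {P' : Measure Ω'} [IsProbabilityMeasure P] [IsProbabilityMeasure P']
    {b : Ω → ℕ → ℝ} {b' : Ω' → ℕ → ℝ} (hb : AEMeasurable b P) (hb' : AEMeasurable b' P')
    (h : ∀ ε : ℝ, 0 < ε → P.map (fun ω => cells ε (b ω)) = P'.map (fun ω => cells ε (b' ω)))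
    (hl : ∀ᵐ ω ∂P, Ordered (b ω)) (hl' : ∀ᵐ ω ∂P', Ordered (b' ω)) :
    P.map b = P'.map b' := by
  have hm : ∀ ε, Measurable fun b : ℕ → ℝ => rounded ε (cells ε b) := fun ε =>
    (measurable_rounded ε).comp (measurable_cells ε)
  refine map_eq_map_of_tendsto (fun n => (hm (1 / (n + 1 : ℝ))).comp_aemeasurable hb)
    (fun n => (hm (1 / (n + 1 : ℝ))).comp_aemeasurable hb') hb hb' (fun n => ?_)
    (hl.mono fun ω hω => hω.tendsto_rounded) (hl'.mono fun ω hω => hω.tendsto_rounded)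
  have h1 := congrArg (Measure.map (rounded (1 / (n + 1 : ℝ)))) (h (1 / (n + 1 : ℝ)) (by positivity))
  have h2 := AEMeasurable.map_map_of_aemeasurable (measurable_rounded (1 / (n + 1 : ℝ))).aemeasurable
    ((measurable_cells (1 / (n + 1 : ℝ))).comp_aemeasurable hb)
  have h3 := AEMeasurable.map_map_of_aemeasurable (measurable_rounded (1 / (n + 1 : ℝ))).aemeasurable
    ((measurable_cells (1 / (n + 1 : ℝ))).comp_aemeasurable hb')
  exact h2.symm.trans (h1.trans h3)

lemma Proper.ordered_renewal {e : ℕ → ℝ} (he : Proper e) : Ordered (renewal e) :=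
  ⟨he.mono, fun _ => Finset.sum_nonneg fun i _ => he.1 i⟩

lemma map_cells_renewal (r : ℝ) [hr : Fact (0 < r)] {h : ℝ} (hh : 0 < h) :
    (iid (expMeasure r)).map (fun e => cells h (renewal e)) =
      Measure.infinitePi fun _ => poisson (r * h) := by
  classical
  refine Measure.eq_infinitePi _ fun s t ht => ?_
  have hmeas : Measurable fun e => cells h (renewal e) :=
    (measurable_cells h).comp measurable_renewal
  rw [Measure.map_apply hmeas
    (MeasurableSet.pi s.countable_toSet fun i _ => ht i)]
  set m := s.sup id + 1 with hm
  have hsm : s ⊆ Finset.range m := fun i hi => by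
    have := Finset.le_sup (f := id) hi
    simp only [id] at this
    simp [hm]; omega
  have := iid_exp_card_renewal r m (fun i => i * h)
    (fun i j hij => by
      have : (i : ℝ) ≤ j := by exact_mod_cast hij
      nlinarith) (by simp)
    (fun i => if i ∈ s then t i else Set.univ)
  -- Indices outside `s` carry the trivial constraint `univ`, so that the result for consecutive
  -- intervals applies to an arbitrary finite set of cells.
  have hset : (fun e => cells h (renewal e)) ⁻¹' (Set.pi s t) =
      {e | ∀ i < m, card (renewal e) (Set.Ico (i * h) ((i + 1 : ℕ) * h)) ∈
        if i ∈ s then t i else Set.univ} := by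
    ext e
    simp only [Set.mem_preimage, Set.mem_pi, Set.mem_ofPred_eq, cells, Finset.mem_coe]
    constructor
    · intro h1 i _
      split_ifs with hi
      · simpa using h1 i hi
      · trivial
    · intro h1 i hi
      have := h1 i (Finset.mem_range.mp (hsm hi))
      simpa [hi] using this
  rw [hset, this, ← Finset.prod_subset hsm]
  · refine Finset.prod_congr rfl fun i hi => ?_
    simp only [hi, if_true]
    congr 2
    push_cast
    ring
  · intro i _ hi
    simp [hi]

end MM1

namespace MM1

/-! ### The points of a Poisson process seen backwards from a given time -/

/-- The points `x n` are numbered in increasing order, and they accumulate nowhere. -/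
def Regular (x : ℤ → ℝ) : Prop :=
  StrictMono x ∧ Filter.Tendsto x .atTop .atTop ∧ Filter.Tendsto x .atBot .atBot

open Classical in
/-- The index of the last of the points `x n` up to time `t`. -/
noncomputable def lastIndex (t : ℝ) (x : ℤ → ℝ) : ℤ :=
  if h : ∃! n, x n ≤ t ∧ t < x (n + 1) then h.choose else 0

lemma Regular.existsUnique_last {x : ℤ → ℝ} (hx : Regular x) (t : ℝ) :
    ∃! n, x n ≤ t ∧ t < x (n + 1) := by
  obtain ⟨m, hm⟩ := (hx.2.2.eventually_le_atBot t).exists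
  obtain ⟨M, hM⟩ := (hx.2.1.eventually_gt_atTop t).exists
  obtain ⟨n, hn, hub⟩ := Int.exists_greatest_of_bdd (P := fun n => x n ≤ t)
    ⟨M, fun z hz => by
      by_contra h
      exact absurd (hM.trans_le (hx.1.monotone (not_le.mp h).le)) (not_lt.mpr hz)⟩ ⟨m, hm⟩
  refine ⟨n, ⟨hn, ?_⟩, ?_⟩
  · by_contra h
    have := hub _ (not_lt.mp h)
    omega
  · rintro k ⟨hk1, hk2⟩
    refine le_antisymm (hub k hk1) ?_
    by_contra h
    have : k + 1 ≤ n := by omega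
    linarith [hx.1.monotone this]

lemma Regular.lastIndex_eq_iff {x : ℤ → ℝ} (hx : Regular x) (t : ℝ) (n : ℤ) :
    lastIndex t x = n ↔ x n ≤ t ∧ t < x (n + 1) := by
  have h := hx.existsUnique_last t
  rw [lastIndex, dif_pos h]
  constructor
  · rintro rfl
    exact h.choose_spec.1
  · intro hn
    exact (h.choose_spec.2 n hn).symm

lemma Regular.last_le {x : ℤ → ℝ} (hx : Regular x) (t : ℝ) : x (lastIndex t x) ≤ t :=
  ((hx.lastIndex_eq_iff t _).mp rfl).1

lemma Regular.lt_next {x : ℤ → ℝ} (hx : Regular x) (t : ℝ) : t < x (lastIndex t x + 1) :=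
  ((hx.lastIndex_eq_iff t _).mp rfl).2

lemma Regular.le_lastIndex_iff {x : ℤ → ℝ} (hx : Regular x) (t : ℝ) (n : ℤ) :
    n ≤ lastIndex t x ↔ x n ≤ t := by
  constructor
  · intro h
    exact (hx.1.monotone h).trans (hx.last_le t)
  · intro h
    by_contra hn
    have : lastIndex t x + 1 ≤ n := by omega
    linarith [hx.1.monotone this, hx.lt_next t]

/-- The default value `0` matters here: the preimage of `0` also contains every sequence without a
unique last index. -/
lemma measurable_lastIndex (t : ℝ) : Measurable (lastIndex t) := by
  have hc : ∀ n : ℤ, MeasurableSet {x : ℤ → ℝ | x n ≤ t ∧ t < x (n + 1)} := fun n =>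
    (measurableSet_le (measurable_pi_apply n) measurable_const).inter
      (measurableSet_lt measurable_const (measurable_pi_apply (n + 1)))
  have hu : ∀ k : ℤ, MeasurableSet {x : ℤ → ℝ | (x k ≤ t ∧ t < x (k + 1)) ∧
      ∀ n, n ≠ k → ¬ (x n ≤ t ∧ t < x (n + 1))} := by
    intro k
    have : {x : ℤ → ℝ | (x k ≤ t ∧ t < x (k + 1)) ∧
        ∀ n, n ≠ k → ¬ (x n ≤ t ∧ t < x (n + 1))} =
        {x | x k ≤ t ∧ t < x (k + 1)} ∩
          ⋂ n ∈ {n : ℤ | n ≠ k}, {x | x n ≤ t ∧ t < x (n + 1)}ᶜ := by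
      ext x; simp
    rw [this]
    exact (hc k).inter (MeasurableSet.biInter (Set.to_countable _) fun n _ => (hc n).compl)
  have he : MeasurableSet {x : ℤ → ℝ | ∃! n, x n ≤ t ∧ t < x (n + 1)} := by
    have : {x : ℤ → ℝ | ∃! n, x n ≤ t ∧ t < x (n + 1)} =
        ⋃ k, {x : ℤ → ℝ | (x k ≤ t ∧ t < x (k + 1)) ∧
          ∀ n, n ≠ k → ¬ (x n ≤ t ∧ t < x (n + 1))} := by
      ext x
      simp only [Set.mem_ofPred_eq, Set.mem_iUnion, ExistsUnique]
      refine exists_congr fun k => and_congr_right fun _ => forall_congr' fun n => ?_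
      tauto
    rw [this]
    exact MeasurableSet.iUnion hu
  refine measurable_to_countable' fun k => ?_
  have : lastIndex t ⁻¹' {k} = {x : ℤ → ℝ | (x k ≤ t ∧ t < x (k + 1)) ∧
      ∀ n, n ≠ k → ¬ (x n ≤ t ∧ t < x (n + 1))} ∪
      (if k = 0 then {x : ℤ → ℝ | ∃! n, x n ≤ t ∧ t < x (n + 1)}ᶜ else ∅) := by
    ext x
    by_cases h : ∃! n, x n ≤ t ∧ t < x (n + 1)
    · have h1 : lastIndex t x = h.choose := dif_pos h
      have h2 := h.choose_spec
      have h3 : x ∉ (if k = 0 then {x : ℤ → ℝ | ∃! n, x n ≤ t ∧ t < x (n + 1)}ᶜ else ∅) := by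
        split_ifs <;> simp [h]
      rw [Set.mem_union, or_iff_left h3, Set.mem_preimage, Set.mem_singleton_iff, h1]
      constructor
      · rintro rfl
        exact ⟨h2.1, fun n hn hn' => hn (h2.2 n hn')⟩
      · rintro ⟨hk, _⟩
        exact (h2.2 k hk).symm
    · have h1 : lastIndex t x = 0 := dif_neg h
      have h3 : ¬ ((x k ≤ t ∧ t < x (k + 1)) ∧ ∀ n, n ≠ k → ¬ (x n ≤ t ∧ t < x (n + 1))) :=
        fun h3 => h ⟨k, h3.1, fun n hn => by_contra fun hnk => h3.2 n hnk hn⟩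
      rw [Set.mem_union, or_iff_right (by exact h3), Set.mem_preimage, Set.mem_singleton_iff, h1]
      split_ifs with hk
      · simp [hk, h]
      · simp [Ne.symm hk]
  rw [this]
  refine (hu k).union ?_
  split_ifs
  · exact he.compl
  · exact MeasurableSet.empty

lemma measurable_eval_index {α : Type*} [MeasurableSpace α] {f : α → ℤ → ℝ} {g : α → ℤ}
    (hf : Measurable f) (hg : Measurable g) : Measurable fun a => f a (g a) := by
  have h : Measurable fun p : (ℤ → ℝ) × ℤ => p.1 p.2 :=
    measurable_from_prod_countable_left fun n => measurable_pi_apply n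
  exact h.comp (hf.prodMk hg)

/-- The distances of the points `x n` up to time `t` to `t`, in increasing order. -/
noncomputable def backward (t : ℝ) (x : ℤ → ℝ) (j : ℕ) : ℝ := t - x (lastIndex t x - j)

lemma measurable_backward (t : ℝ) : Measurable (backward t) :=
  measurable_pi_lambda _ fun _ =>
    (measurable_eval_index measurable_id ((measurable_lastIndex t).sub_const _)).const_sub t

lemma Regular.ordered_backward {x : ℤ → ℝ} (hx : Regular x) (t : ℝ) :
    Ordered (backward t x) := by
  refine ⟨fun i j hij => ?_, fun j => ?_⟩
  · have := hx.1.monotone (show lastIndex t x - (j : ℤ) ≤ lastIndex t x - (i : ℤ) by omega)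
    simp only [backward]; linarith
  · have h1 := hx.1.monotone (show lastIndex t x - (j : ℤ) ≤ lastIndex t x by omega)
    simp only [backward]; linarith [hx.last_le t]

lemma encard_lastIndex_sub (N : ℤ) (p : ℤ → Prop) (hp : ∀ n, p n → n ≤ N) :
    {n | p n}.encard = {j : ℕ | p (N - j)}.encard := by
  have hinj : Function.Injective fun j : ℕ => N - (j : ℤ) := fun i j h => by
    simpa using h
  rw [← hinj.encard_image]
  congr 1
  ext n
  simp only [Set.mem_ofPred_eq, Set.mem_image]
  constructor
  · intro h
    have := hp n h
    exact ⟨(N - n).toNat, by simpa [Int.toNat_of_nonneg (sub_nonneg.mpr this)] using h,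
      by simp [Int.toNat_of_nonneg (sub_nonneg.mpr this)]⟩
  · rintro ⟨j, h, rfl⟩
    exact h

/-- Reversing time exchanges the closed ends of the intervals; since `0 ≤ u`, no point later than
`t` is involved. -/
lemma Regular.card_backward {x : ℤ → ℝ} (hx : Regular x) (t : ℝ) {u : ℝ} (v : ℝ) (hu : 0 ≤ u) :
    card (backward t x) (Set.Ico u v) = card x (Set.Ioc (t - v) (t - u)) := by
  unfold card
  rw [encard_lastIndex_sub (lastIndex t x) (fun n => x n ∈ Set.Ioc (t - v) (t - u))
    (fun n hn => (hx.le_lastIndex_iff t n).mpr (by linarith [hn.2]))]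
  congr 1
  ext j
  simp only [Set.mem_ofPred_eq, backward, Set.mem_Ico, Set.mem_Ioc]
  constructor <;> rintro ⟨h1, h2⟩ <;> constructor <;> linarith

variable {Ω : Type*} [MeasurableSpace Ω] {P : Measure Ω} {X : ℤ → Ω → ℝ} {a : ℝ}

lemma IsPoissonProcess.ae_count_ne_top (hX : IsPoissonProcess P X a) {u v : ℝ} (h : u ≤ v) :
    ∀ᵐ ω ∂P, count X (Set.Ioc u v) ω ≠ ⊤ := by
  rw [(hX.law u v h).ae_iff (p := fun k => k ≠ ⊤) (by fun_prop), ae_map_iff (by fun_prop) (by trivial)]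
  simp

/-- Bounded windows contain finitely many points, so each infinite half-line of indices has a point
outside any window, and monotonicity sends it to the correct infinity. -/
lemma IsPoissonProcess.ae_regular (hX : IsPoissonProcess P X a)
    (hmono : ∀ᵐ ω ∂P, StrictMono fun n => X n ω) :
    ∀ᵐ ω ∂P, Regular fun n => X n ω := by
  have h : ∀ᵐ ω ∂P, ∀ m : ℕ, count X (Set.Ioc (-(m : ℝ)) m) ω ≠ ⊤ := ae_all_iff.mpr fun m =>
    hX.ae_count_ne_top (by linarith [(Nat.cast_nonneg m : (0 : ℝ) ≤ m)])
  filter_upwards [h, hmono] with ω hω hm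
  have hfin : ∀ (m : ℕ) (s : Set ℤ), s.Infinite → ∃ n ∈ s, X n ω ∉ Set.Ioc (-(m : ℝ)) m := by
    intro m s hs
    by_contra! hc
    refine hω m ?_
    have : s ⊆ {n | X n ω ∈ Set.Ioc (-(m : ℝ)) m} := hc
    exact Set.encard_eq_top (hs.mono this)
  refine ⟨hm, ?_, ?_⟩
  · refine Filter.tendsto_atTop_atTop_of_monotone hm.monotone fun b => ?_
    obtain ⟨m, hmb⟩ := exists_nat_gt (max |b| |X 0 ω|)
    obtain ⟨n, hn, hn'⟩ := hfin m (Set.Ici 0) (Set.Ici_infinite _)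
    refine ⟨n, ?_⟩
    by_contra hlt
    refine hn' ⟨?_, ?_⟩
    · have := hm.monotone hn
      linarith [neg_abs_le (X 0 ω), le_max_right |b| |X 0 ω|]
    · linarith [le_abs_self b, le_max_left |b| |X 0 ω|]
  · refine Filter.tendsto_atBot_atBot_of_monotone hm.monotone fun b => ?_
    obtain ⟨m, hmb⟩ := exists_nat_gt (max |b| |X 0 ω|)
    obtain ⟨n, hn, hn'⟩ := hfin m (Set.Iic 0) (Set.Iic_infinite _)
    refine ⟨n, ?_⟩
    by_contra hlt
    refine hn' ⟨?_, ?_⟩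
    · linarith [neg_abs_le b, le_max_left |b| |X 0 ω|]
    · have := hm.monotone hn
      linarith [le_abs_self (X 0 ω), le_max_right |b| |X 0 ω|]

/-- With `a ≤ 0` all windows would almost surely be empty, yet the point `X 0` lies in some window.
-/
lemma IsPoissonProcess.pos (hX : IsPoissonProcess P X a) [NeZero P] : 0 < a := by
  by_contra ha
  have h : ∀ᵐ ω ∂P, ∀ m : ℕ, count X (Set.Ioc (-(m : ℝ)) m) ω = 0 := by
    refine ae_all_iff.mpr fun m => ?_
    have hm : (0 : ℝ) ≤ m - -m := by linarith [(Nat.cast_nonneg m : (0 : ℝ) ≤ m)]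
    have h0 : (a * (m - -(m : ℝ))).toNNReal = 0 :=
      Real.toNNReal_of_nonpos (mul_nonpos_of_nonpos_of_nonneg (not_lt.mp ha) hm)
    rw [(hX.law (-(m : ℝ)) m (by linarith)).ae_iff (p := fun k => k = 0) (by fun_prop),
      ae_map_iff (by fun_prop) (by trivial), h0]
    have h1 : poissonMeasure 0 {0} = 1 := by simp [poissonMeasure_singleton]
    have h2 : ∀ᵐ k ∂(poissonMeasure 0), k ∈ ({0} : Set ℕ) :=
      mem_ae_iff_prob_eq_one (by trivial) |>.mpr h1
    filter_upwards [h2] with k hk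
    simpa using hk
  obtain ⟨ω, hω⟩ := h.exists
  obtain ⟨m, hm⟩ := exists_nat_gt |X 0 ω|
  have := hω m
  rw [count, Set.encard_eq_zero] at this
  have h0 : (0 : ℤ) ∈ {n | X n ω ∈ Set.Ioc (-(m : ℝ)) m} :=
    ⟨by linarith [neg_abs_le (X 0 ω)], by linarith [le_abs_self (X 0 ω)]⟩
  rw [this] at h0
  exact h0

lemma IsPoissonProcess.map_cells_backward (hX : IsPoissonProcess P X a)
    (hm : ∀ n, Measurable (X n)) (hmono : ∀ᵐ ω ∂P, StrictMono fun n => X n ω) (t : ℝ) {h : ℝ}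
    (hh : 0 < h) :
    P.map (fun ω => cells h (backward t fun n => X n ω)) =
      Measure.infinitePi fun _ => poisson (a * h) := by
  classical
  have hmX : Measurable fun ω => fun n => X n ω := measurable_pi_lambda _ hm
  have hmeas : Measurable fun ω => cells h (backward t fun n => X n ω) :=
    (measurable_cells h).comp ((measurable_backward t).comp hmX)
  refine Measure.eq_infinitePi _ fun s B hB => ?_
  rw [Measure.map_apply hmeas (MeasurableSet.pi s.countable_toSet fun i _ => hB i)]
  set M := s.sup id + 1 with hM
  have hsM : ∀ i ∈ s, i < M := fun i hi => by
    have := Finset.le_sup (f := id) hi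
    simp only [id] at this
    omega
  -- A grid of mesh `h` ending at `t`, numbered forwards: the backward cell `i` is the grid interval
  -- `M - 1 - i`.
  set τ : ℕ → ℝ := fun i => t + ((i : ℝ) - M) * h with hτ
  have hτm : Monotone τ := fun i j hij => by
    have : (i : ℝ) ≤ j := by exact_mod_cast hij
    simp only [hτ]; nlinarith
  have hcount : ∀ i ∈ s, ∀ᵐ ω ∂P, cells h (backward t fun n => X n ω) i =
      count X (Set.Ioc (τ (M - 1 - i)) (τ (M - 1 - i + 1))) ω := by
    intro i hi
    filter_upwards [hX.ae_regular hmono] with ω hω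
    rw [cells, hω.card_backward t _ (by positivity)]
    have h1 : M - 1 - i + 1 = M - i := by have := hsM i hi; omega
    have h2 : ((M - 1 - i : ℕ) : ℝ) = M - 1 - i := by
      have := hsM i hi
      rw [Nat.cast_sub (by omega), Nat.cast_sub (by omega)]; simp
    have h3 : ((M - i : ℕ) : ℝ) = M - i := by
      have := hsM i hi
      rw [Nat.cast_sub (by omega)]
    have h4 : τ (M - 1 - i) = t - (i + 1) * h := by simp only [hτ, h2]; ring
    have h5 : τ (M - i) = t - i * h := by simp only [hτ, h3]; ring
    rw [h1, h4, h5]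
    rfl
  have hind := hX.indep τ hτm
  have hinj : Set.InjOn (fun i => M - 1 - i) s := by
    intro i hi j hj hij
    have h1 := hsM i hi
    have h2 := hsM j hj
    simp only at hij
    omega
  have hprod := hind.measure_inter_preimage_eq_mul (s.image fun i => M - 1 - i)
    (sets := fun k => B (M - 1 - k)) (fun _ _ => trivial)
  rw [Finset.prod_image hinj] at hprod
  have hset : (fun ω => cells h (backward t fun n => X n ω)) ⁻¹' (Set.pi s B) =ᵐ[P]
      (⋂ k ∈ s.image fun i => M - 1 - i,
        count X (Set.Ioc (τ k) (τ (k + 1))) ⁻¹' (B (M - 1 - k)) : Set Ω) := by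
    rw [Filter.eventuallyEq_set]
    have := (ae_ball_iff s.countable_toSet).mpr hcount
    filter_upwards [this] with ω hω
    simp only [Set.mem_preimage, Set.mem_pi, Finset.mem_coe, Finset.mem_image, Set.mem_iInter,
      forall_exists_index, and_imp, forall_apply_eq_imp_iff₂]
    refine forall₂_congr fun i hi => ?_
    have hi' := hsM i hi
    rw [hω i hi, show M - 1 - (M - 1 - i) = i by omega]
  rw [measure_congr hset, hprod]
  refine Finset.prod_congr rfl fun i hi => ?_
  have hi' := hsM i hi
  have hlaw := hX.law (τ (M - 1 - i)) (τ (M - 1 - i + 1)) (hτm (by omega))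
  rw [show M - 1 - (M - 1 - i) = i by omega,
    ← Measure.map_apply_of_aemeasurable hlaw.aemeasurable (hB i), hlaw.map_eq]
  congr 4
  simp only [hτ]
  push_cast
  ring

/-- The steps of the sequence `b`, starting from `0`. -/
def steps (b : ℕ → ℝ) : ℕ → ℝ := cons (b 0) fun n => b (n + 1) - b n

@[fun_prop]
lemma measurable_steps : Measurable steps := by
  unfold steps; fun_prop

@[simp] lemma steps_renewal (e : ℕ → ℝ) : steps (renewal e) = e := by
  ext n
  cases n with
  | zero => simp [steps]
  | succ n => simp [steps, renewal_succ]

@[simp] lemma renewal_steps (b : ℕ → ℝ) : renewal (steps b) = b := by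
  ext n
  induction n with
  | zero => simp [steps]
  | succ n ih => rw [renewal_succ, ih]; simp [steps]

/-- The distances between successive points of a Poisson process, seen backwards from a given
time, are independent exponential variables. -/
lemma IsPoissonProcess.map_steps_backward [IsProbabilityMeasure P] (hX : IsPoissonProcess P X a)
    (hm : ∀ n, Measurable (X n)) (hmono : ∀ᵐ ω ∂P, StrictMono fun n => X n ω) (t : ℝ) :
    P.map (fun ω => steps (backward t fun n => X n ω)) = iid (expMeasure a) := by
  have : Fact (0 < a) := ⟨hX.pos⟩
  have hmX : Measurable fun ω => fun n => X n ω := measurable_pi_lambda _ hm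
  have hmb : Measurable fun ω => backward t fun n => X n ω := (measurable_backward t).comp hmX
  have h := map_eq_map_of_cells (P := P) (P' := iid (expMeasure a))
    (b := fun ω => backward t fun n => X n ω) (b' := renewal) hmb.aemeasurable
    measurable_renewal.aemeasurable
    (fun ε hε => (hX.map_cells_backward hm hmono t hε).trans (map_cells_renewal a hε).symm)
    ((hX.ae_regular hmono).mono fun ω hω => hω.ordered_backward t)
    ((ae_proper a).mono fun e he => he.ordered_renewal)
  have h2 := congrArg (Measure.map steps) h
  rw [Measure.map_map measurable_steps hmb, Measure.map_map measurable_steps measurable_renewal]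
    at h2
  have h3 : steps ∘ renewal = id := by ext1 e; simp
  rw [h3, Measure.map_id] at h2
  exact h2

/-- Marks `Y n` independent of the points and of one another remain so when they are renumbered
according to the points. -/
lemma map_marks [IsProbabilityMeasure P] {Y : ℤ → Ω → ℝ} {π : Measure ℝ} [IsProbabilityMeasure π]
    (hX : ∀ n, Measurable (X n)) (hY : ∀ n, Measurable (Y n))
    (hYlaw : ∀ n, HasLaw (Y n) π P) (hYind : iIndepFun Y P)
    (hXY : IndepFun (fun ω n => X n ω) (fun ω n => Y n ω) P)
    {N : (ℤ → ℝ) → ℤ} (hN : Measurable N) {f : (ℤ → ℝ) → ℕ → ℝ} (hf : Measurable f) :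
    P.map (fun ω => (f fun n => X n ω, fun j : ℕ => Y (N (fun n => X n ω) - j) ω)) =
      (P.map fun ω => f fun n => X n ω).prod (iid π) := by
  have hmX : Measurable fun ω => fun n => X n ω := measurable_pi_lambda _ hX
  have hmY : Measurable fun ω => fun n => Y n ω := measurable_pi_lambda _ hY
  have hjoint := (indepFun_iff_map_prod_eq_prod_map_map hmX.aemeasurable hmY.aemeasurable).mp hXY
  have hYl : P.map (fun ω n => Y n ω) = Measure.infinitePi fun _ : ℤ => π :=
    (hYind.hasLaw_infinitePi hYlaw hmY.aemeasurable).map_eq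
  have := Measure.isProbabilityMeasure_map (μ := P) hmX.aemeasurable
  have := Measure.isProbabilityMeasure_map (μ := P) (hf.comp hmX).aemeasurable
  have hshift : Measurable fun p : (ℤ → ℝ) × (ℤ → ℝ) => fun j : ℕ => p.2 (N p.1 - j) :=
    measurable_pi_lambda _ fun j =>
      measurable_eval_index measurable_snd ((hN.comp measurable_fst).sub_const _)
  have hg : Measurable fun p : (ℤ → ℝ) × (ℤ → ℝ) =>
      (f p.1, fun j : ℕ => p.2 (N p.1 - j)) := (hf.comp measurable_fst).prodMk hshift
  have hcomp : P.map (fun ω => (f fun n => X n ω, fun j : ℕ => Y (N (fun n => X n ω) - j) ω)) =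
      ((P.map fun ω n => X n ω).prod (Measure.infinitePi fun _ : ℤ => π)).map
        (fun p => (f p.1, fun j : ℕ => p.2 (N p.1 - j))) := by
    rw [← hYl, ← hjoint, Measure.map_map hg (hmX.prodMk hmY)]
    rfl
  rw [hcomp]
  have hfl : (P.map fun ω => f fun n => X n ω) = (P.map fun ω n => X n ω).map f := by
    rw [Measure.map_map hf hmX]; rfl
  symm
  refine Measure.prod_eq fun F G hF hG => ?_
  rw [Measure.map_apply hg (hF.prod hG), Measure.prod_apply (hg (hF.prod hG)), hfl,
    Measure.map_apply hf hF, ← lintegral_indicator_one (hf hF), ← lintegral_mul_const _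
      (measurable_one.indicator (hf hF))]
  refine lintegral_congr fun x => ?_
  -- For frozen points `x` the renumbering of the marks is a deterministic injection, so it
  -- preserves the i.i.d. law; this law does not depend on `x`, whence independence.
  by_cases hx : f x ∈ F
  · have h1 : (Prod.mk x ⁻¹' ((fun p : (ℤ → ℝ) × (ℤ → ℝ) =>
        (f p.1, fun j : ℕ => p.2 (N p.1 - j))) ⁻¹' F ×ˢ G)) =
        (fun y : ℤ → ℝ => fun j : ℕ => y (N x - j)) ⁻¹' G := by
      ext y; simp [hx]
    have hinj : Function.Injective fun j : ℕ => N x - (j : ℤ) := fun i j h => by simpa using h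
    rw [h1, ← Measure.map_apply (by fun_prop) hG,
      Measure.map_infinitePi_infinitePi_of_inj (P := fun _ : ℤ => π) hinj]
    simp [hx]
  · have h1 : (Prod.mk x ⁻¹' ((fun p : (ℤ → ℝ) × (ℤ → ℝ) =>
        (f p.1, fun j : ℕ => p.2 (N p.1 - j))) ⁻¹' F ×ˢ G)) = ∅ := by
      ext y; simp [hx]
    rw [h1]
    simp [hx]

end MM1

namespace MM1

/-! ### The one-step output theorem -/

/-- The factor `exp (-(a * y))` tilts the exponential density of parameter `b` into a multiple of
the one of parameter `a + b`: the minimum of two independent exponentials. -/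
lemma lintegral_exp_mul_exp {a b : ℝ} (ha : 0 < a) (hb : 0 < b) {g : ℝ → ℝ≥0∞}
    (hg : Measurable g) :
    ∫⁻ y, ENNReal.ofReal (Real.exp (-(a * y))) * g y ∂(expMeasure b) =
      ENNReal.ofReal (b / (a + b)) * ∫⁻ y, g y ∂(expMeasure (a + b)) := by
  rw [lintegral_exp b (by fun_prop), lintegral_exp (a + b) hg, ← lintegral_const_mul _ (by fun_prop)]
  refine lintegral_congr fun y => ?_
  rw [← mul_assoc, ← mul_assoc, ← ENNReal.ofReal_mul (by positivity),
    ← ENNReal.ofReal_mul (by positivity)]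
  congr 2
  rw [mul_assoc, ← Real.exp_add, ← mul_assoc, div_mul_cancel₀ _ (by positivity)]
  ring_nf

lemma lintegral_exp_shift {a y : ℝ} (hy : 0 ≤ y) {g : ℝ → ℝ≥0∞} (hg : Measurable g) :
    ∫⁻ x, (Set.Ici y).indicator (fun x => g (x - y)) x ∂(expMeasure a) =
      ENNReal.ofReal (Real.exp (-(a * y))) * ∫⁻ u, g u ∂(expMeasure a) := by
  rw [lintegral_indicator measurableSet_Ici,
    ← lintegral_map (f := g) (g := fun x => x - y) hg (by fun_prop), exp_memoryless hy,
    lintegral_smul_measure, smul_eq_mul]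

/-- The part of `output_step` where the interarrival time exceeds the sojourn time. By
memorylessness the excess is a fresh exponential `u`, and both sides become `b / (a + b)` times the
mean of `f (s + u) s`. -/
lemma output_half {a b : ℝ} [ha : Fact (0 < a)] [hb : Fact (0 < b)] {f : ℝ → ℝ → ℝ≥0∞}
    (hf : Measurable (Function.uncurry f)) :
    ∫⁻ s, ∫⁻ t, ∫⁻ x, (Set.Ici t).indicator (fun x => f (s + (x - t)) s) x
        ∂(expMeasure a) ∂(expMeasure b) ∂(expMeasure (a + b)) =
      ∫⁻ y, ∫⁻ x, (Set.Ici y).indicator (fun x => f x y) x ∂(expMeasure a) ∂(expMeasure b) := by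
  have : Fact (0 < a + b) := ⟨add_pos ha.out hb.out⟩
  set g : ℝ → ℝ≥0∞ := fun s => ∫⁻ u, f (s + u) s ∂(expMeasure a) with hg
  have hgm : Measurable g := by
    have : Measurable fun p : ℝ × ℝ => f (p.1 + p.2) p.1 :=
      hf.comp ((measurable_fst.add measurable_snd).prodMk measurable_fst)
    exact this.lintegral_prod_right'
  have hfu : ∀ s, Measurable fun u => f (s + u) s := fun s =>
    hf.comp ((measurable_const.add measurable_id).prodMk measurable_const)
  have h1 : ∀ s, ∫⁻ t, ∫⁻ x, (Set.Ici t).indicator (fun x => f (s + (x - t)) s) x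
      ∂(expMeasure a) ∂(expMeasure b) = ENNReal.ofReal (b / (a + b)) * g s := by
    intro s
    have : ∀ᵐ t ∂(expMeasure b), ∫⁻ x, (Set.Ici t).indicator (fun x => f (s + (x - t)) s) x
        ∂(expMeasure a) = ENNReal.ofReal (Real.exp (-(a * t))) * g s := by
      filter_upwards [ae_nonneg_exp b] with t ht
      exact lintegral_exp_shift ht (hfu s)
    rw [lintegral_congr_ae this, lintegral_exp_mul_exp ha.out hb.out measurable_const]
    simp
  simp_rw [h1]
  rw [lintegral_const_mul _ hgm, ← lintegral_exp_mul_exp ha.out hb.out hgm]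
  refine lintegral_congr_ae ?_
  filter_upwards [ae_nonneg_exp b] with y hy
  rw [← lintegral_exp_shift hy (hfu y)]
  simp

lemma ae_ne_exp (r t : ℝ) : ∀ᵐ x ∂(expMeasure r), x ≠ t := by
  rw [ae_iff]; simpa using exp_singleton r t

/-- If the interarrival time `x`, the sojourn time `t` and the service time `s` are independent
exponential variables of parameters `a`, `b`, `a + b`, then the interdeparture time and the next
sojourn time are independent exponential variables of parameters `a`, `b`. -/
lemma output_step {a b : ℝ} [ha : Fact (0 < a)] [hb : Fact (0 < b)] {f : ℝ → ℝ → ℝ≥0∞}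
    (hf : Measurable (Function.uncurry f)) :
    ∫⁻ s, ∫⁻ t, ∫⁻ x, f (s + max (x - t) 0) (s + max (t - x) 0)
        ∂(expMeasure a) ∂(expMeasure b) ∂(expMeasure (a + b)) =
      ∫⁻ y, ∫⁻ x, f x y ∂(expMeasure a) ∂(expMeasure b) := by
  have : Fact (0 < a + b) := ⟨add_pos ha.out hb.out⟩
  -- The domain is split at `x = t`, a null event on which the integrand is irrelevant.
  have hsplit : ∀ (t : ℝ) (F G H : ℝ → ℝ≥0∞), (∀ x, t < x → F x = G x) →
      (∀ x, x < t → F x = H x) → Measurable G →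
      ∫⁻ x, F x ∂(expMeasure a) = ∫⁻ x, (Set.Ici t).indicator G x ∂(expMeasure a) +
        ∫⁻ x, (Set.Iic t).indicator H x ∂(expMeasure a) := by
    intro t F G H hG hH hGm
    rw [← lintegral_add_left (hGm.indicator measurableSet_Ici)]
    refine lintegral_congr_ae ?_
    filter_upwards [ae_ne_exp a t] with x hx
    rcases lt_or_gt_of_ne hx with h | h
    · simp [h.le, not_le.mpr h, hH x h]
    · simp [h.le, not_le.mpr h, hG x h]
  have hm3 : Measurable fun p : (ℝ × ℝ) × ℝ =>
      (Set.Ici p.1.2).indicator (fun x => f (p.1.1 + (x - p.1.2)) p.1.1) p.2 := by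
    have h1 : Measurable fun p : (ℝ × ℝ) × ℝ => f (p.1.1 + (p.2 - p.1.2)) p.1.1 :=
      hf.comp (by fun_prop : Measurable fun p : (ℝ × ℝ) × ℝ => (p.1.1 + (p.2 - p.1.2), p.1.1))
    have h2 := h1.indicator (measurableSet_le (measurable_fst.snd) (measurable_snd) :
      MeasurableSet {p : (ℝ × ℝ) × ℝ | p.1.2 ≤ p.2})
    exact h2
  have hm3' : Measurable fun p : (ℝ × ℝ) × ℝ =>
      (Set.Iic p.1.2).indicator (fun x => f p.1.1 (p.1.1 + (p.1.2 - x))) p.2 := by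
    have h1 : Measurable fun p : (ℝ × ℝ) × ℝ => f p.1.1 (p.1.1 + (p.1.2 - p.2)) :=
      hf.comp (by fun_prop : Measurable fun p : (ℝ × ℝ) × ℝ => (p.1.1, p.1.1 + (p.1.2 - p.2)))
    have h2 := h1.indicator (measurableSet_le (measurable_snd) (measurable_fst.snd) :
      MeasurableSet {p : (ℝ × ℝ) × ℝ | p.2 ≤ p.1.2})
    exact h2
  have hm2 : Measurable fun p : ℝ × ℝ => (Set.Ici p.1).indicator (fun x => f x p.1) p.2 := by
    have h1 : Measurable fun p : ℝ × ℝ => f p.2 p.1 := hf.comp measurable_swap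
    exact h1.indicator (measurableSet_le measurable_fst measurable_snd :
      MeasurableSet {p : ℝ × ℝ | p.1 ≤ p.2})
  have hm2' : Measurable fun p : ℝ × ℝ => (Set.Iic p.1).indicator (fun x => f x p.1) p.2 := by
    have h1 : Measurable fun p : ℝ × ℝ => f p.2 p.1 := hf.comp measurable_swap
    exact h1.indicator (measurableSet_le measurable_snd measurable_fst :
      MeasurableSet {p : ℝ × ℝ | p.2 ≤ p.1})
  have hL : ∀ s t, ∫⁻ x, f (s + max (x - t) 0) (s + max (t - x) 0) ∂(expMeasure a) =
      ∫⁻ x, (Set.Ici t).indicator (fun x => f (s + (x - t)) s) x ∂(expMeasure a) +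
      ∫⁻ x, (Set.Iic t).indicator (fun x => f s (s + (t - x))) x ∂(expMeasure a) := by
    intro s t
    refine hsplit t _ _ _ (fun x hx => ?_) (fun x hx => ?_) ?_
    · rw [max_eq_left (by linarith), max_eq_right (by linarith), add_zero]
    · rw [max_eq_right (by linarith), max_eq_left (by linarith), add_zero]
    · exact hf.comp (by fun_prop : Measurable fun x : ℝ => (s + (x - t), s))
  have hR : ∀ y, ∫⁻ x, f x y ∂(expMeasure a) =
      ∫⁻ x, (Set.Ici y).indicator (fun x => f x y) x ∂(expMeasure a) +
      ∫⁻ x, (Set.Iic y).indicator (fun x => f x y) x ∂(expMeasure a) := by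
    intro y
    refine hsplit y _ _ _ (fun _ _ => rfl) (fun _ _ => rfl) ?_
    exact hf.comp (by fun_prop : Measurable fun x : ℝ => (x, y))
  have hswap : ∀ (h : ℝ → ℝ → ℝ≥0∞) (t x : ℝ),
      (Set.Iic t).indicator (fun x => h t x) x = (Set.Ici x).indicator (fun t => h t x) t := by
    intro h t x
    by_cases hx : x ≤ t <;> simp [hx]
  simp_rw [hL, hR]
  rw [lintegral_add_left hm2.lintegral_prod_right', ← output_half hf]
  have h3 : ∀ s, ∫⁻ t, (∫⁻ x, (Set.Ici t).indicator (fun x => f (s + (x - t)) s) x ∂(expMeasure a) +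
      ∫⁻ x, (Set.Iic t).indicator (fun x => f s (s + (t - x))) x ∂(expMeasure a)) ∂(expMeasure b) =
      ∫⁻ t, ∫⁻ x, (Set.Ici t).indicator (fun x => f (s + (x - t)) s) x ∂(expMeasure a)
        ∂(expMeasure b) +
      ∫⁻ t, ∫⁻ x, (Set.Iic t).indicator (fun x => f s (s + (t - x))) x ∂(expMeasure a)
        ∂(expMeasure b) := fun s => by
    have := hm3.lintegral_prod_right' (ν := expMeasure a)
    exact lintegral_add_left (this.comp measurable_prodMk_left) _
  simp_rw [h3]
  rw [lintegral_add_left (hm3.lintegral_prod_right' (ν := expMeasure a)).lintegral_prod_right']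
  congr 1
  -- The other half follows by symmetry, exchanging the two parameters and the two variables.
  have h4 := output_half (a := b) (b := a) (f := fun x y => f y x) (hf.comp measurable_swap)
  rw [add_comm b a] at h4
  rw [lintegral_lintegral_swap (μ := expMeasure b) (ν := expMeasure a)
    (f := fun y x => (Set.Iic y).indicator (fun x => f x y) x) hm2'.aemeasurable]
  simp_rw [hswap (fun t x => f x t)]
  rw [← h4]
  refine lintegral_congr fun s => ?_
  rw [lintegral_lintegral_swap (μ := expMeasure b) (ν := expMeasure a)
    (f := fun t x => (Set.Iic t).indicator (fun x => f s (s + (t - x))) x)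
    (hm3'.comp (by fun_prop : Measurable fun p : ℝ × ℝ => ((s, p.1), p.2))).aemeasurable]
  simp_rw [hswap (fun t x => f s (s + (t - x)))]

end MM1

namespace MM1

/-! ### The sojourn time as a function of the past

In what follows, `e j` is the time between the arrivals of the customers `-j` and `-j + 1` (for
`j = 0`, the time between the arrival of the customer `0` and the time of observation), and `s j`
is the service time of the customer `-j`. -/

/-- The net input of work over the `m` customers preceding customer `0`. -/
noncomputable def netInput (e s : ℕ → ℝ) (m : ℕ) : ℝ :=
  ∑ i ∈ Finset.range m, (s (i + 1) - e (i + 1))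

/-- The sojourn time of the customer `0`. -/
noncomputable def sojourn (e s : ℕ → ℝ) : ℝ := s 0 + ⨆ m, netInput e s m

/-- The queue is stable. -/
def Stable (e s : ℕ → ℝ) : Prop :=
  (∀ n, 0 ≤ s n) ∧ Filter.Tendsto (netInput e s) .atTop .atBot

@[simp] lemma netInput_zero (e s : ℕ → ℝ) : netInput e s 0 = 0 := by simp [netInput]

lemma netInput_succ (e s : ℕ → ℝ) (m : ℕ) :
    netInput e s (m + 1) = s 1 - e 1 + netInput (tail e) (tail s) m := by
  rw [netInput, Finset.sum_range_succ', netInput, add_comm]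
  rfl

lemma Stable.bddAbove {e s : ℕ → ℝ} (h : Stable e s) : BddAbove (Set.range (netInput e s)) :=
  h.2.isBoundedUnder_le_atBot.bddAbove_range

lemma Stable.tail {e s : ℕ → ℝ} (h : Stable e s) : Stable (tail e) (tail s) := by
  refine ⟨fun n => h.1 (n + 1), ?_⟩
  have h1 := (Filter.tendsto_atBot_add_const_left .atTop (-(s 1 - e 1))
    (h.2.comp (Filter.tendsto_add_atTop_nat 1)))
  refine h1.congr fun m => ?_
  simp only [Function.comp_apply, netInput_succ]
  ring

/-- This is the Lindley recursion: the term `m = 0` of the supremum gives the `0` of the maximum,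
the terms `m ≥ 1` give the previous sojourn time minus the interarrival time. -/
lemma Stable.sojourn_eq {e s : ℕ → ℝ} (h : Stable e s) :
    sojourn e s = s 0 + max (sojourn (MM1.tail e) (MM1.tail s) - e 1) 0 := by
  unfold sojourn
  congr 1
  have hb := h.bddAbove
  have hb' := h.tail.bddAbove
  apply le_antisymm
  · refine ciSup_le fun m => ?_
    cases m with
    | zero => simp
    | succ m =>
      rw [netInput_succ]
      refine le_max_of_le_left ?_
      have := le_ciSup hb' m
      simp only [MM1.tail, zero_add] at this ⊢
      linarith
  · refine max_le ?_ ?_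
    · rw [sub_le_iff_le_add, ← le_sub_iff_add_le']
      refine ciSup_le fun m => ?_
      have := le_ciSup hb (m + 1)
      rw [netInput_succ] at this
      simp only [MM1.tail, zero_add] at this ⊢
      linarith
    · simpa using le_ciSup hb 0

@[fun_prop]
lemma measurable_netInput (m : ℕ) :
    Measurable fun p : (ℕ → ℝ) × (ℕ → ℝ) => netInput p.1 p.2 m := by
  unfold netInput; fun_prop

@[fun_prop]
lemma measurable_sojourn : Measurable fun p : (ℕ → ℝ) × (ℕ → ℝ) => sojourn p.1 p.2 := by
  unfold sojourn
  exact ((measurable_pi_apply 0).comp measurable_snd).add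
    (Measurable.iSup fun m => measurable_netInput m)

/-- The sojourn time of the customer `0`, and the times between the observation and the arrival
of the customer `0`, between the departures of the customers `-1` and `0`, `-2` and `-1`, …, if the
sojourn time of the customer `-n` is `u`. -/
noncomputable def output : ℕ → ℝ → (ℕ → ℝ) → (ℕ → ℝ) → ℝ × (ℕ → ℝ)
  | 0, u, e, _ => (u, e)
  | n + 1, u, e, s =>
    let p := output n u (tail e) (tail s)
    (s 0 + max (p.1 - p.2 0) 0, cons (e 0) (cons (s 0 + max (p.2 0 - p.1) 0) (tail p.2)))

lemma measurable_output (n : ℕ) :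
    Measurable fun p : ℝ × (ℕ → ℝ) × (ℕ → ℝ) => output n p.1 p.2.1 p.2.2 := by
  induction n with
  | zero => unfold output; fun_prop
  | succ n ih =>
    have h : Measurable fun p : ℝ × (ℕ → ℝ) × (ℕ → ℝ) =>
        output n p.1 (tail p.2.1) (tail p.2.2) :=
      ih.comp (by fun_prop : Measurable fun p : ℝ × (ℕ → ℝ) × (ℕ → ℝ) =>
        (p.1, tail p.2.1, tail p.2.2))
    simp only [output]
    fun_prop

@[simp] lemma output_snd_zero (n : ℕ) (u : ℝ) (e s : ℕ → ℝ) : (output n u e s).2 0 = e 0 := by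
  cases n <;> rfl

lemma output_succ_fst (n : ℕ) (u : ℝ) (e s : ℕ → ℝ) :
    (output (n + 1) u e s).1 = s 0 + max ((output n u (tail e) (tail s)).1 - e 1) 0 := by
  simp [output, tail]

lemma output_succ_snd_one (n : ℕ) (u : ℝ) (e s : ℕ → ℝ) :
    (output (n + 1) u e s).2 1 = s 0 + max (e 1 - (output n u (tail e) (tail s)).1) 0 := by
  simp only [output]
  rw [show (1 : ℕ) = 0 + 1 from rfl, cons_succ, cons_zero, output_snd_zero]
  rfl

lemma output_succ_snd_succ (n j : ℕ) (u : ℝ) (e s : ℕ → ℝ) :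
    (output (n + 1) u e s).2 (j + 2) = (output n u (tail e) (tail s)).2 (j + 1) := rfl

/-- The initial sojourn time `u` still matters only if the server has been busy ever since; this is
the second member of the maximum. -/
lemma output_fst_le {e s : ℕ → ℝ} (h : Stable e s) (n : ℕ) (u : ℝ) :
    (output n u e s).1 ≤ max (sojourn e s) (u + ∑ i ∈ Finset.range n, (s i - e (i + 1))) := by
  induction n generalizing e s with
  | zero => simp [output]
  | succ n ih =>
    rw [output_succ_fst, h.sojourn_eq, Finset.sum_range_succ']
    have h1 := ih h.tail
    have h4 : ∑ i ∈ Finset.range n, (MM1.tail s i - MM1.tail e (i + 1)) =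
      ∑ i ∈ Finset.range n, (s (i + 1) - e (i + 1 + 1)) := rfl
    rw [h4] at h1
    simp only [zero_add]
    rcases max_cases ((output n u (MM1.tail e) (MM1.tail s)).1 - e 1) 0 with ⟨h2, _⟩ | ⟨h2, _⟩
    · rw [h2]
      rcases le_max_iff.mp h1 with h3 | h3
      · refine le_max_of_le_left ?_
        linarith [le_max_left (sojourn (MM1.tail e) (MM1.tail s) - e 1) 0]
      · refine le_max_of_le_right ?_
        linarith
    · rw [h2]
      refine le_max_of_le_left ?_
      linarith [le_max_right (sojourn (MM1.tail e) (MM1.tail s) - e 1) 0]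

lemma le_output_fst (e s : ℕ → ℝ) {n m : ℕ} (hm : m < n) (u : ℝ) :
    s 0 + netInput e s m ≤ (output n u e s).1 := by
  induction n generalizing e s m with
  | zero => omega
  | succ n ih =>
    rw [output_succ_fst]
    cases m with
    | zero => simp
    | succ m =>
      have := ih (tail e) (tail s) (m := m) (by omega)
      have h1 : tail s 0 = s 1 := rfl
      rw [netInput_succ]
      linarith [le_max_left ((output n u (tail e) (tail s)).1 - e 1) 0]

lemma sum_sub_eq_netInput (e s : ℕ → ℝ) (n : ℕ) :
    s n + ∑ i ∈ Finset.range n, (s i - e (i + 1)) = s 0 + netInput e s n := by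
  induction n with
  | zero => simp
  | succ n ih =>
    rw [Finset.sum_range_succ]
    have : netInput e s (n + 1) = netInput e s n + (s (n + 1) - e (n + 1)) := by
      rw [netInput, Finset.sum_range_succ]; rfl
    rw [this]
    linarith

/-- The initial condition is forgotten: its contribution tends to `-∞` with the net input, while the
lower bound `le_output_fst` exhausts the supremum. -/
lemma Stable.tendsto_output_fst {e s : ℕ → ℝ} (h : Stable e s) (u : ℝ) :
    Filter.Tendsto (fun n => (output n u e s).1) .atTop (𝓝 (sojourn e s)) := by
  rw [tendsto_order]
  constructor
  · intro a ha
    have : a - s 0 < ⨆ m, netInput e s m := by unfold sojourn at ha; linarith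
    obtain ⟨m, hm⟩ := exists_lt_of_lt_ciSup this
    filter_upwards [Filter.eventually_gt_atTop m] with n hn
    linarith [le_output_fst e s hn u]
  · intro a ha
    filter_upwards [h.2.eventually_lt_atBot (a - s 0 - u)] with n hn
    refine (output_fst_le h n u).trans_lt (max_lt ha ?_)
    linarith [sum_sub_eq_netInput e s n, h.1 n]

/-- The time between the observation and the arrival of the customer `0`, and the successive
interdeparture times. -/
noncomputable def outputGaps (e s : ℕ → ℝ) : ℕ → ℝ :=
  cons (e 0) fun j => s j + max (e (j + 1) - sojourn (fun i => e (i + (j + 1)))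
    (fun i => s (i + (j + 1)))) 0

@[fun_prop]
lemma measurable_outputGaps :
    Measurable fun p : (ℕ → ℝ) × (ℕ → ℝ) => outputGaps p.1 p.2 := by
  unfold outputGaps
  refine measurable_cons (by fun_prop) (measurable_pi_lambda _ fun j => ?_)
  have h : Measurable fun p : (ℕ → ℝ) × (ℕ → ℝ) => sojourn (fun i => p.1 (i + (j + 1)))
      (fun i => p.2 (i + (j + 1))) :=
    measurable_sojourn.comp (by fun_prop : Measurable fun p : (ℕ → ℝ) × (ℕ → ℝ) =>
      ((fun i => p.1 (i + (j + 1))), (fun i => p.2 (i + (j + 1)))))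
  fun_prop

lemma Stable.tendsto_output_snd {e s : ℕ → ℝ} (h : Stable e s) (u : ℝ) (j : ℕ) :
    Filter.Tendsto (fun n => (output n u e s).2 j) .atTop (𝓝 (outputGaps e s j)) := by
  cases j with
  | zero =>
    simp only [output_snd_zero]
    exact tendsto_const_nhds
  | succ j =>
    induction j generalizing e s with
    | zero =>
      rw [← Filter.tendsto_add_atTop_iff_nat 1]
      simp only [output_succ_snd_one, zero_add]
      exact ((tendsto_const_nhds.sub (h.tail.tendsto_output_fst u)).max
        tendsto_const_nhds).const_add _
    | succ j ih =>
      rw [← Filter.tendsto_add_atTop_iff_nat 1]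
      simp only [output_succ_snd_succ]
      exact ih h.tail

/-- The Lindley recursion determines the sojourn time if the queue was empty infinitely often. -/
lemma Stable.eq_sojourn {e s T : ℕ → ℝ} (h : Stable e s)
    (hT : ∀ j, T j = s j + max (T (j + 1) - e (j + 1)) 0)
    (hempty : ∃ j, T (j + 1) ≤ e (j + 1)) : T 0 = sojourn e s := by
  -- Any solution is the recursion run from its own value `T n`. At an idle epoch `j` this value is
  -- just `s j`, which gives the upper bound.
  have key : ∀ n (e s T : ℕ → ℝ), (∀ j, T j = s j + max (T (j + 1) - e (j + 1)) 0) →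
      T 0 = (output n (T n) e s).1 := by
    intro n
    induction n with
    | zero => intro e s T _; rfl
    | succ n ih =>
      intro e s T hT
      have h1 : T 1 = (output n (T (n + 1)) (MM1.tail e) (MM1.tail s)).1 :=
        ih (MM1.tail e) (MM1.tail s) (MM1.tail T) fun j => hT (j + 1)
      rw [output_succ_fst, ← h1]
      exact hT 0
  apply le_antisymm
  · obtain ⟨j, hj⟩ := hempty
    have h1 : T j = s j := by rw [hT j, max_eq_right (by linarith), add_zero]
    rw [key j e s T hT, h1]
    refine (output_fst_le h j _).trans (max_le le_rfl ?_)
    rw [sum_sub_eq_netInput]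
    have := le_ciSup h.bddAbove j
    unfold sojourn
    linarith
  · unfold sojourn
    rw [← le_sub_iff_add_le']
    refine ciSup_le fun m => ?_
    have := le_output_fst e s m.lt_succ_self (T (m + 1))
    rw [← key (m + 1) e s T hT] at this
    linarith

/-- By the law of large numbers the net input grows like `n (1/μ - 1/λ)`, with a negative slope. -/
lemma ae_stable {lam mu : ℝ} [hl : Fact (0 < lam)] [hm : Fact (0 < mu)] (hlm : lam < mu) :
    ∀ᵐ p ∂((iid (expMeasure lam)).prod (iid (expMeasure mu))), Stable p.1 p.2 := by
  have h1 : ∀ (r : ℝ) [Fact (0 < r)], ∀ᵐ e ∂(iid (expMeasure r)),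
      Filter.Tendsto (fun n : ℕ => (∑ i ∈ Finset.range n, e (i + 1)) / (n : ℝ)) .atTop
        (𝓝 r⁻¹) := by
    intro r _
    have := iid_exp_slln r
    rw [← map_tail_iid] at this
    exact ae_of_ae_map (by fun_prop) this
  have h2 := Measure.quasiMeasurePreserving_fst (μ := iid (expMeasure lam))
    (ν := iid (expMeasure mu)) |>.ae (h1 lam)
  have h3 := Measure.quasiMeasurePreserving_snd (μ := iid (expMeasure lam))
    (ν := iid (expMeasure mu)) |>.ae (h1 mu)
  have h4 := Measure.quasiMeasurePreserving_snd (μ := iid (expMeasure lam))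
    (ν := iid (expMeasure mu)) |>.ae (ae_iid_of_ae _ (ae_nonneg_exp mu))
  filter_upwards [h2, h3, h4] with p hp1 hp2 hp3
  refine ⟨hp3, ?_⟩
  have h5 := (hp2.sub hp1).neg_mul_atTop (sub_neg.mpr (inv_strictAnti₀ hl.out hlm))
    tendsto_natCast_atTop_atTop
  refine h5.congr' ?_
  filter_upwards [Filter.eventually_gt_atTop 0] with n hn
  rw [netInput, Finset.sum_sub_distrib]
  field_simp

/-- An exponential sojourn time independent of an i.i.d. exponential sequence is an invariant of
each step of the queue. Here `u` is the sojourn time of the customer from whom the recursion starts.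
-/
lemma lintegral_output {a b : ℝ} [ha : Fact (0 < a)] [hb : Fact (0 < b)] [hab : Fact (0 < a + b)]
    (n : ℕ) {f : ℝ × (ℕ → ℝ) → ℝ≥0∞} (hf : Measurable f) :
    ∫⁻ u, ∫⁻ e, ∫⁻ s, f (output n u e s) ∂(iid (expMeasure (a + b))) ∂(iid (expMeasure a))
        ∂(expMeasure b) = ∫⁻ u, ∫⁻ e, f (u, e) ∂(iid (expMeasure a)) ∂(expMeasure b) := by
  induction n generalizing f with
  | zero => simp [output]
  | succ n ih =>
    set F : ℝ → ℝ → ℝ × (ℕ → ℝ) → ℝ≥0∞ := fun x y p =>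
      f (y + max (p.1 - p.2 0) 0, cons x (cons (y + max (p.2 0 - p.1) 0) (tail p.2))) with hF
    have hFm : Measurable fun q : ℝ × ℝ × (ℝ × (ℕ → ℝ)) => F q.1 q.2.1 q.2.2 :=
      hf.comp (by fun_prop)
    have hom := measurable_output n
    have hom' := measurable_output (n + 1)
    have hG : Measurable fun q : (ℝ × ℝ × ℝ × (ℕ → ℝ)) × (ℕ → ℝ) =>
        F q.1.1 q.1.2.1 (output n q.1.2.2.1 q.1.2.2.2 q.2) :=
      hFm.comp ((by fun_prop : Measurable fun q : (ℝ × ℝ × ℝ × (ℕ → ℝ)) × (ℕ → ℝ) =>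
        q.1.1).prodMk ((by fun_prop : Measurable fun q : (ℝ × ℝ × ℝ × (ℕ → ℝ)) × (ℕ → ℝ) =>
        q.1.2.1).prodMk (hom.comp (by fun_prop : Measurable
          fun q : (ℝ × ℝ × ℝ × (ℕ → ℝ)) × (ℕ → ℝ) => (q.1.2.2.1, q.1.2.2.2, q.2)))))
    have hG1 := hG.lintegral_prod_right' (ν := iid (expMeasure (a + b)))
    set G : ℝ × ℝ × ℝ × (ℕ → ℝ) → ℝ≥0∞ := fun q =>
      ∫⁻ s, F q.1 q.2.1 (output n q.2.2.1 q.2.2.2 s) ∂(iid (expMeasure (a + b))) with hGdef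
    have hG2 : Measurable fun q : ℝ × ℝ × ℝ =>
        ∫⁻ e, G (q.1, q.2.1, q.2.2, e) ∂(iid (expMeasure a)) :=
      (hG1.comp (by fun_prop : Measurable fun q : (ℝ × ℝ × ℝ) × (ℕ → ℝ) =>
        (q.1.1, q.1.2.1, q.1.2.2, q.2))).lintegral_prod_right'
    have hG3 : Measurable fun q : ℝ × ℝ => ∫⁻ y, ∫⁻ e, G (q.1, y, q.2, e)
        ∂(iid (expMeasure a)) ∂(expMeasure (a + b)) :=
      (hG2.comp (by fun_prop : Measurable fun q : (ℝ × ℝ) × ℝ =>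
        (q.1.1, q.2, q.1.2))).lintegral_prod_right'
    -- The first interarrival time `x` and the first service time `y` are split off; what remains is
    -- an `n`-step output.
    have h1 : ∀ u, ∫⁻ e, ∫⁻ s, f (output (n + 1) u e s) ∂(iid (expMeasure (a + b)))
        ∂(iid (expMeasure a)) = ∫⁻ x, ∫⁻ y, ∫⁻ e, G (x, y, u, e) ∂(iid (expMeasure a))
          ∂(expMeasure (a + b)) ∂(expMeasure a) := by
      intro u
      have hm : Measurable fun q : (ℕ → ℝ) × (ℕ → ℝ) => f (output (n + 1) u q.1 q.2) :=
        hf.comp (hom'.comp (by fun_prop : Measurable fun q : (ℕ → ℝ) × (ℕ → ℝ) =>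
          (u, q.1, q.2)))
      rw [lintegral_iid_cons _ hm.lintegral_prod_right']
      refine lintegral_congr fun x => ?_
      rw [lintegral_lintegral_swap (μ := expMeasure (a + b)) (ν := iid (expMeasure a))
        (f := fun y e => G (x, y, u, e)) (hG1.comp (by fun_prop : Measurable
          fun q : ℝ × (ℕ → ℝ) => (x, q.1, u, q.2))).aemeasurable]
      refine lintegral_congr fun e => ?_
      exact lintegral_iid_cons _ (hm.comp measurable_prodMk_left)
    simp_rw [h1]
    rw [lintegral_lintegral_swap (μ := expMeasure b) (ν := expMeasure a)
      (f := fun u x => ∫⁻ y, ∫⁻ e, G (x, y, u, e) ∂(iid (expMeasure a)) ∂(expMeasure (a + b)))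
      (hG3.comp measurable_swap).aemeasurable,
      lintegral_lintegral_swap (μ := expMeasure b) (ν := iid (expMeasure a))
      (f := fun u e => f (u, e)) hf.aemeasurable, lintegral_iid_cons _ hf.lintegral_prod_left']
    refine lintegral_congr fun x => ?_
    rw [lintegral_lintegral_swap (μ := expMeasure b) (ν := expMeasure (a + b))
      (f := fun u y => ∫⁻ e, G (x, y, u, e) ∂(iid (expMeasure a)))
      (hG2.comp (by fun_prop : Measurable fun q : ℝ × ℝ => (x, q.2, q.1))).aemeasurable]
    set H : ℝ → ℝ → ℝ≥0∞ := fun d t => ∫⁻ e, f (t, cons x (cons d e)) ∂(iid (expMeasure a))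
      with hH
    have hHm : Measurable (Function.uncurry H) := by
      have : Measurable fun q : (ℝ × ℝ) × (ℕ → ℝ) => f (q.1.2, cons x (cons q.1.1 q.2)) :=
        hf.comp (by fun_prop)
      exact this.lintegral_prod_right'
    -- By the induction hypothesis the `n`-step output has the product law, so its sojourn time `t`
    -- and first gap `d` are the independent inputs required by `output_step`.
    have h2 : ∀ y, ∫⁻ u, ∫⁻ e, G (x, y, u, e) ∂(iid (expMeasure a)) ∂(expMeasure b) =
        ∫⁻ t, ∫⁻ d, H (y + max (d - t) 0) (y + max (t - d) 0)
          ∂(expMeasure a) ∂(expMeasure b) := by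
      intro y
      have hFy : Measurable (F x y) :=
        hFm.comp (measurable_const.prodMk (measurable_const.prodMk measurable_id))
      rw [ih hFy]
      refine lintegral_congr fun t => ?_
      exact lintegral_iid_cons _ (hFy.comp measurable_prodMk_left)
    simp_rw [h2]
    rw [output_step hHm, lintegral_lintegral_swap (μ := iid (expMeasure a)) (ν := expMeasure b)
      (f := fun e t => f (t, cons x e)) (hf.comp (by fun_prop : Measurable
        fun q : (ℕ → ℝ) × ℝ => (q.2, cons x q.1))).aemeasurable]
    refine lintegral_congr fun t => ?_
    exact (lintegral_iid_cons _ (hf.comp (by fun_prop : Measurable fun e => (t, cons x e)))).symm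

/-- The output theorem: the sojourn time of the customer `0` is independent of the past of the
departures, and the interdeparture times are independent exponential variables. -/
lemma map_sojourn_outputGaps {a b : ℝ} [ha : Fact (0 < a)] [hb : Fact (0 < b)]
    [hab : Fact (0 < a + b)] :
    ((iid (expMeasure a)).prod (iid (expMeasure (a + b)))).map
      (fun p => (sojourn p.1 p.2, outputGaps p.1 p.2)) =
        (expMeasure b).prod (iid (expMeasure a)) := by
  -- The far customer receives an independent exponential sojourn time. The law of the output is
  -- then the same for every `n`, and the limit no longer depends on this auxiliary choice.
  set Q := (expMeasure b).prod ((iid (expMeasure a)).prod (iid (expMeasure (a + b)))) with hQ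
  have hZ : Measurable fun p : (ℕ → ℝ) × (ℕ → ℝ) => (sojourn p.1 p.2, outputGaps p.1 p.2) := by
    fun_prop
  have h1 : ∀ n, Q.map (fun p => output n p.1 p.2.1 p.2.2) =
      (expMeasure b).prod (iid (expMeasure a)) := by
    intro n
    refine Measure.ext_of_lintegral _ fun f hf => ?_
    have hm : Measurable fun p : ℝ × (ℕ → ℝ) × (ℕ → ℝ) => f (output n p.1 p.2.1 p.2.2) :=
      hf.comp (measurable_output n)
    rw [lintegral_map hf (measurable_output n), lintegral_prod _ hf.aemeasurable,
      ← lintegral_output n hf, hQ, lintegral_prod _ hm.aemeasurable]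
    refine lintegral_congr fun u => ?_
    exact lintegral_prod _ (hm.comp measurable_prodMk_left).aemeasurable
  have h2 : ∀ᵐ p ∂Q, Filter.Tendsto (fun n => output n p.1 p.2.1 p.2.2) .atTop
      (𝓝 (sojourn p.2.1 p.2.2, outputGaps p.2.1 p.2.2)) := by
    have := Measure.quasiMeasurePreserving_snd (μ := expMeasure b)
      (ν := (iid (expMeasure a)).prod (iid (expMeasure (a + b)))) |>.ae
        (ae_stable (lt_add_of_pos_right a hb.out))
    filter_upwards [this] with p hp
    exact (hp.tendsto_output_fst p.1).prodMk_nhds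
      (tendsto_pi_nhds.mpr fun j => hp.tendsto_output_snd p.1 j)
  have h3 := map_eq_map_of_tendsto (P := Q) (P' := (expMeasure b).prod (iid (expMeasure a)))
    (Y' := fun _ => id) (Z' := id) (fun n => (measurable_output n).aemeasurable)
    (fun _ => aemeasurable_id) (hZ.comp measurable_snd).aemeasurable aemeasurable_id
    (fun n => by rw [h1, Measure.map_id]) h2 (.of_forall fun _ => tendsto_const_nhds)
  rw [Measure.map_id, ← Measure.map_map hZ measurable_snd, hQ, Measure.map_snd_prod] at h3
  simpa using h3

end MM1

namespace MM1

/-! ### The queue seen from a given time -/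

variable {Ω : Type*} [MeasurableSpace Ω] {P : Measure Ω} {A σ S : ℤ → Ω → ℝ}

/-- The index of the last customer to arrive up to time `t`. -/
noncomputable def lastCustomer (A : ℤ → Ω → ℝ) (t : ℝ) (ω : Ω) : ℤ :=
  lastIndex t fun n => A n ω

/-- The successive interarrival times, seen backwards from time `t`. -/
noncomputable def pastGaps (A : ℤ → Ω → ℝ) (t : ℝ) (ω : Ω) : ℕ → ℝ :=
  steps (backward t fun n => A n ω)

/-- The service times of the customers that arrived up to time `t`, the last one first. -/
noncomputable def pastServices (A σ : ℤ → Ω → ℝ) (t : ℝ) (ω : Ω) : ℕ → ℝ :=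
  fun j => σ (lastCustomer A t ω - j) ω

lemma map_past [IsProbabilityMeasure P] {lam mu : ℝ} [Fact (0 < mu)]
    (hQ : IsEquilibriumMM1 P lam mu A σ S) (t : ℝ) :
    P.map (fun ω => (pastGaps A t ω, pastServices A σ t ω)) =
      (iid (expMeasure lam)).prod (iid (expMeasure mu)) := by
  have h := map_marks (π := expMeasure mu) hQ.measurable_arrival hQ.measurable_service
    hQ.service_law hQ.service_indep hQ.arrival_indep_service (measurable_lastIndex t)
    (f := fun x => steps (backward t x)) (measurable_steps.comp (measurable_backward t))
  rw [hQ.arrival_poisson.map_steps_backward hQ.measurable_arrival hQ.arrival_strictMono] at h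
  exact h

lemma IsEquilibriumMM1.measurable_past {lam mu : ℝ} (hQ : IsEquilibriumMM1 P lam mu A σ S)
    (t : ℝ) : Measurable fun ω => (pastGaps A t ω, pastServices A σ t ω) := by
  have hA : Measurable fun ω => fun n => A n ω := measurable_pi_lambda _ hQ.measurable_arrival
  have hσ : Measurable fun ω => fun n => σ n ω := measurable_pi_lambda _ hQ.measurable_service
  refine (measurable_steps.comp ((measurable_backward t).comp hA)).prodMk
    (measurable_pi_lambda _ fun j => ?_)
  exact measurable_eval_index hσ (((measurable_lastIndex t).comp hA).sub_const _)

lemma ae_of_past [IsProbabilityMeasure P] {lam mu : ℝ} [Fact (0 < mu)]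
    (hQ : IsEquilibriumMM1 P lam mu A σ S) (t : ℝ) {p : (ℕ → ℝ) × (ℕ → ℝ) → Prop}
    (h : ∀ᵐ q ∂((iid (expMeasure lam)).prod (iid (expMeasure mu))), p q) :
    ∀ᵐ ω ∂P, p (pastGaps A t ω, pastServices A σ t ω) := by
  rw [← map_past hQ t] at h
  exact ae_of_ae_map (hQ.measurable_past t).aemeasurable h

lemma IsEquilibriumMM1.ae_service_nonneg {lam mu : ℝ} (hQ : IsEquilibriumMM1 P lam mu A σ S) :
    ∀ᵐ ω ∂P, ∀ n, 0 < σ n ω := by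
  rw [ae_all_iff]
  intro n
  exact ((hQ.service_law n).ae_iff (p := fun x => 0 < x)
    measurableSet_Ioi.mem).mpr (ae_pos_exp mu)

/-- The sample paths of the queue. -/
structure Path (A σ S : ℤ → ℝ) : Prop where
  regular : Regular A
  zero : A 0 ≤ 0 ∧ 0 < A 1
  service_pos : ∀ n, 0 < σ n
  fifo : ∀ n, S (n + 1) = max (A (n + 1)) (S n + σ n)

lemma IsEquilibriumMM1.ae_path {lam mu : ℝ} (hQ : IsEquilibriumMM1 P lam mu A σ S) :
    ∀ᵐ ω ∂P, Path (fun n => A n ω) (fun n => σ n ω) fun n => S n ω := by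
  filter_upwards [hQ.arrival_poisson.ae_regular hQ.arrival_strictMono, hQ.arrival_zero,
    hQ.ae_service_nonneg, hQ.fifo] with ω h1 h2 h3 h4
  exact ⟨h1, h2, h3, h4⟩

/-! ### Deterministic properties of the sample paths. -/

section Path

variable {A σ S : ℤ → ℝ}

lemma Path.arrival_le_start (h : Path A σ S) (n : ℤ) : A n ≤ S n := by
  have := h.fifo (n - 1)
  rw [sub_add_cancel] at this
  rw [this]
  exact le_max_left _ _

lemma Path.departure_le_start (h : Path A σ S) (n : ℤ) : S n + σ n ≤ S (n + 1) := by
  rw [h.fifo n]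
  exact le_max_right _ _

lemma Path.start_strictMono (h : Path A σ S) : StrictMono S :=
  strictMono_int_of_lt_succ fun n => by linarith [h.departure_le_start n, h.service_pos n]

lemma Path.departure_strictMono (h : Path A σ S) : StrictMono fun n => S n + σ n :=
  strictMono_int_of_lt_succ fun n => by
    linarith [h.departure_le_start n, h.service_pos (n + 1)]

lemma Path.lastIndex_zero (h : Path A σ S) : lastIndex 0 A = 0 := by
  rw [h.regular.lastIndex_eq_iff]
  simpa using h.zero

/-- If the server never idled before some time, then the departures are explicit. -/
lemma Path.departure_of_busy (h : Path A σ S) {n₀ : ℕ}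
    (hbusy : ∀ n ≤ -(n₀ : ℤ), A (n + 1) < S n + σ n) :
    ∃ c, ∀ j : ℕ, n₀ ≤ j →
      S (-(j : ℤ)) + σ (-(j : ℤ)) = c - ∑ i ∈ Finset.range j, σ (-(i : ℤ)) := by
  refine ⟨S (-(n₀ : ℤ)) + σ (-(n₀ : ℤ)) + ∑ i ∈ Finset.range n₀, σ (-(i : ℤ)), fun j hj => ?_⟩
  induction j, hj using Nat.le_induction with
  | base => ring
  | succ j hj ih =>
    have h1 := h.fifo (-((j + 1 : ℕ) : ℤ))
    rw [max_eq_right (hbusy _ (by push_cast; omega)).le,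
      show -((j + 1 : ℕ) : ℤ) + 1 = -(j : ℤ) by push_cast; ring] at h1
    rw [← h1, Finset.sum_range_succ]
    linarith

lemma Path.renewal_gaps (h : Path A σ S) (n : ℕ) :
    ∑ i ∈ Finset.range (n + 1), steps (backward 0 A) i = -A (-(n : ℤ)) := by
  have := congrFun (renewal_steps (backward 0 A)) n
  rw [renewal] at this
  rw [this, backward, h.lastIndex_zero]
  simp

/-- The number of customers present at time `t`. -/
lemma Path.le_queue (h : Path A σ S) {t : ℝ} {k : ℕ}
    (hk : A (lastIndex t A + 1) ≤ S (lastIndex t A - k) + σ (lastIndex t A - k)) :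
    (k : ℕ∞) ≤ Set.encard {n | A n ≤ t ∧ t < S n + σ n} := by
  set N := lastIndex t A
  have hinj : Function.Injective fun j : ℕ => N - (j : ℤ) := fun i j h => by simpa using h
  have hsub : (fun j : ℕ => N - (j : ℤ)) '' (Finset.range k : Finset ℕ) ⊆
      {n | A n ≤ t ∧ t < S n + σ n} := by
    rintro _ ⟨j, hj, rfl⟩
    have hj' : j < k := by simpa using hj
    refine ⟨(h.regular.le_lastIndex_iff t _).mp (by simp [N]), ?_⟩
    refine (h.regular.lt_next t).trans_le (hk.trans ?_)
    exact h.departure_strictMono.monotone (show N - (k : ℤ) ≤ N - (j : ℤ) by omega)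
  have := Set.encard_le_encard hsub
  rwa [hinj.encard_image, Set.encard_coe_eq_coe_finsetCard, Finset.card_range] at this

lemma Path.queue_ne_top (h : Path A σ S) {n₁ : ℤ} (hn : S n₁ + σ n₁ ≤ 0) :
    Set.encard {n | A n ≤ 0 ∧ 0 < S n + σ n} ≠ ⊤ := by
  have hsub : {n | A n ≤ 0 ∧ 0 < S n + σ n} ⊆ Set.Icc n₁ 0 := by
    rintro n ⟨h1, h2⟩
    constructor
    · by_contra hlt
      have := h.departure_strictMono.monotone (not_le.mp hlt).le
      linarith
    · by_contra hlt
      have := h.regular.1.monotone (show 1 ≤ n by omega)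
      linarith [h.zero.2]
  exact ((Set.finite_Icc n₁ 0).subset hsub).encard_lt_top.ne

/-- If the server never idled before some time, then the queue was arbitrarily long in the
remote past. -/
lemma Path.tendsto_queue_of_busy (h : Path A σ S) {a b : ℝ} (ha : 0 < a) (hb : 0 < b)
    (hA : Filter.Tendsto (fun n : ℕ => (∑ i ∈ Finset.range n, steps (backward 0 A) i) / (n : ℝ))
      .atTop (𝓝 a⁻¹))
    (hσ : Filter.Tendsto (fun n : ℕ => (∑ i ∈ Finset.range n, σ (-(i : ℤ))) / (n : ℝ))
      .atTop (𝓝 (a + b)⁻¹))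
    {n₀ : ℤ} (hbusy : ∀ n ≤ n₀, A (n + 1) < S n + σ n) :
    (∀ k : ℕ, ∀ᶠ m : ℕ in .atTop, (k : ℕ∞) ≤
      Set.encard {n | A n ≤ -(m : ℝ) ∧ -(m : ℝ) < S n + σ n}) ∧
    ∃ n₁, S n₁ + σ n₁ ≤ 0 := by
  obtain ⟨j₀, hj₀⟩ : ∃ j₀ : ℕ, -(j₀ : ℤ) ≤ n₀ := ⟨n₀.natAbs, by omega⟩
  obtain ⟨c, hc⟩ := h.departure_of_busy (n₀ := j₀) fun n hn => hbusy n (hn.trans hj₀)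
  -- Arrivals recede at rate `1/a` per customer and departures only at rate `1/(a + b)`; the shift
  -- by a fixed `k` does not affect the slopes.
  have hlim : ∀ k : ℕ, Filter.Tendsto (fun n : ℕ => ∑ i ∈ Finset.range n, steps (backward 0 A) i -
      ∑ i ∈ Finset.range (n + k), σ (-(i : ℤ))) .atTop .atTop := by
    intro k
    have h1 : Filter.Tendsto (fun n : ℕ => (∑ i ∈ Finset.range (n + k), σ (-(i : ℤ))) / (n : ℝ))
        .atTop (𝓝 ((a + b)⁻¹ * 1)) := by
      have h2 : Filter.Tendsto (fun n : ℕ => ((n + k : ℕ) : ℝ) / n) .atTop (𝓝 1) := by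
        have h3 : Filter.Tendsto (fun n : ℕ => 1 + (k : ℝ) / n) .atTop (𝓝 (1 + 0)) :=
          tendsto_const_nhds.add (tendsto_const_div_atTop_nhds_zero_nat (k : ℝ))
        rw [add_zero] at h3
        refine h3.congr' ?_
        filter_upwards [Filter.eventually_gt_atTop 0] with n hn
        push_cast
        field_simp
      refine ((hσ.comp (Filter.tendsto_add_atTop_nat k)).mul h2).congr' ?_
      filter_upwards [Filter.eventually_gt_atTop 0] with n hn
      have : ((n + k : ℕ) : ℝ) ≠ 0 := by positivity
      simp only [Function.comp_apply]
      field_simp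
    rw [mul_one] at h1
    have h4 := (hA.sub h1).pos_mul_atTop (sub_pos.mpr (inv_strictAnti₀ ha (by linarith)))
      tendsto_natCast_atTop_atTop
    refine h4.congr' ?_
    filter_upwards [Filter.eventually_gt_atTop 0] with n hn
    field_simp
  constructor
  · intro k
    obtain ⟨J, hJ⟩ := Filter.eventually_atTop.mp ((hlim k).eventually_ge_atTop (-c))
    set L := max J (max j₀ 1) with hL
    -- Before `-M` every customer has index at most `-L`, far enough for both the explicit
    -- departures and the limit above.
    obtain ⟨M, hM⟩ := exists_nat_gt (-A (-(L : ℤ) + 1))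
    filter_upwards [Filter.eventually_ge_atTop M] with m hm
    have hmM : (M : ℝ) ≤ m := by exact_mod_cast hm
    refine h.le_queue ?_
    have hN : lastIndex (-(m : ℝ)) A ≤ -(L : ℤ) := by
      by_contra hlt
      have : -(L : ℤ) + 1 ≤ lastIndex (-(m : ℝ)) A := by omega
      rw [h.regular.le_lastIndex_iff] at this
      linarith
    obtain ⟨j, hj⟩ : ∃ j : ℕ, lastIndex (-(m : ℝ)) A = -((j + 1 : ℕ) : ℤ) := by
      refine ⟨(-lastIndex (-(m : ℝ)) A - 1).toNat, ?_⟩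
      have : 1 ≤ L := by omega
      omega
    rw [hj]
    have hjL : L ≤ j + 1 := by omega
    have h5 := hc (j + 1 + k) (by omega)
    have h6 := hJ (j + 1) (by omega)
    rw [h.renewal_gaps] at h6
    rw [show -((j + 1 : ℕ) : ℤ) + 1 = -(j : ℤ) by push_cast; ring,
      show -((j + 1 : ℕ) : ℤ) - k = -((j + 1 + k : ℕ) : ℤ) by push_cast; ring, h5]
    linarith
  · have h1 := hσ.pos_mul_atTop (by positivity) tendsto_natCast_atTop_atTop
    obtain ⟨j, hj, hj0⟩ := ((h1.eventually_ge_atTop c).and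
      ((Filter.eventually_ge_atTop (max j₀ 1)))).exists
    have : (0 : ℝ) < j := by
      have : 0 < j := by omega
      exact_mod_cast this
    rw [div_mul_cancel₀ _ this.ne'] at hj
    exact ⟨-(j : ℤ), by rw [hc j (by omega)]; linarith⟩

end Path

/-- In equilibrium, the server idled infinitely often in the past. -/
lemma IsEquilibriumMM1.ae_idle [IsProbabilityMeasure P] {a b : ℝ} [ha : Fact (0 < a)]
    [hb : Fact (0 < b)] (hQ : IsEquilibriumMM1 P a (a + b) A σ S) :
    ∀ᵐ ω ∂P, ∀ n₀ : ℤ, ∃ n ≤ n₀, S n ω + σ n ω ≤ A (n + 1) ω := by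
  have hab : Fact (0 < a + b) := ⟨add_pos ha.out hb.out⟩
  have hA : ∀ᵐ ω ∂P, Filter.Tendsto
      (fun n : ℕ => (∑ i ∈ Finset.range n, pastGaps A 0 ω i) / (n : ℝ)) .atTop (𝓝 a⁻¹) :=
    ae_of_past hQ 0 (Measure.quasiMeasurePreserving_fst.ae (iid_exp_slln a))
  have hσ : ∀ᵐ ω ∂P, Filter.Tendsto
      (fun n : ℕ => (∑ i ∈ Finset.range n, pastServices A σ 0 ω i) / (n : ℝ)) .atTop
        (𝓝 (a + b)⁻¹) :=
    ae_of_past hQ 0 (Measure.quasiMeasurePreserving_snd.ae (iid_exp_slln (a + b)))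
  have hbusy : ∀ᵐ ω ∂P, ∀ n₀ : ℤ, (∀ n ≤ n₀, A (n + 1) ω < S n ω + σ n ω) →
      (∀ k : ℕ, ∀ᶠ m : ℕ in .atTop, (k : ℕ∞) ≤ queueLength A S σ (-(m : ℝ)) ω) ∧
        ∃ n₁, S n₁ ω + σ n₁ ω ≤ 0 := by
    filter_upwards [hA, hσ, hQ.ae_path] with ω h1 h2 h3 n₀ hn₀
    refine h3.tendsto_queue_of_busy ha.out hb.out h1 ?_ hn₀
    have : lastCustomer A 0 ω = 0 := h3.lastIndex_zero
    simpa [pastServices, this] using h2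
  -- Some customer has left by time `0` in every case: `hbusy` gives one if the server never idled,
  -- and an idle epoch `n ≤ -1` gives a departure before `A 0 ≤ 0`.
  have hfin : ∀ᵐ ω ∂P, queueLength A S σ 0 ω ≠ ⊤ := by
    filter_upwards [hbusy, hQ.ae_path] with ω h1 h2
    obtain ⟨n₁, hn₁⟩ : ∃ n₁, S n₁ ω + σ n₁ ω ≤ 0 := by
      by_cases h3 : ∀ n ≤ (-1 : ℤ), A (n + 1) ω < S n ω + σ n ω
      · exact (h1 _ h3).2
      · push Not at h3
        obtain ⟨n, hn, hn'⟩ := h3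
        have h4 := h2.regular.1.monotone (show n + 1 ≤ 0 by omega)
        exact ⟨n, hn'.trans (h4.trans h2.zero.1)⟩
    exact h2.queue_ne_top hn₁
  set E : Set Ω := {ω | ∃ n₀ : ℤ, ∀ n ≤ n₀, A (n + 1) ω < S n ω + σ n ω} with hE
  -- On `E` the queue is eventually longer than `k` in the past; stationarity moves this bound to
  -- time `0`, where the finite queue forces `P E = 0` as `k` grows.
  have hle : ∀ k : ℕ, P E ≤ P {ω | (k : ℕ∞) ≤ queueLength A S σ 0 ω} := by
    intro k
    have h1 : P E ≤ P (⋃ M : ℕ, {ω | ∀ m ≥ M, (k : ℕ∞) ≤ queueLength A S σ (-(m : ℝ)) ω}) := by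
      refine measure_mono_ae ?_
      filter_upwards [hbusy] with ω hω
      rintro ⟨n₀, hn₀⟩
      obtain ⟨M, hM⟩ := Filter.eventually_atTop.mp ((hω n₀ hn₀).1 k)
      exact Set.mem_iUnion.mpr ⟨M, hM⟩
    have hmono : Monotone fun M : ℕ =>
        {ω | ∀ m ≥ M, (k : ℕ∞) ≤ queueLength A S σ (-(m : ℝ)) ω} :=
      fun M M' hM ω hω m hm => hω m (hM.trans hm)
    refine h1.trans ?_
    rw [hmono.measure_iUnion]
    refine iSup_le fun M => ?_
    have h2 := (hQ.stationary (-(M : ℝ))).measure_mem_eq (s := {q | (k : ℕ∞) ≤ q}) trivial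
    have h3 : {ω | ∀ m ≥ M, (k : ℕ∞) ≤ queueLength A S σ (-(m : ℝ)) ω} ⊆
        queueLength A S σ (-(M : ℝ)) ⁻¹' {q | (k : ℕ∞) ≤ q} := by
      intro ω hω
      rw [Set.mem_ofPred_eq] at hω
      exact hω M le_rfl
    exact (measure_mono h3).trans h2.le
  have hlim := tendsto_measure_iInter_atTop (μ := P)
    (s := fun k : ℕ => {ω | (k : ℕ∞) ≤ queueLength A S σ 0 ω})
    (fun k => (hQ.stationary 0).aemeasurable_fst.nullMeasurableSet_preimage
      (s := {q | (k : ℕ∞) ≤ q}) trivial)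
    (fun i j hij ω hω => (by exact_mod_cast hij : (i : ℕ∞) ≤ j).trans hω)
    ⟨0, measure_ne_top _ _⟩
  have hzero : P (⋂ k : ℕ, {ω | (k : ℕ∞) ≤ queueLength A S σ 0 ω}) = 0 := by
    refine measure_mono_null (fun ω hω => ?_) (ae_iff.mp hfin)
    simp only [Set.mem_ofPred_eq, not_not]
    exact ENat.eq_top_iff_forall_ge.mpr fun k => Set.mem_iInter.mp hω k
  rw [hzero] at hlim
  have hE0 : P E = 0 := le_antisymm (ge_of_tendsto' hlim hle) bot_le
  have : ∀ᵐ ω ∂P, ω ∉ E := measure_eq_zero_iff_ae_notMem.mp hE0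
  filter_upwards [this] with ω hω n₀
  by_contra! hc
  exact hω ⟨n₀, hc⟩

end MM1

/-! ### Departures and sojourn times expressed through the past. -/

namespace MM1

lemma Stable.shift {e s : ℕ → ℝ} (h : Stable e s) (j : ℕ) :
    Stable (fun i => e (i + j)) fun i => s (i + j) := by
  induction j with
  | zero => exact h
  | succ j ih =>
    have := ih.tail
    have h1 : ∀ f : ℕ → ℝ, (fun i => f (i + (j + 1))) = MM1.tail fun i => f (i + j) := by
      intro f
      ext i
      simp only [MM1.tail]
      congr 1
      ring
    rw [h1, h1]
    exact this

/-- Departures in terms of the sojourn time of the last customer and of the previous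
interdeparture times. -/
lemma Stable.renewal_outputGaps {e s : ℕ → ℝ} (h : Stable e s) (j : ℕ) :
    sojourn e s - renewal (outputGaps e s) j =
      sojourn (fun i => e (i + j)) (fun i => s (i + j)) - renewal e j := by
  induction j with
  | zero => simp [outputGaps]
  | succ j ih =>
    have h1 := (h.shift j).sojourn_eq
    have h2 : ∀ f : ℕ → ℝ, MM1.tail (fun i => f (i + j)) = fun i => f (i + (j + 1)) := by
      intro f
      ext i
      simp only [MM1.tail]
      congr 1
      ring
    rw [h2, h2, zero_add, add_comm 1 j] at h1
    rw [renewal_succ, renewal_succ, ← sub_sub, ih, h1]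
    simp only [outputGaps, cons_succ]
    -- Both cases express `(T - e)⁺ - (e - T)⁺ = T - e`.
    rcases le_total (e (j + 1)) (sojourn (fun i => e (i + (j + 1))) fun i => s (i + (j + 1)))
      with h3 | h3
    · rw [max_eq_left (by linarith), max_eq_right (by linarith)]; ring
    · rw [max_eq_right (by linarith), max_eq_left (by linarith)]; ring

section Path

variable {A σ S : ℤ → ℝ}

/-- The first-in first-out rule is the Lindley recursion for the actual sojourn times, and the idle
epochs select its solution `sojourn`. -/
lemma Path.sojourn_eq (h : Path A σ S) (hidle : ∀ n₀ : ℤ, ∃ n ≤ n₀, S n + σ n ≤ A (n + 1))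
    (t : ℝ) (hst : Stable (steps (backward t A)) fun j => σ (lastIndex t A - j)) (j : ℕ) :
    S (lastIndex t A - j) + σ (lastIndex t A - j) - A (lastIndex t A - j) =
      sojourn (fun i => steps (backward t A) (i + j)) fun i => σ (lastIndex t A - (i + j : ℕ)) := by
  set N := lastIndex t A with hN
  have hstep : ∀ i : ℕ, steps (backward t A) (i + 1) = A (N - i) - A (N - (i + 1 : ℕ)) := by
    intro i
    simp only [steps, cons_succ, backward]
    ring
  have key := Stable.eq_sojourn (T := fun i : ℕ => S (N - (i + j : ℕ)) + σ (N - (i + j : ℕ)) -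
    A (N - (i + j : ℕ))) (hst.shift j) (fun i => ?_) ?_
  · simpa using key
  · rw [show i + 1 + j = i + j + 1 by ring, hstep]
    have h1 := h.fifo (N - (i + j + 1 : ℕ))
    rw [show N - ((i + j + 1 : ℕ) : ℤ) + 1 = N - (i + j : ℕ) by push_cast; ring] at h1
    rw [h1]
    rcases le_total (A (N - (i + j : ℕ)))
      (S (N - (i + j + 1 : ℕ)) + σ (N - (i + j + 1 : ℕ))) with h3 | h3
    · rw [max_eq_right h3, max_eq_left (by linarith)]; ring
    · rw [max_eq_left h3, max_eq_right (by linarith)]; ring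
  · obtain ⟨n, hn, hn'⟩ := hidle (N - j - 1)
    refine ⟨(N - j - 1 - n).toNat, ?_⟩
    have h1 : N - (((N - j - 1 - n).toNat + 1 + j : ℕ) : ℤ) = n := by
      push_cast [Int.toNat_of_nonneg (sub_nonneg.mpr hn)]; ring
    have h2 : N - (((N - j - 1 - n).toNat + j : ℕ) : ℤ) = n + 1 := by
      push_cast [Int.toNat_of_nonneg (sub_nonneg.mpr hn)]; ring
    have h3 : ((N - j - 1 - n).toNat + j + 1) = (N - j - 1 - n).toNat + 1 + j := by ring
    rw [show (N - j - 1 - n).toNat + 1 + j = (N - j - 1 - n).toNat + j + 1 by ring, hstep, h3, h1,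
      h2]
    linarith

lemma Path.departure_eq (h : Path A σ S) (hidle : ∀ n₀ : ℤ, ∃ n ≤ n₀, S n + σ n ≤ A (n + 1))
    (t : ℝ) (hst : Stable (steps (backward t A)) fun j => σ (lastIndex t A - j)) (j : ℕ) :
    S (lastIndex t A - j) + σ (lastIndex t A - j) =
      t + sojourn (steps (backward t A)) (fun j => σ (lastIndex t A - j)) -
        renewal (outputGaps (steps (backward t A)) fun j => σ (lastIndex t A - j)) j := by
  have h1 := h.sojourn_eq hidle t hst j
  have h2 := hst.renewal_outputGaps j
  have h3 := congrFun (renewal_steps (backward t A)) j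
  rw [h3] at h2
  simp only [backward] at h2 h1 ⊢
  linarith

end Path

/-! ### The departure process -/

/-- The points `y - renewal e j`, on the left of `y`, form a Poisson process. -/
lemma iid_exp_card_left (r : ℝ) [hr : Fact (0 < r)] (m : ℕ) {t : ℕ → ℝ} (ht : Monotone t)
    {y : ℝ} (hy : t m ≤ y) (B : ℕ → Set ℕ∞) :
    iid (expMeasure r) {e | ∀ i < m,
        card (fun j => y - renewal e j) (Set.Ioc (t i) (t (i + 1))) ∈ B i} =
      ∏ i ∈ Finset.range m, poisson (r * (t (i + 1) - t i)) (B i) := by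
  have h := iid_exp_card_renewal r m (fun k => y - t (m - k))
    (fun i j hij => by
      have := ht (show m - j ≤ m - i by omega)
      simp only; linarith)
    (by simpa using hy) (fun k => B (m - 1 - k))
  -- Reflection at `y` reverses the order of the intervals and exchanges their closed ends.
  have hset : {e | ∀ i < m, card (fun j => y - renewal e j) (Set.Ioc (t i) (t (i + 1))) ∈ B i} =
      {e | ∀ k < m, card (renewal e) (Set.Ico (y - t (m - k)) (y - t (m - (k + 1)))) ∈
        B (m - 1 - k)} := by
    have hc : ∀ (e : ℕ → ℝ) (u v : ℝ), card (fun j => y - renewal e j) (Set.Ioc u v) =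
        card (renewal e) (Set.Ico (y - v) (y - u)) := by
      intro e u v
      unfold card
      congr 1
      ext j
      simp only [Set.mem_ofPred_eq, Set.mem_Ioc, Set.mem_Ico]
      constructor <;> rintro ⟨h1, h2⟩ <;> constructor <;> linarith
    ext e
    simp only [Set.mem_ofPred_eq, hc]
    constructor
    · intro h1 k hk
      have := h1 (m - 1 - k) (by omega)
      rw [show m - 1 - k + 1 = m - k by omega] at this
      rwa [show m - (k + 1) = m - 1 - k by omega]
    · intro h1 i hi
      have := h1 (m - 1 - i) (by omega)
      rwa [show m - (m - 1 - i) = i + 1 by omega, show m - (m - 1 - i + 1) = i by omega,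
        show m - 1 - (m - 1 - i) = i by omega] at this
  rw [hset, h, ← Finset.prod_range_reflect]
  refine Finset.prod_congr rfl fun i hi => ?_
  have hi' := Finset.mem_range.mp hi
  rw [show m - (m - 1 - i) = i + 1 by omega, show m - (m - 1 - i + 1) = i by omega,
    show m - 1 - (m - 1 - i) = i by omega]
  congr 3
  ring

variable {Ω : Type*} [MeasurableSpace Ω] {P : Measure Ω} {A σ S : ℤ → Ω → ℝ}

lemma measurableSet_card_fun_mem {ι α : Type*} [Countable ι] [MeasurableSpace α]
    {f : α → ι → ℝ} (hf : Measurable f) (t : ℕ → ℝ) (m : ℕ) (B : ℕ → Set ℕ∞) :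
    MeasurableSet {x | ∀ i < m, card (f x) (Set.Ioc (t i) (t (i + 1))) ∈ B i} := by
  have : {x | ∀ i < m, card (f x) (Set.Ioc (t i) (t (i + 1))) ∈ B i} =
      ⋂ i ∈ Set.Iio m, {x | card (f x) (Set.Ioc (t i) (t (i + 1))) ∈ B i} := by
    ext; simp
  rw [this]
  exact MeasurableSet.biInter (Set.to_countable _) fun i _ =>
    ((measurable_card measurableSet_Ioc).comp hf)
      (MeasurableSpace.measurableSet_top (s := B i))

/-- Observed from a time `v` after all the windows, every relevant departure concerns a customer
arrived by `v`. The variable `u` is the sojourn time of the last arrival and `x` the time elapsed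
since then, so the last of these customers leaves at `v + u - x`. -/
lemma IsEquilibriumMM1.measure_departures_eq [IsProbabilityMeasure P] {a b : ℝ}
    [ha : Fact (0 < a)] [hb : Fact (0 < b)] (hQ : IsEquilibriumMM1 P a (a + b) A σ S)
    (m : ℕ) {t : ℕ → ℝ} (ht : Monotone t) (B : ℕ → Set ℕ∞) {v : ℝ} (hv : t m ≤ v) :
    P {ω | ∀ i < m, count (departure S σ) (Set.Ioc (t i) (t (i + 1))) ω ∈ B i} =
      ∫⁻ u, ∫⁻ x, iid (expMeasure a) {e | ∀ i < m,
        card (fun j => v + u - renewal (cons x e) j) (Set.Ioc (t i) (t (i + 1))) ∈ B i}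
          ∂(expMeasure a) ∂(expMeasure b) := by
  have hab : Fact (0 < a + b) := ⟨add_pos ha.out hb.out⟩
  set f : ℝ × (ℕ → ℝ) → ℕ → ℝ := fun p j => v + p.1 - renewal p.2 j with hf
  have hfm : Measurable f := measurable_pi_lambda _ fun j =>
    (measurable_fst.const_add v).sub ((measurable_renewal_apply j).comp measurable_snd)
  have hF := measurableSet_card_fun_mem hfm t m B
  set F := {p | ∀ i < m, card (f p) (Set.Ioc (t i) (t (i + 1))) ∈ B i} with hFdef
  set g : (ℕ → ℝ) × (ℕ → ℝ) → ℝ × (ℕ → ℝ) := fun p => (sojourn p.1 p.2, outputGaps p.1 p.2)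
    with hg
  have hgm : Measurable g := by fun_prop
  have hae : {ω | ∀ i < m, count (departure S σ) (Set.Ioc (t i) (t (i + 1))) ω ∈ B i} =ᵐ[P]
      (fun ω => g (pastGaps A v ω, pastServices A σ v ω)) ⁻¹' F := by
    rw [Filter.eventuallyEq_set]
    filter_upwards [hQ.ae_path, hQ.ae_idle,
      ae_of_past hQ v (ae_stable (lt_add_of_pos_right a hb.out))] with ω h1 h2 h3
    have h4 := h1.departure_eq h2 v h3
    have h5 : ∀ i < m, count (departure S σ) (Set.Ioc (t i) (t (i + 1))) ω =
        card (f (g (pastGaps A v ω, pastServices A σ v ω))) (Set.Ioc (t i) (t (i + 1))) := by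
      intro i hi
      rw [count, encard_lastIndex_sub (lastIndex v fun n => A n ω)
        (fun n => departure S σ n ω ∈ Set.Ioc (t i) (t (i + 1))), card]
      · congr 1
        ext j
        simp only [Set.mem_ofPred_eq, departure]
        rw [h4 j]
        rfl
      · intro n hn
        rw [h1.regular.le_lastIndex_iff]
        have h6 := ht (show i + 1 ≤ m by omega)
        have h7 := h1.arrival_le_start n
        have h8 := h1.service_pos n
        have h9 := hn.2
        simp only [departure] at h7 h8 h9 ⊢
        linarith
    simp only [Set.mem_ofPred_eq, Set.mem_preimage, hFdef]
    exact forall₂_congr fun i hi => by rw [h5 i hi]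
  have hgp : Measurable fun ω => g (pastGaps A v ω, pastServices A σ v ω) :=
    hgm.comp (hQ.measurable_past v)
  rw [measure_congr hae, ← Measure.map_apply hgp hF]
  have hmap : P.map (fun ω => g (pastGaps A v ω, pastServices A σ v ω)) =
      (expMeasure b).prod (iid (expMeasure a)) := by
    rw [← map_sojourn_outputGaps, ← map_past hQ v, Measure.map_map hgm (hQ.measurable_past v)]
    rfl
  rw [hmap, Measure.prod_apply hF]
  refine lintegral_congr fun u => ?_
  rw [iid_apply_cons _ (measurable_prodMk_left hF)]
  rfl

/-- The left side does not involve `v`. As `v` tends to infinity, the last departure `v + u - x`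
passes `t m`, and the earlier ones form a Poisson process on its left. -/
lemma IsEquilibriumMM1.measure_departures [IsProbabilityMeasure P] {a b : ℝ}
    [ha : Fact (0 < a)] [hb : Fact (0 < b)] (hQ : IsEquilibriumMM1 P a (a + b) A σ S)
    (m : ℕ) {t : ℕ → ℝ} (ht : Monotone t) (B : ℕ → Set ℕ∞) :
    P {ω | ∀ i < m, count (departure S σ) (Set.Ioc (t i) (t (i + 1))) ω ∈ B i} =
      ∏ i ∈ Finset.range m, poisson (a * (t (i + 1) - t i)) (B i) := by
  set φ : ℝ → ℝ → ℝ → ℝ≥0∞ := fun v u x => iid (expMeasure a) {e | ∀ i < m,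
    card (fun j => v + u - renewal (cons x e) j) (Set.Ioc (t i) (t (i + 1))) ∈ B i} with hφ
  have hφm : ∀ v, Measurable fun p : ℝ × ℝ => φ v p.1 p.2 := by
    intro v
    have hf : Measurable fun q : (ℝ × ℝ) × (ℕ → ℝ) =>
        fun j => v + q.1.1 - renewal (cons q.1.2 q.2) j := measurable_pi_lambda _ fun j =>
      (measurable_fst.fst.const_add v).sub ((measurable_renewal_apply j).comp
        (by fun_prop : Measurable fun q : (ℝ × ℝ) × (ℕ → ℝ) => cons q.1.2 q.2))
    exact measurable_measure_prodMk_left (measurableSet_card_fun_mem hf t m B)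
  have hφ1 : ∀ v u x, φ v u x ≤ 1 := fun v u x => prob_le_one
  have hφeq : ∀ v u x, t m < v + u - x →
      φ v u x = ∏ i ∈ Finset.range m, poisson (a * (t (i + 1) - t i)) (B i) := by
    intro v u x hx
    rw [← iid_exp_card_left a m ht hx.le B]
    simp only [hφ]
    congr 1
    ext e
    simp only [Set.mem_ofPred_eq]
    refine forall₂_congr fun i hi => ?_
    have : card (fun j => v + u - renewal (cons x e) j) (Set.Ioc (t i) (t (i + 1))) =
        card (fun j => v + u - x - renewal e j) (Set.Ioc (t i) (t (i + 1))) := by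
      unfold card
      rw [← (Nat.succ_injective).encard_image
        {j | v + u - x - renewal e j ∈ Set.Ioc (t i) (t (i + 1))}]
      congr 1
      ext j
      simp only [Set.mem_ofPred_eq, Set.mem_image]
      constructor
      · intro hj
        cases j with
        | zero =>
          have h1 := hj.2
          rw [renewal_zero, cons_zero] at h1
          linarith [ht (show i + 1 ≤ m by omega)]
        | succ j =>
          rw [renewal_cons_succ, ← sub_sub] at hj
          exact ⟨j, hj, rfl⟩
      · rintro ⟨k, hk, rfl⟩
        rw [Nat.succ_eq_add_one, renewal_cons_succ, ← sub_sub]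
        exact hk
    rw [this]
  have hlim : Filter.Tendsto (fun n : ℕ => ∫⁻ p, φ n p.1 p.2 ∂((expMeasure b).prod (expMeasure a)))
      .atTop (𝓝 (∫⁻ _, ∏ i ∈ Finset.range m, poisson (a * (t (i + 1) - t i)) (B i)
        ∂((expMeasure b).prod (expMeasure a)))) := by
    refine tendsto_lintegral_of_dominated_convergence (fun _ => 1) (fun n => hφm n)
      (fun n => .of_forall fun p => hφ1 _ _ _) (by simp) (.of_forall fun p => ?_)
    refine tendsto_const_nhds.congr' ?_
    obtain ⟨M, hM⟩ := exists_nat_gt (t m - p.1 + p.2)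
    filter_upwards [Filter.eventually_ge_atTop M] with n hn
    have : (M : ℝ) ≤ n := by exact_mod_cast hn
    exact (hφeq _ _ _ (by linarith)).symm
  rw [lintegral_const, measure_univ, mul_one] at hlim
  refine tendsto_nhds_unique (tendsto_const_nhds.congr' ?_) hlim
  obtain ⟨M, hM⟩ := exists_nat_gt (t m)
  filter_upwards [Filter.eventually_ge_atTop M] with n hn
  have : (M : ℝ) ≤ n := by exact_mod_cast hn
  rw [hQ.measure_departures_eq m ht B (show t m ≤ n by linarith),
    lintegral_prod _ (hφm n).aemeasurable]

lemma IsEquilibriumMM1.measurable_departure {lam mu : ℝ}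
    (hQ : IsEquilibriumMM1 P lam mu A σ S) :
    Measurable fun ω => fun n => departure S σ n ω :=
  measurable_pi_lambda _ fun n => (hQ.measurable_start n).add (hQ.measurable_service n)

lemma IsEquilibriumMM1.measurable_count_departure {lam mu : ℝ}
    (hQ : IsEquilibriumMM1 P lam mu A σ S) (u v : ℝ) :
    Measurable (count (departure S σ) (Set.Ioc u v)) :=
  (measurable_card measurableSet_Ioc).comp hQ.measurable_departure

lemma IsEquilibriumMM1.measure_count_departure [IsProbabilityMeasure P] {a b : ℝ}
    [ha : Fact (0 < a)] [hb : Fact (0 < b)] (hQ : IsEquilibriumMM1 P a (a + b) A σ S)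
    {u v : ℝ} (huv : u ≤ v) (B : Set ℕ∞) :
    P (count (departure S σ) (Set.Ioc u v) ⁻¹' B) = poisson (a * (v - u)) B := by
  have h := hQ.measure_departures 1 (t := fun i => if i = 0 then u else v)
    (fun i j hij => by
      simp only
      split_ifs <;> first | omega | exact huv | exact le_rfl) (fun _ => B)
  have hset : count (departure S σ) (Set.Ioc u v) ⁻¹' B =
      {ω | count (departure S σ) (Set.Ioc u v) ω ∈ B} := rfl
  rw [hset]
  simpa using h

/-- The departure process is a Poisson process. -/
theorem IsEquilibriumMM1.departure_poisson [IsProbabilityMeasure P] {a b : ℝ}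
    [ha : Fact (0 < a)] [hb : Fact (0 < b)] (hQ : IsEquilibriumMM1 P a (a + b) A σ S) :
    IsPoissonProcess P (departure S σ) a where
  law u v huv := by
    refine ⟨(hQ.measurable_count_departure u v).aemeasurable, Measure.ext fun B hB => ?_⟩
    rw [Measure.map_apply (hQ.measurable_count_departure u v) hB,
      hQ.measure_count_departure huv]
  indep t ht := by
    classical
    rw [iIndepFun_iff_measure_inter_preimage_eq_mul]
    intro s B _
    set m := s.sup id + 1 with hm
    have hsm : s ⊆ Finset.range m := fun i hi => by
      have := Finset.le_sup (f := id) hi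
      simp only [id] at this
      simp [hm]; omega
    have h := hQ.measure_departures m ht (fun i => if i ∈ s then B i else Set.univ)
    have hset : (⋂ i ∈ s, count (departure S σ) (Set.Ioc (t i) (t (i + 1))) ⁻¹' B i) =
        {ω | ∀ i < m, count (departure S σ) (Set.Ioc (t i) (t (i + 1))) ω ∈
          if i ∈ s then B i else Set.univ} := by
      ext ω
      simp only [Set.mem_iInter, Set.mem_preimage, Set.mem_ofPred_eq]
      constructor
      · intro h1 i _
        split_ifs with hi
        · exact h1 i hi
        · trivial
      · intro h1 i hi
        simpa [hi] using h1 i (Finset.mem_range.mp (hsm hi))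
    rw [hset, h, ← Finset.prod_subset hsm (fun i _ hi => by simp [hi])]
    refine Finset.prod_congr rfl fun i hi => ?_
    rw [hQ.measure_count_departure (ht i.le_succ)]
    simp [hi]

end MM1

namespace MM1

/-! ### The law of the time between successive beginnings of service -/

/-- The waiting time of a customer that arrives at the time of observation. -/
noncomputable def wait (e s : ℕ → ℝ) : ℝ := max (sojourn e s - e 0) 0

/-- The time between the beginnings of service of the customer `0` and of a customer that arrives
a time `e 0` later. -/
noncomputable def startGap (e s : ℕ → ℝ) : ℝ := max (e 0 - wait (tail e) (tail s)) (s 0)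

lemma measurable_wait : Measurable fun p : (ℕ → ℝ) × (ℕ → ℝ) => wait p.1 p.2 := by
  unfold wait; fun_prop

lemma measurable_startGap : Measurable fun p : (ℕ → ℝ) × (ℕ → ℝ) => startGap p.1 p.2 := by
  have h : Measurable fun p : (ℕ → ℝ) × (ℕ → ℝ) => wait (tail p.1) (tail p.2) :=
    measurable_wait.comp (by fun_prop : Measurable fun p : (ℕ → ℝ) × (ℕ → ℝ) =>
      (tail p.1, tail p.2))
  unfold startGap
  fun_prop

/-- The stationary law of the waiting time. -/
noncomputable def waitLaw (a b : ℝ) : Measure ℝ :=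
  ((expMeasure b).prod (expMeasure a)).map fun p => max (p.1 - p.2) 0

/-- The stationary law of the time between successive beginnings of service. -/
noncomputable def startGapLaw (a b : ℝ) : Measure ℝ :=
  ((waitLaw a b).prod ((expMeasure a).prod (expMeasure (a + b)))).map
    fun p => max (p.2.1 - p.1) p.2.2

lemma ae_nonneg_waitLaw (a b : ℝ) : ∀ᵐ w ∂(waitLaw a b), 0 ≤ w := by
  rw [waitLaw, ae_map_iff (by fun_prop) measurableSet_Ici]
  exact .of_forall fun p => le_max_right _ _

/-- A maximum of independent variables is at most `y` when both are, which factors the distribution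
function. -/
lemma startGapLaw_Iic (a b : ℝ) [Fact (0 < a)] [Fact (0 < a + b)] (y : ℝ) : startGapLaw a b (Set.Iic y) =
    ((waitLaw a b).prod (expMeasure a)) {p | p.2 - p.1 ≤ y} * expMeasure (a + b) (Set.Iic y) := by
  rw [startGapLaw, Measure.map_apply (by fun_prop) measurableSet_Iic, ← Measure.prod_prod,
    ← (measurePreserving_prodAssoc (waitLaw a b) (expMeasure a)
      (expMeasure (a + b))).measure_preimage_equiv]
  congr 1
  ext p
  simp [MeasurableEquiv.prodAssoc]

lemma lintegral_iid_prod_cons {a c : ℝ} [Fact (0 < a)] [Fact (0 < c)]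
    {f : (ℕ → ℝ) × (ℕ → ℝ) → ℝ≥0∞} (hf : Measurable f) :
    ∫⁻ p, f p ∂((iid (expMeasure a)).prod (iid (expMeasure c))) =
      ∫⁻ q, ∫⁻ x, ∫⁻ y, f (cons x q.1, cons y q.2) ∂(expMeasure c) ∂(expMeasure a)
        ∂((iid (expMeasure a)).prod (iid (expMeasure c))) := by
  have h1 : Measurable fun q : (((ℕ → ℝ) × (ℕ → ℝ)) × ℝ) × ℝ =>
      f (cons q.1.2 q.1.1.1, cons q.2 q.1.1.2) := hf.comp (by fun_prop)
  have h2 := (h1.lintegral_prod_right' (ν := expMeasure (c)))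
  have h3 := (h2.lintegral_prod_right' (ν := expMeasure a))
  rw [lintegral_prod _ hf.aemeasurable, lintegral_prod _ h3.aemeasurable,
    lintegral_iid_cons _ hf.lintegral_prod_right']
  rw [lintegral_lintegral_swap (μ := expMeasure a) (ν := iid (expMeasure a))
    (f := fun x e => ∫⁻ s, f (cons x e, s) ∂(iid (expMeasure c))) (by
      have : Measurable fun q : (ℝ × (ℕ → ℝ)) × (ℕ → ℝ) => f (cons q.1.1 q.1.2, q.2) :=
        hf.comp (by fun_prop)
      exact this.lintegral_prod_right'.aemeasurable)]
  refine lintegral_congr fun e => ?_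
  rw [lintegral_lintegral_swap (μ := iid (expMeasure c)) (ν := expMeasure a)
    (f := fun s x => ∫⁻ y, f (cons x e, cons y s) ∂(expMeasure c))
    (h2.comp (by fun_prop : Measurable fun q : (ℕ → ℝ) × ℝ => ((e, q.1), q.2))).aemeasurable]
  refine lintegral_congr fun x => ?_
  have h4 : Measurable fun s : ℕ → ℝ => f (cons x e, s) := hf.comp measurable_prodMk_left
  refine (lintegral_iid_cons _ h4).trans ?_
  exact lintegral_lintegral_swap (hf.comp (by fun_prop : Measurable fun q : ℝ × (ℕ → ℝ) =>
    (cons x e, cons q.1 q.2))).aemeasurable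

section

variable {a b : ℝ} [ha : Fact (0 < a)] [hb : Fact (0 < b)] [hab : Fact (0 < a + b)]

instance isProbabilityMeasure_waitLaw : IsProbabilityMeasure (waitLaw a b) :=
  Measure.isProbabilityMeasure_map (by fun_prop)

instance isProbabilityMeasure_startGapLaw : IsProbabilityMeasure (startGapLaw a b) :=
  Measure.isProbabilityMeasure_map (by fun_prop)

/-- The entry `0` of `outputGaps` is the elapsed time `e 0` itself; the output theorem thus makes it
independent of the exponential sojourn time. -/
lemma map_wait : ((iid (expMeasure a)).prod (iid (expMeasure (a + b)))).map
    (fun p => wait p.1 p.2) = waitLaw a b := by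
  have h1 := congrArg (Measure.map fun q : ℝ × (ℕ → ℝ) => max (q.1 - q.2 0) 0)
    (map_sojourn_outputGaps (a := a) (b := b))
  rw [Measure.map_map (by fun_prop) (by fun_prop)] at h1
  refine Eq.trans h1 ?_
  have h2 : (fun q : ℝ × (ℕ → ℝ) => max (q.1 - q.2 0) 0) =
      (fun p : ℝ × ℝ => max (p.1 - p.2) 0) ∘ Prod.map id (Function.eval 0) := rfl
  have h3 : Measurable (Prod.map id (Function.eval 0) : ℝ × (ℕ → ℝ) → ℝ × ℝ) :=
    measurable_id.prodMap (measurable_pi_apply 0)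
  rw [h2, ← Measure.map_map (by fun_prop) h3, ← Measure.map_prod_map _ _ measurable_id
    (measurable_pi_apply 0), Measure.map_id,
    (measurePreserving_eval_infinitePi (fun _ : ℕ => expMeasure a) 0).map_eq]
  rfl

/-- The waiting time uses only the tails of both sequences, hence is independent of the leading
interarrival and service times. -/
lemma map_startGap_joint : ((iid (expMeasure a)).prod (iid (expMeasure (a + b)))).map
    (fun p => (p.1 0, startGap p.1 p.2)) =
    ((waitLaw a b).prod ((expMeasure a).prod (expMeasure (a + b)))).map
      fun p => (p.2.1, max (p.2.1 - p.1) p.2.2) := by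
  have hm : Measurable fun p : (ℕ → ℝ) × (ℕ → ℝ) => (p.1 0, startGap p.1 p.2) :=
    Measurable.prodMk (by fun_prop) measurable_startGap
  refine Measure.ext_of_lintegral _ fun f hf => ?_
  have hf1 : Measurable fun q : (ℝ × ℝ) × ℝ => f (q.1.2, max (q.1.2 - q.1.1) q.2) :=
    hf.comp (by fun_prop)
  have hf2 : Measurable fun w : ℝ => ∫⁻ x, ∫⁻ y, f (x, max (x - w) y) ∂(expMeasure (a + b))
      ∂(expMeasure a) :=
    (hf1.lintegral_prod_right' (ν := expMeasure (a + b))).lintegral_prod_right'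
  have hfm : Measurable fun p : (ℕ → ℝ) × (ℕ → ℝ) => f (p.1 0, startGap p.1 p.2) := hf.comp hm
  rw [lintegral_map hf hm, lintegral_map hf (by fun_prop)]
  refine (lintegral_iid_prod_cons hfm).trans (Eq.trans ?_ (lintegral_prod _ (by fun_prop)).symm)
  rw [← map_wait, lintegral_map (by
    have : Measurable fun q : ℝ × (ℝ × ℝ) => f (q.2.1, max (q.2.1 - q.1) q.2.2) :=
      hf.comp (by fun_prop)
    exact this.lintegral_prod_right') measurable_wait]
  refine lintegral_congr fun q => ?_
  rw [lintegral_prod _ (by fun_prop)]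
  rfl

lemma map_startGap : ((iid (expMeasure a)).prod (iid (expMeasure (a + b)))).map
    (fun p => startGap p.1 p.2) = startGapLaw a b := by
  have h := congrArg (Measure.map Prod.snd) (map_startGap_joint (a := a) (b := b))
  rw [Measure.map_map measurable_snd (Measurable.prodMk (by fun_prop) measurable_startGap),
    Measure.map_map measurable_snd (by fun_prop)] at h
  exact h

lemma exp_Iic {r : ℝ} [hr : Fact (0 < r)] {y : ℝ} (hy : 0 ≤ y) :
    expMeasure r (Set.Iic y) = ENNReal.ofReal (1 - Real.exp (-(r * y))) := by
  have h := cdf_expMeasure_eq hr.out y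
  rw [if_pos hy] at h
  rw [← ofReal_cdf, h]

lemma exp_Iic_neg {r : ℝ} [hr : Fact (0 < r)] {y : ℝ} (hy : y < 0) :
    expMeasure r (Set.Iic y) = 0 := by
  have h := cdf_expMeasure_eq hr.out y
  rw [if_neg (not_le.mpr hy)] at h
  rw [← ofReal_cdf, h, ENNReal.ofReal_zero]

lemma exp_Ioi {r : ℝ} [hr : Fact (0 < r)] {y : ℝ} (hy : 0 ≤ y) :
    expMeasure r (Set.Ioi y) = ENNReal.ofReal (Real.exp (-(r * y))) := by
  have h1 : Real.exp (-(r * y)) ≤ 1 := Real.exp_le_one_iff.mpr (by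
    have := hr.out; nlinarith)
  rw [← Set.compl_Iic, prob_compl_eq_one_sub measurableSet_Iic, exp_Iic hy,
    ← ENNReal.ofReal_one, ← ENNReal.ofReal_sub _ (by linarith)]
  congr 1
  ring

lemma exp_Ici {r : ℝ} [hr : Fact (0 < r)] {y : ℝ} (hy : 0 ≤ y) :
    expMeasure r (Set.Ici y) = ENNReal.ofReal (Real.exp (-(r * y))) := by
  rw [← exp_Ioi hy]
  refine measure_congr ?_
  rw [Filter.eventuallyEq_set]
  filter_upwards [ae_ne_exp r y] with x hx
  exact ⟨fun h => lt_of_le_of_ne (Set.mem_Ici.mp h) (Ne.symm hx),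
    fun h => Set.mem_Ici.mpr (le_of_lt (Set.mem_Ioi.mp h))⟩

lemma lintegral_exp_neg_mul (a b : ℝ) [ha : Fact (0 < a)] [hb : Fact (0 < b)] :
    ∫⁻ y, ENNReal.ofReal (Real.exp (-(b * y))) ∂(expMeasure a) =
      ENNReal.ofReal (a / (a + b)) := by
  have : Fact (0 < b + a) := ⟨add_pos hb.out ha.out⟩
  have h := lintegral_exp_mul_exp (a := b) (b := a) hb.out ha.out
    (g := fun _ => 1) measurable_const
  simp only [mul_one, lintegral_one, measure_univ] at h
  rw [h, add_comm b a]

/-- The probability that a waiting customer still waits when the next one arrives. -/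
lemma waitLaw_prod_exp :
    ((waitLaw a b).prod (expMeasure a)) {p | p.2 ≤ p.1} = ENNReal.ofReal ((a / (a + b)) ^ 2) := by
  have hm : MeasurableSet {p : ℝ × ℝ | p.2 ≤ p.1} := measurableSet_le measurable_snd measurable_fst
  rw [Measure.prod_apply_symm hm]
  have h1 : ∀ᵐ x ∂(expMeasure a), waitLaw a b ((fun w => (w, x)) ⁻¹' {p : ℝ × ℝ | p.2 ≤ p.1}) =
      ENNReal.ofReal (a / (a + b)) * ENNReal.ofReal (Real.exp (-(b * x))) := by
    -- Strict positivity of `x` discards the `0` in the maximum: waiting at least `x` then means a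
    -- sojourn time of at least `x + y`.
    filter_upwards [ae_pos_exp a] with x hx
    have hs : MeasurableSet ((fun w : ℝ => (w, x)) ⁻¹' {p : ℝ × ℝ | p.2 ≤ p.1}) :=
      measurable_prodMk_right hm
    rw [waitLaw, Measure.map_apply (by fun_prop) hs,
      Measure.prod_apply_symm ((by fun_prop : Measurable fun p : ℝ × ℝ => max (p.1 - p.2) 0) hs)]
    have h2 : ∀ᵐ y ∂(expMeasure a), expMeasure b ((fun t => (t, y)) ⁻¹'
        ((fun p : ℝ × ℝ => max (p.1 - p.2) 0) ⁻¹' ((fun w : ℝ => (w, x)) ⁻¹'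
          {p : ℝ × ℝ | p.2 ≤ p.1}))) =
        ENNReal.ofReal (Real.exp (-(b * y))) * ENNReal.ofReal (Real.exp (-(b * x))) := by
      filter_upwards [ae_nonneg_exp a] with y hy
      have : ((fun t => (t, y)) ⁻¹' ((fun p : ℝ × ℝ => max (p.1 - p.2) 0) ⁻¹'
          ((fun w : ℝ => (w, x)) ⁻¹' {p : ℝ × ℝ | p.2 ≤ p.1}))) = Set.Ici (x + y) := by
        ext t
        simp only [Set.mem_preimage, Set.mem_ofPred_eq, Set.mem_Ici, le_max_iff]
        constructor
        · rintro (h | h) <;> linarith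
        · intro h
          left; linarith
      rw [this, exp_Ici (by linarith), ← ENNReal.ofReal_mul (by positivity), ← Real.exp_add]
      ring_nf
    rw [lintegral_congr_ae h2, lintegral_mul_const _ (by fun_prop), lintegral_exp_neg_mul]
  have := ha.out
  have := hab.out
  rw [lintegral_congr_ae h1, lintegral_const_mul _ (by fun_prop), lintegral_exp_neg_mul,
    ← ENNReal.ofReal_mul (by positivity), sq]

/-- Memorylessness makes the tail of `X - W` on `[0, ∞)` proportional to `exp (-(a * y))`. -/
lemma waitLaw_prod_exp_le {y : ℝ} (hy : 0 ≤ y) :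
    ((waitLaw a b).prod (expMeasure a)) {p | p.2 - p.1 ≤ y} =
      ENNReal.ofReal (1 - (1 - (a / (a + b)) ^ 2) * Real.exp (-(a * y))) := by
  have hm : ∀ y : ℝ, MeasurableSet {p : ℝ × ℝ | y < p.2 - p.1} := fun y =>
    measurableSet_lt measurable_const (measurable_snd.sub measurable_fst)
  have key : ∀ y : ℝ, 0 ≤ y → ((waitLaw a b).prod (expMeasure a)) {p | y < p.2 - p.1} =
      ENNReal.ofReal (Real.exp (-(a * y))) * ∫⁻ w, ENNReal.ofReal (Real.exp (-(a * w)))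
        ∂(waitLaw a b) := by
    intro y hy
    rw [Measure.prod_apply (hm y), ← lintegral_const_mul _ (by fun_prop)]
    refine lintegral_congr_ae ?_
    filter_upwards [ae_nonneg_waitLaw a b] with w hw
    have : Prod.mk w ⁻¹' {p : ℝ × ℝ | y < p.2 - p.1} = Set.Ioi (y + w) := by
      ext x
      simp only [Set.mem_preimage, Set.mem_ofPred_eq, Set.mem_Ioi]
      constructor <;> intro h <;> linarith
    rw [this, exp_Ioi (by linarith), ← ENNReal.ofReal_mul (by positivity), ← Real.exp_add]
    ring_nf
  have ha0 := ha.out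
  have hb0 := hb.out
  have hρ : 0 ≤ 1 - (a / (a + b)) ^ 2 := by
    rw [sub_nonneg, sq_le_one_iff_abs_le_one, abs_of_nonneg (by positivity), div_le_one hab.out]
    linarith
  -- The factor of proportionality is read off at `y = 0`, where the tail is the probability `1 -
  -- ρ²` that the next customer does not arrive within the waiting time.
  have h0 := key 0 le_rfl
  have h1 : {p : ℝ × ℝ | (0 : ℝ) < p.2 - p.1} = {p : ℝ × ℝ | p.2 ≤ p.1}ᶜ := by
    ext p; simp
  rw [h1, prob_compl_eq_one_sub (measurableSet_le measurable_snd measurable_fst),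
    waitLaw_prod_exp, ← ENNReal.ofReal_one, ← ENNReal.ofReal_sub _ (by positivity)] at h0
  simp only [mul_zero, neg_zero, Real.exp_zero, ENNReal.ofReal_one, one_mul] at h0
  have h2 : {p : ℝ × ℝ | p.2 - p.1 ≤ y} = {p : ℝ × ℝ | y < p.2 - p.1}ᶜ := by
    ext p; simp
  rw [h2, prob_compl_eq_one_sub (hm y), key y hy, ← h0, ← ENNReal.ofReal_mul (by positivity),
    ← ENNReal.ofReal_one, ← ENNReal.ofReal_sub _ (by positivity), mul_comm]

/-- The law of the time between successive beginnings of service is a signed mixture of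
exponential laws. -/
lemma startGapLaw_add : startGapLaw a b + ENNReal.ofReal (1 - (a / (a + b)) ^ 2) •
    expMeasure (a + (a + b)) = expMeasure (a + b) + ENNReal.ofReal (1 - (a / (a + b)) ^ 2) •
      expMeasure a := by
  have ha0 := ha.out
  have hb0 := hb.out
  have : Fact (0 < a + (a + b)) := ⟨by linarith⟩
  have hρ : 0 ≤ 1 - (a / (a + b)) ^ 2 := by
    rw [sub_nonneg, sq_le_one_iff_abs_le_one, abs_of_nonneg (by positivity), div_le_one hab.out]
    linarith
  have hρ1 : 1 - (a / (a + b)) ^ 2 ≤ 1 := by linarith [sq_nonneg (a / (a + b))]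
  have hle : ∀ r y : ℝ, 0 < r → 0 ≤ y → Real.exp (-(r * y)) ≤ 1 := fun r y hr hy =>
    Real.exp_le_one_iff.mpr (by nlinarith)
  have : IsFiniteMeasure (ENNReal.ofReal (1 - (a / (a + b)) ^ 2) • expMeasure (a + (a + b))) :=
    Measure.smul_finite _ ENNReal.ofReal_ne_top
  -- The product of the two distribution functions is expanded. The exponential of parameter `a + (a
  -- + b)` has a negative weight, hence its place on the left of an identity between measures.
  refine Measure.ext_of_Iic _ _ fun y => ?_
  simp only [Measure.add_apply, Measure.smul_apply, smul_eq_mul, startGapLaw_Iic]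
  by_cases hy : 0 ≤ y
  · have e1 := hle a y ha0 hy
    have e2 := hle (a + b) y hab.out hy
    have e3 := hle (a + (a + b)) y (by linarith) hy
    have p1 := Real.exp_pos (-(a * y))
    have p2 := Real.exp_pos (-((a + b) * y))
    have h4 : 0 ≤ 1 - (1 - (a / (a + b)) ^ 2) * Real.exp (-(a * y)) := by
      nlinarith [mul_le_one₀ hρ1 p1.le e1]
    rw [waitLaw_prod_exp_le hy, exp_Iic hy, exp_Iic hy, exp_Iic hy, ← ENNReal.ofReal_mul h4,
      ← ENNReal.ofReal_mul hρ, ← ENNReal.ofReal_mul hρ,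
      ← ENNReal.ofReal_add (mul_nonneg h4 (by linarith)) (mul_nonneg hρ (by linarith)),
      ← ENNReal.ofReal_add (by linarith) (mul_nonneg hρ (by linarith))]
    congr 1
    rw [show -((a + (a + b)) * y) = -(a * y) + -((a + b) * y) by ring, Real.exp_add]
    ring
  · rw [not_le] at hy
    simp [exp_Iic_neg hy]

lemma integrable_cexp_exp (r : ℝ) [hr : Fact (0 < r)] {s : ℂ} (hs : 0 ≤ s.re) :
    Integrable (fun x : ℝ => Complex.exp (-s * x)) (expMeasure r) := by
  refine (integrable_const (1 : ℝ)).mono (by fun_prop) ?_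
  filter_upwards [ae_nonneg_exp r] with x hx
  rw [Complex.norm_exp]
  simp only [norm_one, Complex.mul_re, Complex.neg_re, Complex.ofReal_re, Complex.neg_im,
    Complex.ofReal_im, mul_zero, sub_zero]
  exact Real.exp_le_one_iff.mpr (by nlinarith)

lemma integral_cexp_exp (r : ℝ) [hr : Fact (0 < r)] {s : ℂ} (hs : 0 ≤ s.re) :
    ∫ x : ℝ, Complex.exp (-s * x) ∂(expMeasure r) = r / (r + s) := by
  have h : expMeasure r = volume.withDensity (exponentialPDF r) := rfl
  have hm : Measurable (exponentialPDF r) := (measurable_exponentialPDFReal r).ennreal_ofReal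
  have hlt : ∀ᵐ x, exponentialPDF r x < ∞ := .of_forall fun x => ENNReal.ofReal_lt_top
  have hr0 := hr.out
  have hind : ∀ x : ℝ, (exponentialPDF r x).toReal • Complex.exp (-s * x) =
      (Set.Ici 0).indicator (fun x : ℝ => (r : ℂ) * Complex.exp ((-(r + s)) * x)) x := by
    intro x
    by_cases hx : 0 ≤ x
    · rw [exponentialPDF_of_nonneg hx, ENNReal.toReal_ofReal (by positivity)]
      simp only [Set.indicator, Set.mem_Ici, hx, if_true, Complex.real_smul]
      push_cast
      rw [mul_assoc, ← Complex.exp_add]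
      ring_nf
    · simp [hx, exponentialPDF_of_neg (not_le.mp hx)]
  have hre : (-(r + s) : ℂ).re < 0 := by simp; linarith
  rw [h, integral_withDensity_eq_integral_toReal_smul hm hlt]
  simp_rw [hind]
  rw [integral_indicator measurableSet_Ici, integral_Ici_eq_integral_Ioi, integral_const_mul,
    integral_exp_mul_complex_Ioi hre]
  have : (r + s : ℂ) ≠ 0 := fun h0 => by rw [h0] at hre; simp at hre
  simp only [Complex.ofReal_zero, mul_zero, Complex.exp_zero]
  rw [neg_div_neg_eq, mul_one_div]

lemma integrable_cexp_startGapLaw {s : ℂ} (hs : 0 ≤ s.re) :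
    Integrable (fun x : ℝ => Complex.exp (-s * x)) (startGapLaw a b) := by
  have h : Integrable (fun x : ℝ => Complex.exp (-s * x)) (startGapLaw a b +
      ENNReal.ofReal (1 - (a / (a + b)) ^ 2) • expMeasure (a + (a + b))) := by
    rw [startGapLaw_add]
    exact (integrable_cexp_exp _ hs).add_measure
      ((integrable_cexp_exp _ hs).smul_measure ENNReal.ofReal_ne_top)
  exact h.left_of_add_measure

lemma integral_cexp_startGapLaw {s : ℂ} (hs : 0 ≤ s.re) :
    ∫ x : ℝ, Complex.exp (-s * x) ∂(startGapLaw a b) =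
      a * ((a + b : ℝ) ^ 2 * (a + (a + b : ℝ)) + (a + b : ℝ) * (2 * (a + b : ℝ) + a) * s +
        a * s ^ 2) / ((a + b : ℝ) * (a + s) * ((a + b : ℝ) + s) * (a + (a + b : ℝ) + s)) := by
  have ha0 := ha.out
  have hb0 := hb.out
  have hab0 := hab.out
  have : Fact (0 < a + (a + b)) := ⟨by linarith⟩
  have hρ : 0 ≤ 1 - (a / (a + b)) ^ 2 := by
    rw [sub_nonneg, sq_le_one_iff_abs_le_one, abs_of_nonneg (by positivity), div_le_one hab.out]
    linarith
  have h := congrArg (fun m => ∫ x : ℝ, Complex.exp (-s * x) ∂m)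
    (startGapLaw_add (a := a) (b := b))
  rw [integral_add_measure (integrable_cexp_startGapLaw hs)
      ((integrable_cexp_exp _ hs).smul_measure ENNReal.ofReal_ne_top),
    integral_add_measure (integrable_cexp_exp _ hs)
      ((integrable_cexp_exp _ hs).smul_measure ENNReal.ofReal_ne_top),
    integral_smul_measure, integral_smul_measure, integral_cexp_exp _ hs, integral_cexp_exp _ hs,
    integral_cexp_exp _ hs, ENNReal.toReal_ofReal hρ, Complex.real_smul, Complex.real_smul] at h
  rw [← eq_sub_iff_add_eq] at h
  rw [h]
  have hne : ∀ r : ℝ, 0 < r → (r + s : ℂ) ≠ 0 := fun r hr h0 => by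
    have := congrArg Complex.re h0
    simp at this
    linarith
  have n1 := hne a ha0
  have n2 := hne (a + b) hab0
  have n3 := hne (a + (a + b)) (by linarith)
  have n4 : ((a + b : ℝ) : ℂ) ≠ 0 := by exact_mod_cast hab0.ne'
  push_cast at n2 n3 n4 ⊢
  field_simp
  ring

/-- Equating the transform with `r / (r + s)` gives a polynomial identity of degree three in `s`.
Its cubic and quadratic coefficients impose incompatible values of `r`. -/
lemma startGapLaw_ne_exp (r : ℝ) (hr : 0 < r) : startGapLaw a b ≠ expMeasure r := by
  have ha0 := ha.out
  have hb0 := hb.out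
  have hab0 := hab.out
  have : Fact (0 < r) := ⟨hr⟩
  intro heq
  have key : ∀ s : ℝ, 0 < s →
      a * ((a + b) ^ 2 * (a + (a + b)) + (a + b) * (2 * (a + b) + a) * s + a * s ^ 2) * (r + s) =
        r * ((a + b) * (a + s) * ((a + b) + s) * (a + (a + b) + s)) := by
    intro s hs
    have h1 := integral_cexp_startGapLaw (a := a) (b := b) (s := (s : ℂ)) (by simpa using hs.le)
    rw [heq, integral_cexp_exp r (by simpa using hs.le)] at h1
    have h2 : r / (r + s) = a * ((a + b) ^ 2 * (a + (a + b)) + (a + b) * (2 * (a + b) + a) * s +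
        a * s ^ 2) / ((a + b) * (a + s) * ((a + b) + s) * (a + (a + b) + s)) := by
      exact_mod_cast h1
    rw [div_eq_div_iff (by positivity) (by positivity)] at h2
    linarith
  have k1 := key a ha0
  have k2 := key (2 * a) (by positivity)
  have k3 := key (3 * a) (by positivity)
  -- The difference of the two sides has no constant term, so its values at `a`, `2a`, `3a`
  -- determine it; these combinations extract its `s³` and `s²` coefficients.
  have c3 : a ^ 3 * (a ^ 2 - r * (a + b)) = 0 := by linear_combination k1 / 2 - k2 / 2 + k3 / 6
  have c2 : a ^ 2 * (a * (a + b) * (2 * (a + b) + a) + a ^ 2 * r -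
      2 * r * (a + b) * (a + (a + b))) = 0 := by
    linear_combination -5 / 2 * k1 + 2 * k2 - k3 / 2
  have c3' := (mul_eq_zero.mp c3).resolve_left (by positivity)
  have c2' := (mul_eq_zero.mp c2).resolve_left (by positivity)
  -- Eliminating `r` leaves a product of positive factors.
  have h : a * (b * (a + 2 * b) * (2 * a + b)) = 0 := by
    linear_combination (a + b) * c2' + (a ^ 2 - 2 * (a + b) * (a + (a + b))) * c3'
  have : 0 < a * (b * (a + 2 * b) * (2 * a + b)) := by positivity
  linarith

end

end MM1

namespace MM1

/-! ### The Palm distribution of the time between successive beginnings of service -/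

/-- The relation `(n + 1) p (n + 1) = r p n` reduces the mean to the total mass. -/
lemma lintegral_poissonMeasure (r : ℝ≥0) : ∫⁻ k : ℕ, (k : ℝ≥0∞) ∂(poissonMeasure r) = r := by
  have h1 : ∑' n : ℕ, poissonMeasure r {n} = 1 := by
    have h := lintegral_countable' (μ := poissonMeasure r) fun _ : ℕ => (1 : ℝ≥0∞)
    simpa using h.symm
  have h2 : ∀ n : ℕ, ((n + 1 : ℕ) : ℝ≥0∞) * poissonMeasure r {n + 1} =
      r * poissonMeasure r {n} := by
    intro n
    rw [poissonMeasure_singleton, poissonMeasure_singleton, ← ENNReal.ofReal_natCast,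
      ← ENNReal.ofReal_coe_nnreal, ← ENNReal.ofReal_mul (by positivity),
      ← ENNReal.ofReal_mul (by positivity), Nat.factorial_succ]
    congr 1
    push_cast
    field_simp
    ring
  rw [lintegral_countable', tsum_eq_zero_add' ENNReal.summable]
  simp_rw [h2]
  rw [ENNReal.tsum_mul_left, h1]
  simp

/-- The expected number of points of a renewal process with exponential steps in a unit interval. -/
lemma lintegral_card_renewal (r : ℝ) [hr : Fact (0 < r)] {u : ℝ} (hu : 0 ≤ u) :
    ∫⁻ e, (card (renewal e) (Set.Ico u (u + 1)) : ℝ≥0∞) ∂(iid (expMeasure r)) =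
      ENNReal.ofReal r := by
  have hm : Measurable fun e : ℕ → ℝ => card (renewal e) (Set.Ico u (u + 1)) :=
    (measurable_card measurableSet_Ico).comp measurable_renewal
  have h : (iid (expMeasure r)).map (fun e => card (renewal e) (Set.Ico u (u + 1))) =
      poisson r := by
    refine Measure.ext fun B hB => ?_
    rw [Measure.map_apply hm hB]
    have h := iid_exp_card_renewal r 1 (fun i => if i = 0 then u else u + 1)
      (fun i j hij => by
        simp only
        split_ifs <;> first | omega | linarith) (by simpa using hu) fun _ => B
    have hset : (fun e => card (renewal e) (Set.Ico u (u + 1))) ⁻¹' B =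
      {e | card (renewal e) (Set.Ico u (u + 1)) ∈ B} := rfl
    rw [hset]
    simpa using h
  have hc : Measurable fun k : ℕ∞ => (k : ℝ≥0∞) := by fun_prop
  calc _ = ∫⁻ k, (k : ℝ≥0∞) ∂((iid (expMeasure r)).map
        (fun e => card (renewal e) (Set.Ico u (u + 1)))) := (lintegral_map hc hm).symm
    _ = _ := by
      rw [h, lintegral_map hc (by fun_prop)]
      simp only [ENat.toENNReal_coe]
      exact lintegral_poissonMeasure r.toNNReal

section

variable {a c : ℝ} [ha : Fact (0 < a)] [hc : Fact (0 < c)]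

/-- The first steps of a sequence are independent of the following ones. -/
lemma lintegral_iid_prod_split {F : ℝ × ((ℕ → ℝ) × (ℕ → ℝ)) → ℝ≥0∞} (hF : Measurable F) (j : ℕ) :
    ∫⁻ p, F (∑ i ∈ Finset.range j, p.1 i, (fun i => p.1 (i + j), fun i => p.2 (i + j)))
        ∂((iid (expMeasure a)).prod (iid (expMeasure c))) =
      ∫⁻ e, ∫⁻ p, F (∑ i ∈ Finset.range j, e i, p)
        ∂((iid (expMeasure a)).prod (iid (expMeasure c))) ∂(iid (expMeasure a)) := by
  induction j generalizing F with
  | zero => simp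
  | succ j ih =>
    have hF1 : Measurable fun q : ℝ × (ℝ × ((ℕ → ℝ) × (ℕ → ℝ))) => F (q.1 + q.2.1, q.2.2) :=
      hF.comp (by fun_prop)
    have hF2 : Measurable fun p : (ℕ → ℝ) × (ℕ → ℝ) => F (∑ i ∈ Finset.range (j + 1), p.1 i,
        (fun i => p.1 (i + (j + 1)), fun i => p.2 (i + (j + 1)))) := hF.comp (by fun_prop)
    have hF3 : Measurable fun q : (ℕ → ℝ) × ((ℕ → ℝ) × (ℕ → ℝ)) =>
        F (∑ i ∈ Finset.range (j + 1), q.1 i, q.2) := hF.comp (by fun_prop)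
    have hF4 : Measurable fun q : ((ℕ → ℝ) × (ℕ → ℝ)) × ℝ =>
        F (q.2 + ∑ i ∈ Finset.range j, q.1.1 i,
          (fun i => q.1.1 (i + j), fun i => q.1.2 (i + j))) := hF.comp (by fun_prop)
    have hsum : ∀ (x : ℝ) (e : ℕ → ℝ), ∑ i ∈ Finset.range (j + 1), cons x e i =
        x + ∑ i ∈ Finset.range j, e i := fun x e => by
      rw [Finset.sum_range_succ', add_comm]; rfl
    rw [lintegral_iid_prod_cons hF2, lintegral_iid_cons _ hF3.lintegral_prod_right']
    simp only [hsum]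
    have hy : ∀ (p : (ℕ → ℝ) × (ℕ → ℝ)) (x : ℝ), ∫⁻ y, F (x + ∑ i ∈ Finset.range j, p.1 i,
        (fun i => cons x p.1 (i + (j + 1)), fun i => cons y p.2 (i + (j + 1)))) ∂(expMeasure c) =
        F (x + ∑ i ∈ Finset.range j, p.1 i, (fun i => p.1 (i + j), fun i => p.2 (i + j))) := by
      intro p x
      change ∫⁻ _, F (x + ∑ i ∈ Finset.range j, p.1 i,
        (fun i => p.1 (i + j), fun i => p.2 (i + j))) ∂(expMeasure c) = _
      rw [lintegral_const, measure_univ, mul_one]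
    simp only [hy]
    refine (lintegral_lintegral_swap (μ := (iid (expMeasure a)).prod (iid (expMeasure c)))
      (ν := expMeasure a) (f := fun (p : (ℕ → ℝ) × (ℕ → ℝ)) (x : ℝ) =>
      F (x + ∑ i ∈ Finset.range j, p.1 i, (fun i => p.1 (i + j), fun i => p.2 (i + j))))
      hF4.aemeasurable).trans ?_
    refine lintegral_congr fun x => ?_
    have hF5 : Measurable fun q : ℝ × ((ℕ → ℝ) × (ℕ → ℝ)) => F (x + q.1, q.2) :=
      hF.comp (by fun_prop)
    exact ih hF5

end

section

variable {a b : ℝ} [ha : Fact (0 < a)] [hab : Fact (0 < a + b)]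

/-- The expected number of points of the renewal process `x, x + e 0, x + e 0 + e 1, …` in
`[M, M + 1)`. -/
noncomputable def expectedCount (a M x : ℝ) : ℝ≥0∞ :=
  ∑' j : ℕ, iid (expMeasure a) {e | ∑ i ∈ Finset.range j, e i + x ∈ Set.Ico M (M + 1)}

lemma measurable_expectedCount (M : ℝ) : Measurable (expectedCount a M) := by
  refine Measurable.tsum fun j => ?_
  have h : MeasurableSet {q : ℝ × (ℕ → ℝ) |
      ∑ i ∈ Finset.range j, q.2 i + q.1 ∈ Set.Ico M (M + 1)} :=
    (by fun_prop : Measurable fun q : ℝ × (ℕ → ℝ) => ∑ i ∈ Finset.range j, q.2 i + q.1)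
      measurableSet_Ico
  exact measurable_measure_prodMk_left h

/-- The term `j = 0` is the deterministic point `x`; the others are a renewal process seen from `x`.
-/
lemma expectedCount_eq (M x : ℝ) : expectedCount a M x =
    (Set.Ico M (M + 1)).indicator (fun _ => 1) x +
      ∫⁻ e, (card (renewal e) (Set.Ico (M - x) (M - x + 1)) : ℝ≥0∞) ∂(iid (expMeasure a)) := by
  have hm : ∀ j : ℕ, Measurable fun e : ℕ → ℝ => renewal e j := fun j => by fun_prop
  rw [expectedCount, tsum_eq_zero_add' ENNReal.summable]
  congr 1
  · by_cases hx : x ∈ Set.Ico M (M + 1) <;> simp [hx]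
  · simp_rw [coe_card]
    have hm' : ∀ j : ℕ, Measurable fun e : ℕ → ℝ =>
        (Set.Ico (M - x) (M - x + 1)).indicator (fun _ => (1 : ℝ≥0∞)) (renewal e j) := fun j =>
      (measurable_const.indicator measurableSet_Ico).comp (hm j)
    rw [lintegral_tsum fun j => (hm' j).aemeasurable]
    refine tsum_congr fun j => ?_
    rw [← lintegral_indicator_one]
    · refine lintegral_congr fun e => ?_
      simp only [Set.indicator, Set.mem_ofPred_eq, Set.mem_Ico, renewal, Pi.one_apply]
      congr 1
      rw [eq_iff_iff]
      constructor <;> rintro ⟨h1, h2⟩ <;> constructor <;> linarith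
    · exact (by fun_prop : Measurable fun e : ℕ → ℝ => ∑ i ∈ Finset.range (j + 1), e i + x)
        measurableSet_Ico

lemma expectedCount_of_lt {M x : ℝ} (hx : x < M) : expectedCount a M x = ENNReal.ofReal a := by
  rw [expectedCount_eq, Set.indicator_of_notMem (fun h => absurd h.1 (not_le.mpr hx)), zero_add,
    lintegral_card_renewal a (by linarith)]

/-- A bound uniform in `M` and `x`, for dominated convergence: when `x > M` the window is enlarged
to a unit interval starting at `0`. -/
lemma expectedCount_le (M x : ℝ) : expectedCount a M x ≤ 1 + ENNReal.ofReal a := by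
  rw [expectedCount_eq]
  refine add_le_add (Set.indicator_le_self' (fun _ _ => zero_le_one) x) ?_
  rw [← lintegral_card_renewal a (le_max_right (M - x) 0)]
  refine lintegral_mono_ae ?_
  filter_upwards [ae_proper a] with e he
  have : card (renewal e) (Set.Ico (M - x) (M - x + 1)) ≤
      card (renewal e) (Set.Ico (max (M - x) 0) (max (M - x) 0 + 1)) := by
    refine Set.encard_le_encard fun j hj => ?_
    rw [Set.mem_ofPred_eq] at hj ⊢
    exact ⟨max_le hj.1 (he.ordered_renewal.2 j),
      hj.2.trans_le (add_le_add (le_max_left _ _) le_rfl)⟩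
  exact_mod_cast this

/-- The customers arriving in a unit time window far in the past, and whose start gap lies in
`B`. -/
def farGap (M : ℝ) (B : Set ℝ) (j : ℕ) : Set ((ℕ → ℝ) × (ℕ → ℝ)) :=
  {p | renewal p.1 j ∈ Set.Ico M (M + 1) ∧
    startGap (fun i => p.1 (i + j)) (fun i => p.2 (i + j)) ∈ B}

lemma measurableSet_farGap (M : ℝ) {B : Set ℝ} (hB : MeasurableSet B) (j : ℕ) :
    MeasurableSet (farGap M B j) := by
  have h1 : Measurable fun p : (ℕ → ℝ) × (ℕ → ℝ) => renewal p.1 j :=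
    (measurable_renewal_apply j).comp measurable_fst
  have h2 : Measurable fun p : (ℕ → ℝ) × (ℕ → ℝ) =>
      startGap (fun i => p.1 (i + j)) (fun i => p.2 (i + j)) :=
    measurable_startGap.comp (by fun_prop : Measurable fun p : (ℕ → ℝ) × (ℕ → ℝ) =>
      ((fun i => p.1 (i + j)), fun i => p.2 (i + j)))
  exact (h1 measurableSet_Ico).inter (h2 hB)

/-- The start gap of customer `j` depends only on the sequences from index `j` on. Shifting them to
the origin leaves the independent sum of the first `j` gaps, and summation over `j` produces
`expectedCount`. -/
lemma tsum_farGap (M : ℝ) {B : Set ℝ} (hB : MeasurableSet B) :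
    ∑' j, ((iid (expMeasure a)).prod (iid (expMeasure (a + b)))) (farGap M B j) =
      ∫⁻ p, expectedCount a M (p.1 0) * (startGap p.1 p.2 |> B.indicator fun _ => 1)
        ∂((iid (expMeasure a)).prod (iid (expMeasure (a + b)))) := by
  have hg : Measurable fun p : (ℕ → ℝ) × (ℕ → ℝ) =>
      B.indicator (fun _ => (1 : ℝ≥0∞)) (startGap p.1 p.2) :=
    (measurable_const.indicator hB).comp measurable_startGap
  have hset : ∀ j : ℕ, MeasurableSet {q : ℝ × ((ℕ → ℝ) × (ℕ → ℝ)) |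
      q.1 + q.2.1 0 ∈ Set.Ico M (M + 1) ∧ startGap q.2.1 q.2.2 ∈ B} := fun j =>
    ((by fun_prop : Measurable fun q : ℝ × ((ℕ → ℝ) × (ℕ → ℝ)) => q.1 + q.2.1 0)
      measurableSet_Ico).inter ((measurable_startGap.comp measurable_snd) hB)
  have key : ∀ j, ((iid (expMeasure a)).prod (iid (expMeasure (a + b)))) (farGap M B j) =
      ∫⁻ p, iid (expMeasure a) {e | ∑ i ∈ Finset.range j, e i + p.1 0 ∈ Set.Ico M (M + 1)} *
        B.indicator (fun _ => 1) (startGap p.1 p.2)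
        ∂((iid (expMeasure a)).prod (iid (expMeasure (a + b)))) := by
    intro j
    have hF : Measurable ({q : ℝ × ((ℕ → ℝ) × (ℕ → ℝ)) | q.1 + q.2.1 0 ∈ Set.Ico M (M + 1) ∧
      startGap q.2.1 q.2.2 ∈ B}.indicator (fun _ => (1 : ℝ≥0∞))) :=
      measurable_const.indicator (hset j)
    have h := lintegral_iid_prod_split (a := a) (c := a + b) hF j
    rw [← lintegral_indicator_one (measurableSet_farGap M hB j)]
    refine Eq.trans (lintegral_congr fun p => ?_) (h.trans ?_)
    · have hsum : renewal p.1 j = ∑ i ∈ Finset.range j, p.1 i + p.1 (0 + j) := by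
        rw [zero_add]; exact Finset.sum_range_succ _ j
      have hiff : p ∈ farGap M B j ↔ (∑ i ∈ Finset.range j, p.1 i,
          ((fun i => p.1 (i + j)), fun i => p.2 (i + j))) ∈ {q : ℝ × ((ℕ → ℝ) × (ℕ → ℝ)) |
            q.1 + q.2.1 0 ∈ Set.Ico M (M + 1) ∧ startGap q.2.1 q.2.2 ∈ B} := by
        simp only [farGap, Set.mem_ofPred_eq, hsum]
      by_cases hp : p ∈ farGap M B j
      · rw [Set.indicator_of_mem hp, Set.indicator_of_mem (hiff.mp hp), Pi.one_apply]
      · rw [Set.indicator_of_notMem hp, Set.indicator_of_notMem fun h => hp (hiff.mpr h)]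
    · refine (lintegral_lintegral_swap (μ := iid (expMeasure a))
        (ν := (iid (expMeasure a)).prod (iid (expMeasure (a + b))))
        (f := fun e p => {q : ℝ × ((ℕ → ℝ) × (ℕ → ℝ)) | q.1 + q.2.1 0 ∈ Set.Ico M (M + 1) ∧
          startGap q.2.1 q.2.2 ∈ B}.indicator (fun _ => (1 : ℝ≥0∞))
          (∑ i ∈ Finset.range j, e i, p)) (hF.comp (by fun_prop :
            Measurable fun q : (ℕ → ℝ) × ((ℕ → ℝ) × (ℕ → ℝ)) =>
              (∑ i ∈ Finset.range j, q.1 i, q.2))).aemeasurable).trans ?_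
      refine lintegral_congr fun p => ?_
      by_cases hp : startGap p.1 p.2 ∈ B
      · rw [Set.indicator_of_mem hp, mul_one, ← lintegral_indicator_one]
        · refine lintegral_congr fun e => ?_
          simp [Set.indicator, hp]
        · exact (by fun_prop : Measurable fun e : ℕ → ℝ => ∑ i ∈ Finset.range j, e i + p.1 0)
            measurableSet_Ico
      · simp [Set.indicator, hp]
  simp_rw [key]
  rw [← lintegral_tsum fun j => ?_]
  · refine lintegral_congr fun p => ?_
    rw [ENNReal.tsum_mul_right]
    rfl
  · refine (Measurable.mul ?_ hg).aemeasurable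
    have h : MeasurableSet {q : ((ℕ → ℝ) × (ℕ → ℝ)) × (ℕ → ℝ) |
        ∑ i ∈ Finset.range j, q.2 i + q.1.1 0 ∈ Set.Ico M (M + 1)} :=
      (by fun_prop : Measurable fun q : ((ℕ → ℝ) × (ℕ → ℝ)) × (ℕ → ℝ) =>
        ∑ i ∈ Finset.range j, q.2 i + q.1.1 0) measurableSet_Ico
    exact measurable_measure_prodMk_left h

/-- Once `M` exceeds `e 0`, the expected count is exactly `a`, so position and start gap decouple in
the limit. -/
lemma tendsto_tsum_farGap [hb : Fact (0 < b)] {B : Set ℝ} (hB : MeasurableSet B) :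
    Filter.Tendsto (fun M : ℕ => ∑' j,
      ((iid (expMeasure a)).prod (iid (expMeasure (a + b)))) (farGap M B j)) .atTop
      (𝓝 (ENNReal.ofReal a * startGapLaw a b B)) := by
  have hg : Measurable fun p : (ℕ → ℝ) × (ℕ → ℝ) =>
      B.indicator (fun _ => (1 : ℝ≥0∞)) (startGap p.1 p.2) :=
    (measurable_const.indicator hB).comp measurable_startGap
  have hlim : ENNReal.ofReal a * startGapLaw a b B =
      ∫⁻ p, ENNReal.ofReal a * B.indicator (fun _ => (1 : ℝ≥0∞)) (startGap p.1 p.2)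
        ∂((iid (expMeasure a)).prod (iid (expMeasure (a + b)))) := by
    rw [lintegral_const_mul _ hg, ← map_startGap, Measure.map_apply measurable_startGap hB,
      ← lintegral_indicator_one (measurable_startGap hB)]
    rfl
  rw [hlim]
  simp_rw [fun M : ℝ => tsum_farGap (a := a) (b := b) M hB]
  refine tendsto_lintegral_of_dominated_convergence (fun _ => 1 + ENNReal.ofReal a)
    (fun M => ((measurable_expectedCount (a := a) M).comp (by fun_prop :
      Measurable fun p : (ℕ → ℝ) × (ℕ → ℝ) => p.1 0)).mul hg)
    (fun M => .of_forall fun p => ?_) (by simp) (.of_forall fun p => ?_)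
  · refine (mul_le_mul' (expectedCount_le _ _)
      (Set.indicator_le_self' (fun _ _ => zero_le_one) _)).trans (mul_one _).le
  · refine tendsto_const_nhds.congr' ?_
    obtain ⟨n, hn⟩ := exists_nat_gt (p.1 0)
    filter_upwards [Filter.eventually_ge_atTop n] with M hM
    have : (n : ℝ) ≤ M := by exact_mod_cast hM
    rw [expectedCount_of_lt (by linarith)]

end

/-! ### Start gaps along a sample path. -/

section Path

variable {A σ S : ℤ → ℝ}

/-- Subtracting `S n` in the service rule gives the gap `max (A (n + 1) - S n) (σ n)`, where `S n`
is the arrival plus the waiting time. -/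
lemma Path.interStart_eq (h : Path A σ S) (hidle : ∀ n₀ : ℤ, ∃ n ≤ n₀, S n + σ n ≤ A (n + 1))
    (t : ℝ) (hst : Stable (steps (backward t A)) fun j => σ (lastIndex t A - j)) (k : ℕ) :
    S (lastIndex t A - k) - S (lastIndex t A - (k + 1 : ℕ)) =
      startGap (fun i => steps (backward t A) (i + (k + 1)))
        fun i => σ (lastIndex t A - (i + (k + 1) : ℕ)) := by
  set N := lastIndex t A with hN
  have hstep : ∀ i : ℕ, steps (backward t A) (i + 1) = A (N - i) - A (N - (i + 1 : ℕ)) := by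
    intro i
    simp only [steps, cons_succ, backward]
    ring
  have h1 := h.sojourn_eq hidle t hst (k + 2)
  have h2 := h.fifo (N - (k + 2 : ℕ))
  have h3 := h.fifo (N - (k + 1 : ℕ))
  rw [show N - ((k + 2 : ℕ) : ℤ) + 1 = N - (k + 1 : ℕ) by push_cast; ring] at h2
  rw [show N - ((k + 1 : ℕ) : ℤ) + 1 = N - (k : ℕ) by push_cast; ring] at h3
  have hw : wait (tail fun i => steps (backward t A) (i + (k + 1)))
      (tail fun i => σ (N - (i + (k + 1) : ℕ))) = S (N - (k + 1 : ℕ)) - A (N - (k + 1 : ℕ)) := by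
    have e1 : (tail fun i => steps (backward t A) (i + (k + 1))) =
        fun i => steps (backward t A) (i + (k + 2)) := by
      ext i; simp only [tail]; congr 1; ring
    have e2 : (tail fun i => σ (N - (i + (k + 1) : ℕ))) = fun i => σ (N - (i + (k + 2) : ℕ)) := by
      ext i; simp only [tail]; congr 3; ring
    rw [wait, e1, e2, ← h1]
    beta_reduce
    rw [zero_add, hstep (k + 1), h2]
    rcases le_total (A (N - (k + 1 : ℕ))) (S (N - (k + 2 : ℕ)) + σ (N - (k + 2 : ℕ))) with h4 | h4
    · rw [max_eq_right h4, max_eq_left (by linarith)]; ring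
    · rw [max_eq_left h4, max_eq_right (by linarith)]; ring
  rw [startGap, hw, zero_add, hstep k, h3]
  rcases le_total (A (N - (k : ℕ))) (S (N - (k + 1 : ℕ)) + σ (N - (k + 1 : ℕ))) with h4 | h4
  · rw [max_eq_right h4, max_eq_right (by linarith)]; ring
  · rw [max_eq_left h4, max_eq_left (by linarith)]; ring

end Path

end MM1

/-! ### Identification of the Palm distribution. -/

namespace MM1

section

variable {Ω : Type*} [MeasurableSpace Ω] {P : Measure Ω} {A σ S : ℤ → Ω → ℝ}

lemma IsEquilibriumMM1.measurable_interStart {lam mu : ℝ} (hQ : IsEquilibriumMM1 P lam mu A σ S)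
    (n : ℤ) : Measurable (interStart S n) :=
  (hQ.measurable_start (n + 1)).sub (hQ.measurable_start n)

/-- Almost surely, the times between beginnings of service in terms of the past of time `t`. -/
lemma IsEquilibriumMM1.ae_interStart [IsProbabilityMeasure P] {a b : ℝ} [ha : Fact (0 < a)]
    [hb : Fact (0 < b)] (hQ : IsEquilibriumMM1 P a (a + b) A σ S) (t : ℝ) :
    ∀ᵐ ω ∂P, ∀ k : ℕ, interStart S (lastCustomer A t ω - (k + 1 : ℕ)) ω =
      startGap (fun i => pastGaps A t ω (i + (k + 1)))
        fun i => pastServices A σ t ω (i + (k + 1)) := by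
  have hab : Fact (0 < a + b) := ⟨add_pos ha.out hb.out⟩
  filter_upwards [hQ.ae_path, hQ.ae_idle,
    ae_of_past hQ t (ae_stable (lt_add_of_pos_right a hb.out))] with ω h1 h2 h3 k
  refine Eq.trans ?_ (h1.interStart_eq h2 t h3 k)
  rw [interStart, lastCustomer]
  congr 2
  push_cast
  ring

/-- The expected number of customers arriving in `(0, 1]` and whose start gap lies in `B`. -/
lemma IsEquilibriumMM1.tsum_interStart [IsProbabilityMeasure P] {a b : ℝ} [ha : Fact (0 < a)]
    [hb : Fact (0 < b)] (hQ : IsEquilibriumMM1 P a (a + b) A σ S) {B : Set ℝ}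
    (hB : MeasurableSet B) :
    ∑' n : ℤ, P {ω | A n ω ∈ Set.Ioc 0 1 ∧ interStart S n ω ∈ B} =
      ENNReal.ofReal a * startGapLaw a b B := by
  have hab : Fact (0 < a + b) := ⟨add_pos ha.out hb.out⟩
  set E : ℤ → Set Ω := fun n => {ω | A n ω ∈ Set.Ioc 0 1 ∧ interStart S n ω ∈ B} with hE
  have hEm : ∀ n, MeasurableSet (E n) := fun n =>
    (hQ.measurable_arrival n measurableSet_Ioc).inter (hQ.measurable_interStart n hB)
  -- Seen from time `M + 1`, the window `(0, 1]` becomes the range `[M, M + 1)` of distances.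
  set D : ℕ → ℕ → Set Ω := fun M j => {ω | (pastGaps A (M + 1) ω, pastServices A σ (M + 1) ω) ∈
    farGap M B j} with hD
  have hDm : ∀ M j, MeasurableSet (D M j) := fun M j =>
    (hQ.measurable_past (M + 1)) (measurableSet_farGap M hB j)
  have hDP : ∀ M j, P (D M j) =
      ((iid (expMeasure a)).prod (iid (expMeasure (a + b)))) (farGap M B j) := fun M j => by
    rw [← map_past hQ (M + 1), Measure.map_apply (hQ.measurable_past _)
      (measurableSet_farGap M hB j)]
    rfl
  -- The exceptional event. For the last customer before `M + 1` the backward description replaces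
  -- the next arrival by the observation time; this affects the window only if no arrival occurs for
  -- a time `M`.
  set δ : ℕ → Set Ω := fun M => {ω | (M : ℝ) ≤ pastGaps A (M + 1) ω 0} with hδ
  have hgap : ∀ M : ℕ, Measurable fun ω => pastGaps A (M + 1 : ℝ) ω 0 := fun M =>
    (measurable_pi_apply 0).comp (measurable_fst.comp (hQ.measurable_past (M + 1)))
  have hδm : ∀ M, MeasurableSet (δ M) := fun M => measurableSet_le measurable_const (hgap M)
  have hδP : ∀ M, P (δ M) = ENNReal.ofReal (Real.exp (-(a * M))) := by
    intro M
    rw [← exp_Ici M.cast_nonneg, ← (measurePreserving_eval_infinitePi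
      (fun _ : ℕ => expMeasure a) 0).map_eq, Measure.map_apply (measurable_pi_apply 0)
      measurableSet_Ici]
    have h := congrArg (Measure.map Prod.fst) (map_past hQ (M + 1))
    rw [Measure.map_map measurable_fst (hQ.measurable_past _), Measure.map_fst_prod,
      measure_univ, one_smul] at h
    change _ = iid (expMeasure a) _
    rw [← h, Measure.map_apply (measurable_fst.comp (hQ.measurable_past _))
      (measurable_pi_apply 0 measurableSet_Ici)]
    rfl
  -- The two counts agree from index `1` on; the term of index `0` on either side is at most the
  -- indicator of `δ M`, whose probability vanishes as `M` grows.
  have hsum : ∀ M : ℕ, ∀ᵐ ω ∂P,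
      ∑' n, (E n).indicator (fun _ => (1 : ℝ≥0∞)) ω ≤
        (δ M).indicator (fun _ => 1) ω + ∑' j, (D M j).indicator (fun _ => 1) ω ∧
      ∑' j, (D M j).indicator (fun _ => 1) ω ≤
        (δ M).indicator (fun _ => 1) ω + ∑' n, (E n).indicator (fun _ => (1 : ℝ≥0∞)) ω := by
    intro M
    filter_upwards [hQ.ae_path, hQ.ae_interStart (M + 1)] with ω h1 h2
    set N := lastCustomer A (M + 1) ω with hN
    have hinj : Function.Injective fun j : ℕ => N - (j : ℤ) := fun i j h => by simpa using h
    have hren : ∀ j : ℕ, renewal (pastGaps A (M + 1) ω) j = M + 1 - A (N - j) ω := fun j => by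
      rw [pastGaps, renewal_steps]; rfl
    have hsupp : ∑' n, (E n).indicator (fun _ => (1 : ℝ≥0∞)) ω =
        ∑' j : ℕ, (E (N - j)).indicator (fun _ => (1 : ℝ≥0∞)) ω := by
      refine (hinj.tsum_eq (f := fun n => (E n).indicator (fun _ => (1 : ℝ≥0∞)) ω) ?_).symm
      intro n hn
      have hn' : ω ∈ E n := by
        by_contra h
        exact hn (Set.indicator_of_notMem h _)
      have hle : n ≤ N := (h1.regular.le_lastIndex_iff _ n).mpr
        (hn'.1.2.trans (by linarith [(Nat.cast_nonneg M : (0 : ℝ) ≤ M)]))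
      exact ⟨(N - n).toNat, by simp only [Int.toNat_of_nonneg (sub_nonneg.mpr hle)]; ring⟩
    have hmem : ∀ j : ℕ, A (N - j) ω ∈ Set.Ioc 0 1 ↔
        renewal (pastGaps A (M + 1) ω) j ∈ Set.Ico (M : ℝ) (M + 1) := fun j => by
      rw [hren, Set.mem_Ioc, Set.mem_Ico]
      constructor <;> rintro ⟨h3, h4⟩ <;> constructor <;> linarith
    have htail : ∀ k : ℕ, ω ∈ E (N - (k + 1 : ℕ)) ↔ ω ∈ D M (k + 1) := fun k => by
      simp only [hE, hD, farGap, Set.mem_ofPred_eq, hmem, h2 k]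
    have htail' : ∑' k : ℕ, (E (N - (k + 1 : ℕ))).indicator (fun _ => (1 : ℝ≥0∞)) ω =
        ∑' k : ℕ, (D M (k + 1)).indicator (fun _ => (1 : ℝ≥0∞)) ω := by
      refine tsum_congr fun k => ?_
      by_cases h : ω ∈ D M (k + 1)
      · rw [Set.indicator_of_mem h, Set.indicator_of_mem ((htail k).mpr h)]
      · rw [Set.indicator_of_notMem h, Set.indicator_of_notMem fun h' => h ((htail k).mp h')]
    have h0 : A (N - (0 : ℕ)) ω ∈ Set.Ioc 0 1 → ω ∈ δ M := fun h =>
      ((hmem 0).mp h).1.trans_eq (renewal_zero _)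
    have hz : ∀ s : Set Ω, (ω ∈ s → A (N - (0 : ℕ)) ω ∈ Set.Ioc 0 1) →
        s.indicator (fun _ => (1 : ℝ≥0∞)) ω ≤ (δ M).indicator (fun _ => 1) ω := fun s hs => by
      by_cases h : ω ∈ s
      · rw [Set.indicator_of_mem h, Set.indicator_of_mem (h0 (hs h))]
      · rw [Set.indicator_of_notMem h]
        exact bot_le
    have hz1 := hz (E (N - (0 : ℕ))) fun h => h.1
    have hz2 := hz (D M 0) fun h => (hmem 0).mpr h.1
    rw [hsupp, tsum_eq_zero_add' ENNReal.summable,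
      tsum_eq_zero_add' (f := fun j => (D M j).indicator (fun _ => (1 : ℝ≥0∞)) ω) ENNReal.summable,
      htail']
    exact ⟨add_le_add hz1 (self_le_add_left _ _), add_le_add hz2 (self_le_add_left _ _)⟩
  have hind : ∀ s : ℕ → Set Ω, (∀ j, MeasurableSet (s j)) →
      ∫⁻ ω, ∑' j, (s j).indicator (fun _ => (1 : ℝ≥0∞)) ω ∂P = ∑' j, P (s j) := fun s hs => by
    rw [lintegral_tsum fun j => (measurable_const.indicator (hs j)).aemeasurable]
    simp [lintegral_indicator, hs]
  have hindE : ∫⁻ ω, ∑' n, (E n).indicator (fun _ => (1 : ℝ≥0∞)) ω ∂P = ∑' n, P (E n) := by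
    rw [lintegral_tsum fun j => (measurable_const.indicator (hEm j)).aemeasurable]
    simp [lintegral_indicator, hEm]
  have hindδ : ∀ M, ∫⁻ ω, (δ M).indicator (fun _ => (1 : ℝ≥0∞)) ω ∂P = P (δ M) := fun M => by
    simp [lintegral_indicator, hδm]
  have hδmeas : ∀ M, Measurable ((δ M).indicator (fun _ => (1 : ℝ≥0∞))) := fun M =>
    measurable_const.indicator (hδm M)
  have hle1 : ∀ M, ∑' n, P (E n) ≤ P (δ M) + ∑' j, P (D M j) := fun M => by
    rw [← hindE, ← hind _ (hDm M), ← hindδ, ← lintegral_add_left (hδmeas M)]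
    exact lintegral_mono_ae ((hsum M).mono fun ω h => h.1)
  have hle2 : ∀ M, ∑' j, P (D M j) ≤ P (δ M) + ∑' n, P (E n) := fun M => by
    rw [← hindE, ← hind _ (hDm M), ← hindδ, ← lintegral_add_left (hδmeas M)]
    exact lintegral_mono_ae ((hsum M).mono fun ω h => h.2)
  have hδlim : Filter.Tendsto (fun M => P (δ M)) .atTop (𝓝 0) := by
    simp_rw [hδP]
    rw [← ENNReal.ofReal_zero]
    refine ENNReal.tendsto_ofReal (Real.tendsto_exp_neg_atTop_nhds_zero.comp ?_)
    exact tendsto_natCast_atTop_atTop.const_mul_atTop ha.out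
  have hDlim : Filter.Tendsto (fun M => ∑' j, P (D M j)) .atTop
      (𝓝 (ENNReal.ofReal a * startGapLaw a b B)) := by
    simp_rw [hDP]
    exact tendsto_tsum_farGap hB
  refine le_antisymm ?_ ?_
  · have h := hδlim.add hDlim
    rw [zero_add] at h
    exact ge_of_tendsto' h hle1
  · have h := hδlim.add_const (∑' n, P (E n))
    rw [zero_add] at h
    exact le_of_tendsto_of_tendsto' hDlim h hle2

theorem IsEquilibriumMM1.genericLaw_interStart [IsProbabilityMeasure P] {a b : ℝ}
    [ha : Fact (0 < a)] [hb : Fact (0 < b)] (hQ : IsEquilibriumMM1 P a (a + b) A σ S) :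
    genericLaw P A (interStart S) = startGapLaw a b := by
  have hab : Fact (0 < a + b) := ⟨add_pos ha.out hb.out⟩
  -- The case `B = univ` gives the normalising constant.
  have h1 : ∑' n : ℤ, P {ω | A n ω ∈ Set.Ioc 0 1} = ENNReal.ofReal a := by
    have h := hQ.tsum_interStart MeasurableSet.univ
    simpa using h
  refine Measure.ext fun B hB => ?_
  have h2 : ∀ n : ℤ, (P.restrict {ω | A n ω ∈ Set.Ioc 0 1}).map (interStart S n) B =
      P {ω | A n ω ∈ Set.Ioc 0 1 ∧ interStart S n ω ∈ B} := fun n => by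
    rw [Measure.map_apply (hQ.measurable_interStart n) hB,
      Measure.restrict_apply (hQ.measurable_interStart n hB), Set.inter_comm]
    rfl
  rw [genericLaw, Measure.smul_apply, Measure.sum_apply _ hB, h1, smul_eq_mul]
  simp_rw [h2]
  rw [hQ.tsum_interStart hB, ← mul_assoc, ENNReal.inv_mul_cancel (by simpa using ha.out)
    ENNReal.ofReal_ne_top, one_mul]

end

end MM1

namespace MM1

/-! ### The beginnings of service do not form a Poisson process -/

lemma map_shift_iid_prod {a c : ℝ} [ha : Fact (0 < a)] [hc : Fact (0 < c)] (j : ℕ) :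
    ((iid (expMeasure a)).prod (iid (expMeasure c))).map
      (fun p => ((fun i => p.1 (i + j)), fun i => p.2 (i + j))) =
      (iid (expMeasure a)).prod (iid (expMeasure c)) := by
  refine Measure.ext_of_lintegral _ fun f hf => ?_
  rw [lintegral_map hf (by fun_prop)]
  refine (lintegral_iid_prod_split (a := a) (c := c) (hf.comp measurable_snd) j).trans ?_
  simp

/-- A random shift `m` changes a sum of `n` terms by at most `min m n`, hence its average by a
vanishing amount. -/
lemma sum_range_shift_le {f : ℕ → ℝ≥0∞} (hf : ∀ j, f j ≤ 1) (m n : ℕ) :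
    ∑ j ∈ Finset.range n, f (m + j) ≤ ∑ j ∈ Finset.range n, f j + min (m : ℝ≥0∞) n := by
  have hle : ∀ (g : ℕ → ℝ≥0∞), (∀ j, g j ≤ 1) → ∀ k : ℕ, ∑ j ∈ Finset.range k, g j ≤ k :=
    fun g hg k => (Finset.sum_le_sum fun j _ => hg j).trans (by simp)
  rcases le_total m n with h | h
  · rw [min_eq_left (by exact_mod_cast h)]
    calc _ ≤ ∑ j ∈ Finset.range m, f j + ∑ j ∈ Finset.range n, f (m + j) := self_le_add_left _ _
      _ = ∑ j ∈ Finset.range n, f j + ∑ j ∈ Finset.range m, f (n + j) := by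
        rw [← Finset.sum_range_add, ← Finset.sum_range_add, add_comm]
      _ ≤ _ := add_le_add le_rfl (hle _ (fun j => hf _) m)
  · rw [min_eq_right (by exact_mod_cast h)]
    exact (hle _ (fun j => hf _) n).trans (self_le_add_left _ _)

section

variable {Ω : Type*} [MeasurableSpace Ω] {P : Measure Ω} {A σ S : ℤ → Ω → ℝ}

/-- By the numbering, customer `0` is the last to arrive before time `0`; the gap of an earlier
customer is then a function of a shifted, hence identically distributed, past. -/
lemma IsEquilibriumMM1.measure_interStart [IsProbabilityMeasure P] {a b : ℝ}
    [ha : Fact (0 < a)] [hb : Fact (0 < b)] (hQ : IsEquilibriumMM1 P a (a + b) A σ S)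
    {B : Set ℝ} (hB : MeasurableSet B) (j : ℕ) :
    P (interStart S (-(j + 1 : ℕ)) ⁻¹' B) = startGapLaw a b B := by
  have hab : Fact (0 < a + b) := ⟨add_pos ha.out hb.out⟩
  set g : (ℕ → ℝ) × (ℕ → ℝ) → (ℕ → ℝ) × (ℕ → ℝ) :=
    fun p => ((fun i => p.1 (i + (j + 1))), fun i => p.2 (i + (j + 1))) with hg
  have hgm : Measurable g := by fun_prop
  have h : interStart S (-(j + 1 : ℕ)) ⁻¹' B =ᵐ[P]
      (fun ω => (pastGaps A 0 ω, pastServices A σ 0 ω)) ⁻¹'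
        (g ⁻¹' ((fun p => startGap p.1 p.2) ⁻¹' B)) := by
    rw [Filter.eventuallyEq_set]
    filter_upwards [hQ.ae_path, hQ.ae_interStart 0] with ω h1 h2
    have h3 : lastCustomer A 0 ω = 0 := h1.lastIndex_zero
    have h4 := h2 j
    rw [h3, zero_sub] at h4
    rw [Set.mem_preimage, h4]
    rfl
  rw [measure_congr h, ← Measure.map_apply (hQ.measurable_past 0)
    (hgm (measurable_startGap hB)), map_past hQ 0, ← Measure.map_apply hgm
    (measurable_startGap hB), map_shift_iid_prod, ← Measure.map_apply measurable_startGap hB,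
    map_startGap]

/-- If the beginnings of service formed a Poisson process, then the law of the time between
successive beginnings of service would be exponential. -/
lemma IsEquilibriumMM1.exp_le_startGapLaw [IsProbabilityMeasure P] {a b r : ℝ}
    [ha : Fact (0 < a)] [hb : Fact (0 < b)] [hr : Fact (0 < r)]
    (hQ : IsEquilibriumMM1 P a (a + b) A σ S) (hS : IsPoissonProcess P S r) :
    expMeasure r ≤ startGapLaw a b := by
  have hmono : ∀ᵐ ω ∂P, StrictMono fun n => S n ω :=
    hQ.ae_path.mono fun ω h => h.start_strictMono
  have hSm : Measurable fun ω => fun n => S n ω := measurable_pi_lambda _ hQ.measurable_start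
  -- The index `j + 1` skips step `0`, which is the distance from time `0` to the last beginning of
  -- service, not a gap.
  set g : ℕ → Ω → ℝ := fun j ω => steps (backward 0 fun n => S n ω) (j + 1) with hg
  -- A start never precedes the arrival, so the last start before time `0` concerns a customer of
  -- index `-m ≤ 0`. This random shift separates the gaps before `0` from the gaps of fixed
  -- customers.
  set m : Ω → ℕ := fun ω => (lastIndex 0 fun n => S n ω).natAbs with hm
  have hmm : Measurable m := (measurable_of_countable Int.natAbs).comp
    ((measurable_lastIndex 0).comp hSm)
  have hsm : Measurable fun ω => steps (backward 0 fun n => S n ω) :=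
    measurable_steps.comp ((measurable_backward 0).comp hSm)
  have hgm : ∀ j, Measurable (g j) := fun j => (measurable_pi_apply (j + 1)).comp hsm
  have heq : ∀ᵐ ω ∂P, ∀ j, g j ω = interStart S (-(m ω + j + 1 : ℕ)) ω := by
    filter_upwards [hQ.ae_path, hS.ae_regular hmono] with ω h1 h2 j
    have h3 : lastIndex 0 (fun n => S n ω) ≤ 0 := by
      rw [← h1.lastIndex_zero, h1.regular.le_lastIndex_iff]
      exact (h1.arrival_le_start _).trans (h2.last_le 0)
    have h4 : (lastIndex 0 fun n => S n ω) = -(m ω : ℤ) := by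
      simp only [hm]; omega
    simp only [hg, steps, cons_succ, backward, interStart, h4]
    rw [show -((m ω + j + 1 : ℕ) : ℤ) + 1 = -(m ω : ℤ) - j by push_cast; ring,
      show -((m ω + j + 1 : ℕ) : ℤ) = -(m ω : ℤ) - (j + 1 : ℕ) by push_cast; ring]
    ring
  refine Measure.le_iff.mpr fun B hB => ?_
  have hgP : ∀ j, P (g j ⁻¹' B) = expMeasure r B := by
    intro j
    rw [← (measurePreserving_eval_infinitePi (fun _ : ℕ => expMeasure r) (j + 1)).map_eq,
      Measure.map_apply (measurable_pi_apply (j + 1)) hB]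
    change _ = iid (expMeasure r) _
    rw [← hS.map_steps_backward hQ.measurable_start hmono 0, Measure.map_apply
      hsm (measurable_pi_apply (j + 1) hB)]
    rfl
  set f : ℕ → Ω → ℝ≥0∞ := fun j => (interStart S (-(j + 1 : ℕ)) ⁻¹' B).indicator fun _ => 1
    with hf
  have hfm : ∀ j, Measurable (f j) := fun j =>
    measurable_const.indicator (hQ.measurable_interStart _ hB)
  have hfP : ∀ j, ∫⁻ ω, f j ω ∂P = startGapLaw a b B := fun j => by
    rw [← hQ.measure_interStart hB j]
    exact lintegral_indicator_one (hQ.measurable_interStart _ hB)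
  -- Averaging over `n` successive gaps: each has probability `expMeasure r B` when numbered by time
  -- and `startGapLaw a b B` when numbered by customer. The shift costs `min m n / n`, which tends
  -- to `0` in mean.
  have hmain : ∀ n : ℕ, 0 < n → expMeasure r B ≤
      startGapLaw a b B + ∫⁻ ω, min (m ω : ℝ≥0∞) n / n ∂P := by
    intro n hn
    have h1 : ∫⁻ ω, ∑ j ∈ Finset.range n, (g j ⁻¹' B).indicator (fun _ => (1 : ℝ≥0∞)) ω ∂P ≤
        ∫⁻ ω, (∑ j ∈ Finset.range n, f j ω + min (m ω : ℝ≥0∞) n) ∂P := by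
      refine lintegral_mono_ae ?_
      filter_upwards [heq] with ω hω
      refine Eq.trans_le (Finset.sum_congr rfl fun j _ => ?_) (sum_range_shift_le
        (f := fun j => f j ω) (fun j => Set.indicator_le_self' (fun _ _ => zero_le_one) _) (m ω) n)
      have hiff : ω ∈ g j ⁻¹' B ↔ ω ∈ interStart S (-(m ω + j + 1 : ℕ)) ⁻¹' B := by
        rw [Set.mem_preimage, hω j, Set.mem_preimage]
      by_cases h : ω ∈ g j ⁻¹' B
      · exact (Set.indicator_of_mem h _).trans
          (Set.indicator_of_mem (hiff.mp h) fun _ => (1 : ℝ≥0∞)).symm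
      · exact (Set.indicator_of_notMem h _).trans
          (Set.indicator_of_notMem (fun h0 => h (hiff.mpr h0)) fun _ => (1 : ℝ≥0∞)).symm
    rw [lintegral_add_left (Finset.measurable_sum _ fun j _ => hfm j),
      lintegral_finsetSum _ fun j _ => hfm j,
      lintegral_finsetSum _ fun j _ => measurable_const.indicator (hgm j hB)] at h1
    have h2 : ∀ j, ∫⁻ ω, (g j ⁻¹' B).indicator (fun _ => (1 : ℝ≥0∞)) ω ∂P = expMeasure r B :=
      fun j => (lintegral_indicator_one (hgm j hB)).trans (hgP j)
    simp only [h2, hfP, Finset.sum_const, Finset.card_range, nsmul_eq_mul] at h1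
    have hn0 : (n : ℝ≥0∞) ≠ 0 := by exact_mod_cast hn.ne'
    have hnt : (n : ℝ≥0∞) ≠ ∞ := ENNReal.natCast_ne_top n
    have h3 : ∫⁻ ω, min (m ω : ℝ≥0∞) n ∂P = n * ∫⁻ ω, min (m ω : ℝ≥0∞) n / n ∂P := by
      rw [← lintegral_const_mul' _ _ hnt]
      exact lintegral_congr fun ω => (ENNReal.mul_div_cancel hn0 hnt).symm
    rw [h3, ← mul_add] at h1
    exact (ENNReal.mul_le_mul_iff_right hn0 hnt).mp h1
  have hlim : Filter.Tendsto (fun n : ℕ => ∫⁻ ω, min (m ω : ℝ≥0∞) n / n ∂P) .atTop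
      (𝓝 (∫⁻ _, 0 ∂P)) := by
    have hmE : Measurable fun ω => (m ω : ℝ≥0∞) :=
      (measurable_of_countable fun k : ℕ => (k : ℝ≥0∞)).comp hmm
    refine tendsto_lintegral_of_dominated_convergence (fun _ => 1)
      (fun n => (hmE.min measurable_const).div_const _)
      (fun n => .of_forall fun ω => ?_) (by simp) (.of_forall fun ω => ?_)
    · exact (ENNReal.div_le_div_right (min_le_right _ _) _).trans ENNReal.div_self_le_one
    · have h1 : Filter.Tendsto (fun n : ℕ => (m ω : ℝ≥0∞) / n) .atTop (𝓝 ((m ω : ℝ≥0∞) / ∞)) :=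
        ENNReal.Tendsto.const_div ENNReal.tendsto_nat_nhds_top (.inr (ENNReal.natCast_ne_top _))
      rw [ENNReal.div_top] at h1
      exact tendsto_of_tendsto_of_tendsto_of_le_of_le tendsto_const_nhds h1 (fun n => bot_le)
        fun n => ENNReal.div_le_div_right (min_le_left _ _) _
  have h := hlim.const_add (startGapLaw a b B)
  rw [lintegral_zero, add_zero] at h
  exact ge_of_tendsto h ((Filter.eventually_gt_atTop 0).mono hmain)

theorem IsEquilibriumMM1.not_poisson_start [IsProbabilityMeasure P] {a b : ℝ}
    [ha : Fact (0 < a)] [hb : Fact (0 < b)] (hQ : IsEquilibriumMM1 P a (a + b) A σ S) (r : ℝ) :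
    ¬ IsPoissonProcess P S r := by
  intro hS
  have hab : Fact (0 < a + b) := ⟨add_pos ha.out hb.out⟩
  have hr : Fact (0 < r) := ⟨hS.pos⟩
  -- Between probability measures, domination is equality.
  exact startGapLaw_ne_exp r hr.out
    (Measure.eq_of_le_of_isProbabilityMeasure (hQ.exp_le_startGapLaw hS)).symm

end

end MM1

theorem mainTheorem7 {Ω : Type*} [MeasurableSpace Ω] (P : Measure Ω) [IsProbabilityMeasure P]
    (lam mu : ℝ) (hlam : 0 < lam) (hstable : lam < mu) (A σ S : ℤ → Ω → ℝ)
    (hQ : MM1.IsEquilibriumMM1 P lam mu A σ S) :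
    IsProbabilityMeasure (MM1.genericLaw P A (MM1.interStart S)) ∧
    (∀ s : ℂ, 0 ≤ s.re →
      Integrable (fun x : ℝ => Complex.exp (-s * x)) (MM1.genericLaw P A (MM1.interStart S)) ∧
      ∫ x : ℝ, Complex.exp (-s * x) ∂(MM1.genericLaw P A (MM1.interStart S)) =
        lam * (mu ^ 2 * (lam + mu) + mu * (2 * mu + lam) * s + lam * s ^ 2) /
          (mu * (lam + s) * (mu + s) * (lam + mu + s))) ∧
    (∀ r : ℝ, 0 < r → MM1.genericLaw P A (MM1.interStart S) ≠ expMeasure r) ∧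
    (∀ a : ℝ, ¬ MM1.IsPoissonProcess P S a) ∧
    MM1.IsPoissonProcess P (MM1.departure S σ) lam := by
  -- The variable `b = mu - lam` is the parameter of the stationary sojourn time.
  obtain ⟨b, rfl⟩ : ∃ b, mu = lam + b := ⟨mu - lam, by ring⟩
  have ha : Fact (0 < lam) := ⟨hlam⟩
  have hb : Fact (0 < b) := ⟨by linarith⟩
  have hab : Fact (0 < lam + b) := ⟨by linarith⟩
  rw [hQ.genericLaw_interStart]
  exact ⟨inferInstance, fun s hs => ⟨MM1.integrable_cexp_startGapLaw hs,
    MM1.integral_cexp_startGapLaw hs⟩, MM1.startGapLaw_ne_exp, hQ.not_poisson_start,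
    hQ.departure_poisson⟩
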